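/- **Setting.** Let $\Sigma_0,\Sigma_1$ be three-round public-coin protocols (prover sends $a$, verifier sends a uniformly random challenge $c$, prover sends $z$) with common challenge space $\mathcal C=\{0,1\}^m$. For $b\in\{0,1\}$ the instances, first messages and responses of $\Sigma_b$ are bit strings of lengths $n_b,k_b,l_b$, and $V_b(x,a,c,z)$ is the acceptance predicate of its verifier $\mathcal V_b$. Let $H:\mathcal X\to\mathcal C$ be a hash function on inputs $(b,x_0,x_1,a)\in\mathcal X=\{0,1\}\times\{0,1\}^{n_0}\times\{0,1\}^{n_1}\times\{0,1\}^{\max(k_0,k_1)}$, where shorter strings $a$ are padded with zeros. A *sequential OR-proof* (Liu–Wei–Wong) for $(x_0,x_1)$ is a quadruple $\pi_\vee=(a_0,a_1,z_0,z_1)$, and it is valid if $$V_\vee^H(x_0,x_1,\pi_\vee):=\bigl[V_0(x_0,a_0,H(1,x_0,x_1,a_1),z_0)\wedge V_1(x_1,a_1,H(0,x_0,x_1,a_0),z_1)\bigr]$$ holds. A *$q$-query adversary* $\mathcal A$ consists of an initial unit vector $|\phi_0\rangle$ and operations $A_1,\dots,A_q$ (each a projection followed by a unitary; the projection may be the identity)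 on a finite-dimensional space consisting of the query registers, the output registers for $(x_0,x_1,a_0,a_1,z_0,z_1)$, and a private register. The output $(x_0,x_1,\pi_\vee)\leftarrow\mathcal A^H$ is obtained by measuring the output registers of $A_q\mathcal O^H\cdots A_1\mathcal O^H|\phi_0\rangle$ in the computational basis, where $\mathcal O^H:|c\rangle|x\rangle|y\rangle\mapsto|c\rangle|x\rangle|y\oplus c\cdot H(x)\rangle$ is the controlled oracle. A *black-box interactive prover* $\hat{\mathcal P}$ is a single quantum program, independent of the lengths, of $q$, of $\mathcal A$ and of $V_0,V_1$, which receives $q$ and the lengths $n_0,n_1,k_0,k_1,m,l_0,l_1$ as input. It has classical variables with bounded loops and arithmetic charged in unary, uniform random choices from $\{0,\dots,k-1\}$ (with $k$ charged in unary), work qubits initialised to $|0\rangle$, the NOT, Hadamard, $T=\mathrm{diag}(1,e^{i\pi/4})$, CNOT and Toffoli gates, and computational-basis measurements. Its access to $\mathcal A$ is as follows: $\mathcal A$ starts in $|\phi_0\rangle$; $\hat{\mathcal P}$ may apply the next operation $A_i$ (at unit cost); it may act on the query registers as long as $\mathcal A$ has not finished, and on the output registers once $\mathcal A$ has finished; the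 private register is out of its reach. $\hat{\mathcal P}$ has no access to $H$. In $\langle\hat{\mathcal P}^{\mathcal A},\mathcal V_b\rangle$, $\hat{\mathcal P}^{\mathcal A}$ first outputs a bit $b$ and two instances $x_0,x_1$, and then runs $\Sigma_b$ as the prover on the instance $x_b$: it sends $a$, receives a uniformly random $c\in\mathcal C$ and sends $z$; the verifier's verdict is $v_b=\mathsf{accept}$ iff $V_b(x_b,a,c,z)$ holds. **Theorem.** There exist a black-box interactive prover $\hat{\mathcal P}$ and a polynomial $p$ such that for all lengths $n_0,n_1,k_0,k_1,m,l_0,l_1\ge 0$, all $q\ge 0$ and every $q$-query adversary $\mathcal A$, the prover $\hat{\mathcal P}^{\mathcal A}$ always takes at most $p(s)$ steps and uses at most $p(s)$ work qubits, where $s=q+n_0+n_1+k_0+k_1+m+l_0+l_1$, and for all predicates $V_0,V_1$ and all instances $x_0^\circ,x_1^\circ$, $$\Pr\bigl[x_0=x_0^\circ\wedge x_1=x_1^\circ\wedge v_b=\mathsf{accept}:(b,x_0,x_1,v_b)\leftarrow\langle\hat{\mathcal P}^{\mathcal A},\mathcal V_b\rangle\bigr]\ \ge\ \frac1{(2q+1)^4}\Pr_H\bigl[x_0=x_0^\circ\wedge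 x_1=x_1^\circ\wedge V_\vee^H(x_0,x_1,\pi_\vee):(x_0,x_1,\pi_\vee)\leftarrow\mathcal A^H\bigr],$$ where $H:\mathcal X\to\mathcal C$ is uniformly random. -/

import Mathlib

open scoped BigOperators

noncomputable section

namespace SeqOr

/-! ### Sequential OR proofs -/

/-- Bit strings of length `n`. -/
abbrev Bits (n : ℕ) : Type := Fin n → Bool

/-- The bit lengths of the messages of two three-round public-coin protocols `Σ₀`, `Σ₁`
(indexed by `false`, `true`): instances, first messages and responses, and the common
length of the challenges. -/
structure Sizes where
  inst : Bool → ℕ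
  com : Bool → ℕ
  chal : ℕ
  resp : Bool → ℕ

/-- The sum of all the lengths. -/
def Sizes.total (S : Sizes) : ℕ :=
  S.inst false + S.inst true + S.com false + S.com true + S.chal + S.resp false + S.resp true

/-- The verification predicates `V₀`, `V₁`: `V b x a c z` says that the verifier of `Σ_b` accepts
the transcript `(a, c, z)` for the instance `x`. Nothing else about the protocols matters. -/
abbrev Verifiers (S : Sizes) : Type :=
  (b : Bool) → Bits (S.inst b) → Bits (S.com b) → Bits S.chal → Bits (S.resp b) → Prop

/-- A pair of instances `(x₀, x₁)`. -/
abbrev Instances (S : Sizes) : Type := (b : Bool) → Bits (S.inst b)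

/-- The bit positions of an input `(b, x₀, x₁, a)` of the hash function; the part `a` is long
enough for the first messages of both protocols. -/
inductive HashBit (S : Sizes) : Type
  | sel : HashBit S
  | inst (b : Bool) (i : Fin (S.inst b)) : HashBit S
  | com (i : Fin (max (S.com false) (S.com true))) : HashBit S
  deriving DecidableEq, Fintype

/-- Hash functions `{0,1} × X₀ × X₁ × A → C`. -/
abbrev HashFun (S : Sizes) : Type := (HashBit S → Bool) → Bits S.chal

/-- The hash input `(b, x₀, x₁, a)`, with `a` padded by zeros. -/
def hashInput {S : Sizes} (b : Bool) (x : Instances S) (a : Bits (S.com b)) : HashBit S → Bool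
  | .sel => b
  | .inst b' i => x b' i
  | .com i => if h : (i : ℕ) < S.com b then a ⟨i, h⟩ else false

/-- `V_∨^H(x₀, x₁, (a₀, a₁, z₀, z₁))`: the challenge of `Σ_b` is obtained by hashing the first
message of the other protocol. -/
def ValidOrProof {S : Sizes} (V : Verifiers S) (H : HashFun S) (x : Instances S)
    (a : (b : Bool) → Bits (S.com b)) (z : (b : Bool) → Bits (S.resp b)) : Prop :=
  ∀ b : Bool, V b (x b) (a b) (H (hashInput (!b) x (a (!b)))) (z b)

/-! ### Oracle quantum algorithms -/

/-- The qubits of an adversary that other parties may see: the registers of an oracle query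
`|c⟩|x⟩|y⟩`, and the output registers `(x₀, x₁, a₀, a₁, z₀, z₁)`. -/
inductive AdvQubit (S : Sizes) : Type
  | queryControl : AdvQubit S
  | queryInput (h : HashBit S) : AdvQubit S
  | queryResult (j : Fin S.chal) : AdvQubit S
  | outInst (b : Bool) (i : Fin (S.inst b)) : AdvQubit S
  | outCom (b : Bool) (i : Fin (S.com b)) : AdvQubit S
  | outResp (b : Bool) (i : Fin (S.resp b)) : AdvQubit S
  deriving DecidableEq, Fintype

/-- The computational basis of the adversary's state space; `E` is (a basis of) its private
register. -/
abbrev AdvBasis (S : Sizes) (E : Type) : Type := (AdvQubit S → Bool) × E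

/-- The action of the controlled oracle `|c⟩|x⟩|y⟩ ↦ |c⟩|x⟩|y ⊕ c·H(x)⟩` on basis states. -/
def oracleMap {S : Sizes} {E : Type} (H : HashFun S) (s : AdvBasis S E) : AdvBasis S E :=
  (fun k => match k with
    | .queryResult j =>
      xor (s.1 (.queryResult j)) (s.1 .queryControl && H (fun h => s.1 (.queryInput h)) j)
    | k => s.1 k, s.2)

theorem oracleMap_involutive {S : Sizes} {E : Type} (H : HashFun S) :
    Function.Involutive (oracleMap (E := E) H) := by
  intro s
  refine Prod.ext ?_ rfl
  funext k
  cases k <;> simp [oracleMap]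

/-- The unitary `O^H`, applied to a state. -/
def applyOracle {S : Sizes} {E : Type} (H : HashFun S) (ψ : AdvBasis S E → ℂ) :
    AdvBasis S E → ℂ :=
  fun s => ψ (oracleMap H s)

/-- An oracle quantum algorithm that makes `q` queries: an initial state and `q` operations, each a
projection followed by a unitary (a unitary if the projection is the identity). -/
structure Adversary (S : Sizes) (q : ℕ) (E : Type) [Fintype E] [DecidableEq E] where
  start : AdvBasis S E → ℂ
  start_norm : ∑ s, ‖start s‖ ^ 2 = 1
  step : Fin q → Matrix (AdvBasis S E) (AdvBasis S E) ℂ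
  step_eq : ∀ i, ∃ U ∈ Matrix.unitaryGroup (AdvBasis S E) ℂ,
    ∃ R : Matrix (AdvBasis S E) (AdvBasis S E) ℂ, IsStarProjection R ∧ step i = U * R

section Adversary

variable {S : Sizes} {q : ℕ} {E : Type} [Fintype E] [DecidableEq E]

/-- The final state `A_q O^H ⋯ A_1 O^H |φ₀⟩`. -/
def Adversary.finalState (A : Adversary S q E) (H : HashFun S) : AdvBasis S E → ℂ :=
  (List.finRange q).foldl (fun ψ i => (A.step i).mulVec (applyOracle H ψ)) A.start

open Classical in
/-- The probability, for the fixed function `H`, that measuring the output registers gives the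
instances `x` together with a valid OR-proof for `x`. -/
def Adversary.successGiven (A : Adversary S q E) (V : Verifiers S) (x : Instances S)
    (H : HashFun S) : ℝ :=
  ∑ s : AdvBasis S E,
    if (∀ b i, s.1 (.outInst b i) = x b i) ∧
        ValidOrProof V H x (fun b i => s.1 (.outCom b i)) (fun b i => s.1 (.outResp b i))
    then ‖A.finalState H s‖ ^ 2 else 0

/-- The same probability for a uniformly random `H`. -/
def Adversary.successProb (A : Adversary S q E) (V : Verifiers S) (x : Instances S) : ℝ :=
  (∑ H : HashFun S, A.successGiven V x H) / (Fintype.card (HashFun S) : ℝ)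

end Adversary

/-! ### Quantum programs with black-box access to an adversary

Programs have classical variables that hold natural numbers, work qubits, and access to an
adversary. They have bounded loops only, so that every program terminates; the number of elementary
steps is counted, and classical arithmetic is charged in unary. -/

/-- Arithmetic expressions in the program variables. -/
inductive Expr : Type
  | const (n : ℕ) : Expr
  | var (v : ℕ) : Expr
  | add (e f : Expr) : Expr
  | sub (e f : Expr) : Expr
  | mul (e f : Expr) : Expr
  | div (e f : Expr) : Expr
  | mod (e f : Expr) : Expr

/-- Value of an expression (with truncated subtraction). -/
def Expr.eval (σ : ℕ → ℕ) : Expr → ℕ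
  | .const n => n
  | .var v => σ v
  | .add e f => e.eval σ + f.eval σ
  | .sub e f => e.eval σ - f.eval σ
  | .mul e f => e.eval σ * f.eval σ
  | .div e f => e.eval σ / f.eval σ
  | .mod e f => e.eval σ % f.eval σ

/-- Cost of evaluating an expression: the sum of the values of all subexpressions, plus one for
each of them. -/
def Expr.cost (σ : ℕ → ℕ) : Expr → ℕ
  | .const n => n + 1
  | .var v => σ v + 1
  | .add e f => e.cost σ + f.cost σ + (Expr.add e f).eval σ + 1
  | .sub e f => e.cost σ + f.cost σ + (Expr.sub e f).eval σ + 1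
  | .mul e f => e.cost σ + f.cost σ + (Expr.mul e f).eval σ + 1
  | .div e f => e.cost σ + f.cost σ + (Expr.div e f).eval σ + 1
  | .mod e f => e.cost σ + f.cost σ + (Expr.mod e f).eval σ + 1

/-- The arrays of qubits that a program can address. -/
inductive Bank : Type
  | work : Bank
  | queryControl : Bank
  | querySel : Bank
  | queryInst (b : Bool) : Bank
  | queryCom : Bank
  | queryResult : Bank
  | outInst (b : Bool) : Bank
  | outCom (b : Bool) : Bank
  | outResp (b : Bool) : Bank

/-- A qubit, given by an array and an index into it. -/
structure Loc : Type where
  bank : Bank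
  index : Expr

/-- Elementary gates: Clifford+T together with NOT and the Toffoli gate. -/
inductive Gate : Type
  | not (t : Loc) : Gate
  | hadamard (t : Loc) : Gate
  | phaseT (t : Loc) : Gate
  | cnot (c t : Loc) : Gate
  | toffoli (c d t : Loc) : Gate

/-- Programs. -/
inductive Cmd : Type
  | skip : Cmd
  /-- Sequential composition. -/
  | seq (c d : Cmd) : Cmd
  /-- `v := e`. -/
  | assign (v : ℕ) (e : Expr) : Cmd
  /-- `if e ≠ 0 then c else d`. -/
  | ite (e : Expr) (c d : Cmd) : Cmd
  /-- `for v = 0, …, e - 1 do c`, with `e` evaluated once, at the start. -/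
  | loop (v : ℕ) (e : Expr) (c : Cmd) : Cmd
  /-- `v :=` a uniformly random element of `{0, …, e - 1}` (`v := 0` if `e = 0`). -/
  | rand (v : ℕ) (e : Expr) : Cmd
  /-- Apply a gate. -/
  | gate (g : Gate) : Cmd
  /-- Measure a qubit in the computational basis and store the outcome in `v`. -/
  | measure (v : ℕ) (l : Loc) : Cmd
  /-- Run the adversary from its current query to the next one (or to its final output). -/
  | advance : Cmd
  /-- `v :=` the `e`-th bit of the message received (`v := 0` if there is no such bit). -/
  | read (v : ℕ) (e : Expr) : Cmd
  /-- Append a bit to the message sent: `0` if `e = 0`, and `1` otherwise. -/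
  | send (e : Expr) : Cmd

/-- The qubits of the joint system of a program with `W` work qubits and an adversary. -/
abbrev Qubit (S : Sizes) (W : ℕ) : Type := Fin W ⊕ AdvQubit S

/-- The computational basis of the joint system. -/
abbrev JointBasis (S : Sizes) (W : ℕ) (E : Type) : Type := (Qubit S W → Bool) × E

/-- One branch of an execution: the values of the variables, the number of steps that the adversary
has made, the message sent so far, the time used, and the (subnormalized) quantum state. The branch
has probability `weight * ∑ s, ‖amp s‖ ^ 2`; here `weight` accounts for the random choices, and the
norm of `amp` for the measurement outcomes. -/
structure Branch (S : Sizes) (W : ℕ) (E : Type) where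
  vars : ℕ → ℕ
  advPos : ℕ
  sent : List Bool
  time : ℕ
  weight : ℝ
  amp : JointBasis S W E → ℂ

/-- The `i`-th element of an array of length `n`, if there is one. -/
def arrayIndex (n i : ℕ) : Option (Fin n) := if h : i < n then some ⟨i, h⟩ else none

/-- The qubit with index `i` of an array. The query registers can be accessed only while the
adversary is at a query (`finished = false`), and the output registers only when it has finished. -/
def resolve (S : Sizes) (W : ℕ) (finished : Bool) (k : Bank) (i : ℕ) : Option (Qubit S W) :=
  match k, finished with
  | .work, _ => (arrayIndex W i).map Sum.inl
  | .queryControl, false => if i = 0 then some (.inr .queryControl) else none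
  | .querySel, false => if i = 0 then some (.inr (.queryInput .sel)) else none
  | .queryInst b, false => (arrayIndex (S.inst b) i).map fun j => .inr (.queryInput (.inst b j))
  | .queryCom, false =>
      (arrayIndex (max (S.com false) (S.com true)) i).map fun j => .inr (.queryInput (.com j))
  | .queryResult, false => (arrayIndex S.chal i).map fun j => .inr (.queryResult j)
  | .outInst b, true => (arrayIndex (S.inst b) i).map fun j => .inr (.outInst b j)
  | .outCom b, true => (arrayIndex (S.com b) i).map fun j => .inr (.outCom b j)
  | .outResp b, true => (arrayIndex (S.resp b) i).map fun j => .inr (.outResp b j)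
  | _, _ => none

section Semantics

variable {S : Sizes} {W q : ℕ} {E : Type} [Fintype E] [DecidableEq E]

/-- Let time `n` pass. -/
def Branch.tick (s : Branch S W E) (n : ℕ) : Branch S W E := { s with time := s.time + n }

/-- `v := n`. -/
def Branch.setVar (s : Branch S W E) (v n : ℕ) : Branch S W E :=
  { s with vars := Function.update s.vars v n }

/-- The qubit that `l` stands for. -/
def Branch.locate (q : ℕ) (s : Branch S W E) (l : Loc) : Option (Qubit S W) :=
  resolve S W (decide (q ≤ s.advPos)) l.bank (l.index.eval s.vars)

/-- Set the bit at qubit `k` of a basis state. -/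
def setBit (s : JointBasis S W E) (k : Qubit S W) (v : Bool) : JointBasis S W E :=
  (Function.update s.1 k v, s.2)

/-- Action of a gate on a state. A gate that refers to a nonexistent qubit, or to the same qubit
twice, has no effect. -/
def applyGate (find : Loc → Option (Qubit S W)) (ψ : JointBasis S W E → ℂ) :
    Gate → JointBasis S W E → ℂ
  | .not t => match find t with
    | some k => fun s => ψ (setBit s k (!s.1 k))
    | none => ψ
  | .hadamard t => match find t with
    | some k => fun s =>
        (ψ (setBit s k false) + (if s.1 k then -1 else 1) * ψ (setBit s k true)) / (√2 : ℝ)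
    | none => ψ
  | .phaseT t => match find t with
    | some k => fun s => (if s.1 k then Complex.exp (Real.pi / 4 * Complex.I) else 1) * ψ s
    | none => ψ
  | .cnot c t => match find c, find t with
    | some i, some k =>
        if i ≠ k then fun s => ψ (setBit s k (xor (s.1 k) (s.1 i))) else ψ
    | _, _ => ψ
  | .toffoli c d t => match find c, find d, find t with
    | some i, some j, some k =>
        if i ≠ j ∧ i ≠ k ∧ j ≠ k then fun s => ψ (setBit s k (xor (s.1 k) (s.1 i && s.1 j))) else ψ
    | _, _, _ => ψ

/-- Cost of a gate. -/
def Gate.cost (σ : ℕ → ℕ) : Gate → ℕ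
  | .not t => 1 + t.index.cost σ
  | .hadamard t => 1 + t.index.cost σ
  | .phaseT t => 1 + t.index.cost σ
  | .cnot c t => 1 + c.index.cost σ + t.index.cost σ
  | .toffoli c d t => 1 + c.index.cost σ + d.index.cost σ + t.index.cost σ

/-- Projection onto the states in which qubit `k` has the value `v`. -/
def projectQubit (k : Qubit S W) (v : Bool) (ψ : JointBasis S W E → ℂ) : JointBasis S W E → ℂ :=
  fun s => if s.1 k = v then ψ s else 0

/-- Apply an operator of the adversary to the adversary's part of the joint system. -/
def applyAdv (M : Matrix (AdvBasis S E) (AdvBasis S E) ℂ) (ψ : JointBasis S W E → ℂ) :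
    JointBasis S W E → ℂ :=
  fun s => ∑ t : AdvBasis S E,
    M (fun k => s.1 (.inr k), s.2) t * ψ (Sum.elim (fun k => s.1 (.inl k)) t.1, t.2)

/-- The branches that result from running a program, where `msg` is the message that it received
and `A` the adversary. -/
def exec (A : Adversary S q E) (msg : List Bool) : Cmd → Branch S W E → List (Branch S W E)
  | .skip, s => [s.tick 1]
  | .seq c d, s => (exec A msg c s).flatMap (exec A msg d)
  | .assign v e, s => [(s.setVar v (e.eval s.vars)).tick (1 + e.cost s.vars)]
  | .ite e c d, s =>
      if e.eval s.vars ≠ 0 then exec A msg c (s.tick (1 + e.cost s.vars))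
      else exec A msg d (s.tick (1 + e.cost s.vars))
  | .loop v e c, s =>
      (List.range (e.eval s.vars)).foldl
        (fun L i => L.flatMap fun t => exec A msg c ((t.setVar v i).tick 1))
        [s.tick (1 + e.cost s.vars)]
  | .rand v e, s =>
      if e.eval s.vars = 0 then [(s.setVar v 0).tick (1 + e.cost s.vars)]
      else (List.range (e.eval s.vars)).map fun i =>
        { (s.setVar v i).tick (1 + e.cost s.vars) with
          weight := s.weight / (e.eval s.vars : ℝ) }
  | .gate g, s =>
      [{ s.tick (g.cost s.vars) with amp := applyGate (s.locate q) s.amp g }]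
  | .measure v l, s =>
      match s.locate q l with
      | some k => [false, true].map fun r =>
          { (s.setVar v r.toNat).tick (1 + l.index.cost s.vars) with
            amp := projectQubit k r s.amp }
      | none => [(s.setVar v 0).tick (1 + l.index.cost s.vars)]
  | .advance, s =>
      if h : s.advPos < q then
        [{ s.tick 1 with advPos := s.advPos + 1, amp := applyAdv (A.step ⟨s.advPos, h⟩) s.amp }]
      else [s.tick 1]
  | .read v e, s =>
      [(s.setVar v (msg.getD (e.eval s.vars) false).toNat).tick (1 + e.cost s.vars)]
  | .send e, s =>
      [{ s.tick (1 + e.cost s.vars) with sent := s.sent ++ [decide (e.eval s.vars ≠ 0)] }]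

/-- The input of a program: the number of queries and the message lengths. -/
def inputVars (S : Sizes) (q : ℕ) (v : ℕ) : ℕ :=
  [q, S.inst false, S.inst true, S.com false, S.com true, S.chal,
    S.resp false, S.resp true].getD v 0

open Classical in
/-- The initial branch: all work qubits are `|0⟩`, and the adversary is in its initial state. -/
def startBranch (A : Adversary S q E) (W : ℕ) : Branch S W E where
  vars := inputVars S q
  advPos := 0
  sent := []
  time := 0
  weight := 1
  amp := fun s =>
    if ∀ k, s.1 (.inl k) = false then A.start (fun k => s.1 (.inr k), s.2) else 0

/-- The probability of a branch. -/
def Branch.prob (s : Branch S W E) : ℝ := s.weight * ∑ k, ‖s.amp k‖ ^ 2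

end Semantics

/-! ### The interactive prover -/

/-- An interactive prover: a program that announces the bit `b` and the instances `x₀`, `x₁`, a
program that sends the first message of `Σ_b`, and a program that receives the challenge and sends
the response. The programs are run one after the other on the same memory. -/
structure Prover where
  announce : Cmd
  commit : Cmd
  respond : Cmd

/-- The outcome of a run: what was sent in each of the phases, and the final branch. -/
structure Outcome (S : Sizes) (W : ℕ) (E : Type) where
  announced : List Bool
  committed : List Bool
  responded : List Bool
  final : Branch S W E

section Prover

variable {S : Sizes} {q : ℕ} {E : Type} [Fintype E] [DecidableEq E]

/-- All the possible outcomes of running the prover with black-box access to `A` and with `W` work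
qubits, when the challenge is `c`. The challenge becomes available only after the first message has
been sent. -/
def Prover.runs (P : Prover) (A : Adversary S q E) (W : ℕ) (c : Bits S.chal) :
    List (Outcome S W E) :=
  (exec A [] P.announce (startBranch A W)).flatMap fun s =>
    (exec A [] P.commit { s with sent := [] }).flatMap fun t =>
      (exec A (List.ofFn c) P.respond { t with sent := [] }).map fun u =>
        ⟨s.sent, t.sent, u.sent, u⟩

/-- The prover has announced some bit `b` and the instances `x = (x₀, x₁)`, and the verifier of
`Σ_b` accepts the transcript for the instance `x_b`. -/
def Outcome.Success {W : ℕ} (o : Outcome S W E) (V : Verifiers S) (x : Instances S)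
    (c : Bits S.chal) : Prop :=
  ∃ (b : Bool) (a : Bits (S.com b)) (z : Bits (S.resp b)),
    o.announced = [b] ++ List.ofFn (x false) ++ List.ofFn (x true) ∧
    o.committed = List.ofFn a ∧ o.responded = List.ofFn z ∧ V b (x b) a c z

open Classical in
/-- The probability of success when the challenge is chosen uniformly at random. -/
def Prover.successProb (P : Prover) (A : Adversary S q E) (W : ℕ) (V : Verifiers S)
    (x : Instances S) : ℝ :=
  (∑ c : Bits S.chal,
      ((P.runs A W c).map fun o => if o.Success V x c then o.final.prob else 0).sum) /
    (Fintype.card (Bits S.chal) : ℝ)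

/-- The prover runs in time at most `T`, on all branches and for all challenges. -/
def Prover.RunsInTime (P : Prover) (A : Adversary S q E) (W T : ℕ) : Prop :=
  ∀ (c : Bits S.chal), ∀ o ∈ P.runs A W c, o.final.time ≤ T

end Prover

end SeqOr

end

open scoped BigOperators

noncomputable section

namespace SeqOr

/-! ### Polynomial running time -/

/-! The proof is a measure-and-reprogram argument for two points. Let h_β = (β, x₀, x₁, a_β) be the
two hash inputs that an OR-proof determines. They differ in the selector bit, so resetting a uniform
H at h_0 and h_1 to independent uniform values Θ_0, Θ_1 leaves it uniform (`sum_reprogram`). The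
original and the reprogrammed oracle differ only on queries at the reprogrammed point. Telescoping
over the q queries therefore writes the final state as a signed sum of 2q+1 hybrids: in each, the
point is observed at one query, or only in the final output, and the new value is in force from that
query on or from the next one. For both points there are (2q+1)² hybrids, indexed by κ
(`Adversary.finalState_reprogram`). Cauchy–Schwarz costs a factor (2q+1)²
(`Adversary.successProb_le`), and the prover's uniform guess of κ costs another.

In a fixed hybrid let b be the index of the point that is observed first. This point contains x₀, x₁
and a_b, which is what the prover has to announce and commit to. The challenge that Σ_b answers is
the value Θ_{!b} at the other point, and it has no influence before the first observation
(`Adversary.preIdeal_congr`, `Adversary.simulated_clearVal`). So the verifier's challenge can be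
inserted there at that time, while Θ_b is chosen by the prover.

The prover has no H. For fixed points and values, the amplitudes of a hybrid have degree at most q
in the values of H, so averages of their squared moduli do not change when H is drawn from a
(2q+1)-wise independent family (`Adversary.sum_norm_ideal`). The family reads an input as a
polynomial over F₂ and applies random linear functionals to the coefficients of its powers 0, …, 2q.
Its independence is a Vandermonde argument over F₂[X], and evaluating it takes only polynomial
multiplication, no finite-field reduction.

The simulation is coherent. Hadamard gates put the coefficients of the functionals and Θ_b into
uniform superposition, an observation is a CNOT copy into a cleared register, and the oracle is a
reversible circuit that is computed, used and uncomputed. The invariant `Branch.Simulates` gives the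
amplitudes on those memory contents that matter. All branches have nonnegative probability, so
keeping only these yields a lower bound (`le_successProb_prover`). The running time is bounded
syntactically, from the shape of the program (`Cmd.exists_time_le`). -/

theorem eval_nat_mono (p : Polynomial ℕ) : Monotone fun n : ℕ => p.eval n := by
  induction p using Polynomial.induction_on' with
  | add p r hp hr =>
    intro a b h
    simpa using add_le_add (hp h) (hr h)
  | monomial n a =>
    intro x y h
    simp only [Polynomial.eval_monomial]
    exact Nat.mul_le_mul_left _ (Nat.pow_le_pow_left h n)

/-- The value of the expression is bounded in terms of the program inputs alone. -/
def Expr.inputBounded : Expr → Bool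
  | .const _ => true
  | .var v => decide (v < 8)
  | .add e f => e.inputBounded && f.inputBounded
  | .mul e f => e.inputBounded && f.inputBounded
  | .sub e _ => e.inputBounded
  | .div e _ => e.inputBounded
  | .mod e _ => e.inputBounded

def Expr.isVar : Expr → Bool
  | .var _ => true
  | _ => false

/-- No input variable is overwritten, and every loop bound and every assigned value is bounded in
terms of the inputs. -/
def Cmd.tame : Cmd → Bool
  | .skip => true
  | .seq c d => c.tame && d.tame
  | .assign v e => decide (8 ≤ v) && (e.inputBounded || e.isVar)
  | .ite _ c d => c.tame && d.tame
  | .loop v e c => decide (8 ≤ v) && e.inputBounded && c.tame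
  | .rand v e => decide (8 ≤ v) && e.inputBounded
  | .gate _ => true
  | .measure v _ => decide (8 ≤ v)
  | .advance => true
  | .read v _ => decide (8 ≤ v)
  | .send _ => true

/-- Truncated subtraction, division and remainder never exceed their first operand, so the second
one may contain arbitrary variables. -/
theorem Expr.exists_eval_le (e : Expr) (he : e.inputBounded = true) :
    ∃ B : Polynomial ℕ, ∀ (σ : ℕ → ℕ) (N : ℕ), (∀ v < 8, σ v ≤ N) → e.eval σ ≤ B.eval N := by
  induction e with
  | const n => exact ⟨Polynomial.C n, fun σ N _ => by simp [Expr.eval]⟩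
  | var v =>
    have hv : v < 8 := by simpa [Expr.inputBounded] using he
    exact ⟨Polynomial.X, fun σ N h => by simpa [Expr.eval] using h v hv⟩
  | add e f ihe ihf =>
    simp only [Expr.inputBounded, Bool.and_eq_true] at he
    obtain ⟨B, hB⟩ := ihe he.1
    obtain ⟨D, hD⟩ := ihf he.2
    exact ⟨B + D, fun σ N h => by simpa [Expr.eval] using add_le_add (hB σ N h) (hD σ N h)⟩
  | mul e f ihe ihf =>
    simp only [Expr.inputBounded, Bool.and_eq_true] at he
    obtain ⟨B, hB⟩ := ihe he.1
    obtain ⟨D, hD⟩ := ihf he.2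
    exact ⟨B * D, fun σ N h => by simpa [Expr.eval] using Nat.mul_le_mul (hB σ N h) (hD σ N h)⟩
  | sub e f ihe ihf =>
    obtain ⟨B, hB⟩ := ihe he
    exact ⟨B, fun σ N h => (Nat.sub_le _ _).trans (hB σ N h)⟩
  | div e f ihe ihf =>
    obtain ⟨B, hB⟩ := ihe he
    exact ⟨B, fun σ N h => (Nat.div_le_self _ _).trans (hB σ N h)⟩
  | mod e f ihe ihf =>
    obtain ⟨B, hB⟩ := ihe he
    exact ⟨B, fun σ N h => (Nat.mod_le _ _).trans (hB σ N h)⟩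

theorem Expr.exists_cost_le (e : Expr) :
    ∃ p : Polynomial ℕ, ∀ (σ : ℕ → ℕ) (M : ℕ), (∀ v, σ v ≤ M) →
      e.cost σ ≤ p.eval M ∧ e.eval σ ≤ p.eval M := by
  induction e with
  | const n => exact ⟨Polynomial.C (n + 1), fun σ N _ => by simp [Expr.eval, Expr.cost]⟩
  | var v =>
    refine ⟨Polynomial.X + 1, fun σ N h => ?_⟩
    have := h v
    simp [Expr.eval, Expr.cost]
    omega
  | add e f ihe ihf | sub e f ihe ihf | div e f ihe ihf | mod e f ihe ihf =>
    obtain ⟨B, hB⟩ := ihe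
    obtain ⟨D, hD⟩ := ihf
    refine ⟨2 * B + 2 * D + 1, fun σ N h => ?_⟩
    obtain ⟨h1, h2⟩ := hB σ N h
    obtain ⟨h3, h4⟩ := hD σ N h
    have := Nat.div_le_self (e.eval σ) (f.eval σ)
    have := Nat.mod_le (e.eval σ) (f.eval σ)
    simp [Expr.eval, Expr.cost]
    omega
  | mul e f ihe ihf =>
    obtain ⟨B, hB⟩ := ihe
    obtain ⟨D, hD⟩ := ihf
    refine ⟨B + D + B * D + 1, fun σ N h => ?_⟩
    obtain ⟨h1, h2⟩ := hB σ N h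
    obtain ⟨h3, h4⟩ := hD σ N h
    have := Nat.mul_le_mul h2 h4
    simp [Expr.eval, Expr.cost]
    omega

theorem Gate.exists_cost_le (g : Gate) :
    ∃ p : Polynomial ℕ, ∀ (σ : ℕ → ℕ) (M : ℕ), (∀ v, σ v ≤ M) → g.cost σ ≤ p.eval M := by
  cases g with
  | not t | hadamard t | phaseT t =>
    obtain ⟨p, hp⟩ := t.index.exists_cost_le
    exact ⟨1 + p, fun σ M h => by simpa [Gate.cost] using (hp σ M h).1⟩
  | cnot c t =>
    obtain ⟨p, hp⟩ := c.index.exists_cost_le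
    obtain ⟨r, hr⟩ := t.index.exists_cost_le
    refine ⟨1 + p + r, fun σ M h => ?_⟩
    have := (hp σ M h).1
    have := (hr σ M h).1
    simp [Gate.cost]
    omega
  | toffoli c d t =>
    obtain ⟨p, hp⟩ := c.index.exists_cost_le
    obtain ⟨r, hr⟩ := d.index.exists_cost_le
    obtain ⟨u, hu⟩ := t.index.exists_cost_le
    refine ⟨1 + p + r + u, fun σ M h => ?_⟩
    have := (hp σ M h).1
    have := (hr σ M h).1
    have := (hu σ M h).1
    simp [Gate.cost]
    omega

/-- `u` is reached from `s` in time at most `T`, the variables being bounded by `M'` afterwards. -/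
def Branch.Reaches {S : Sizes} {W : ℕ} {E : Type} (s u : Branch S W E) (N M' T : ℕ) : Prop :=
  u.time ≤ s.time + T ∧ (∀ v < 8, u.vars v ≤ N) ∧ ∀ v, u.vars v ≤ M'

theorem update_bounds {σ : ℕ → ℕ} {N M M' v n : ℕ} (h8 : ∀ v < 8, σ v ≤ N) (hM : ∀ v, σ v ≤ M)
    (hMM : M ≤ M') (hv : 8 ≤ v) (hn : n ≤ M') :
    (∀ w < 8, Function.update σ v n w ≤ N) ∧ ∀ w, Function.update σ v n w ≤ M' := by
  constructor
  · intro w hw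
    rw [Function.update_of_ne (by omega)]
    exact h8 w hw
  · intro w
    by_cases h : w = v
    · subst h; simpa using hn
    · rw [Function.update_of_ne h]
      exact (hM w).trans hMM

/-- The variable bound has the form `max M (B.eval N)` with `N` bounding the inputs, which a tame
program never changes. Such a bound is idempotent: running the program again does not raise it.
Hence variables do not grow along a loop, and a loop multiplies the time only by its bound, itself
polynomial in `N`. -/
theorem Cmd.exists_time_le (c : Cmd) (hc : c.tame = true) :
    ∃ p B : Polynomial ℕ, ∀ (S : Sizes) (W q : ℕ) (E : Type) [Fintype E] [DecidableEq E]
      (A : Adversary S q E) (msg : List Bool) (s : Branch S W E) (N M : ℕ),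
      (∀ v < 8, s.vars v ≤ N) → (∀ v, s.vars v ≤ M) → ∀ u ∈ exec A msg c s,
        s.Reaches u N (max M (B.eval N)) (p.eval (N + M)) := by
  induction c with
  | skip =>
    refine ⟨1, 0, fun S W q E _ _ A msg s N M h8 hM u hu => ?_⟩
    simp only [exec, List.mem_singleton] at hu
    subst hu
    exact ⟨by simp [Branch.tick], h8, fun v => le_max_of_le_left (hM v)⟩
  | seq c d ihc ihd =>
    simp only [Cmd.tame, Bool.and_eq_true] at hc
    obtain ⟨p, B, hp⟩ := ihc hc.1
    obtain ⟨r, D, hr⟩ := ihd hc.2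
    refine ⟨p + r.comp (Polynomial.X + B), B + D, fun S W q E _ _ A msg s N M h8 hM u hu => ?_⟩
    simp only [exec, List.mem_flatMap] at hu
    obtain ⟨t, ht, hu⟩ := hu
    obtain ⟨h1, h2, h3⟩ := hp S W q E A msg s N M h8 hM t ht
    obtain ⟨h4, h5, h6⟩ := hr S W q E A msg t N _ h2 h3 u hu
    have hB := eval_nat_mono B (show N ≤ N + M by omega)
    have := eval_nat_mono r (show N + max M (B.eval N) ≤ N + M + B.eval (N + M) by
      simp only at hB; omega)
    refine ⟨?_, h5, fun v => (h6 v).trans ?_⟩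
    · simp only [Polynomial.eval_add, Polynomial.eval_comp, Polynomial.eval_X] at *
      omega
    · simp only [Polynomial.eval_add]
      omega
  | assign v e =>
    simp only [Cmd.tame, Bool.and_eq_true, decide_eq_true_eq, Bool.or_eq_true] at hc
    obtain ⟨p, hp⟩ := e.exists_cost_le
    obtain ⟨B, hB⟩ : ∃ B : Polynomial ℕ, ∀ (σ : ℕ → ℕ) (N M : ℕ), (∀ v < 8, σ v ≤ N) →
        (∀ v, σ v ≤ M) → e.eval σ ≤ max M (B.eval N) := by
      rcases hc.2 with h | h
      · obtain ⟨B, hB⟩ := e.exists_eval_le h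
        exact ⟨B, fun σ N M h8 _ => le_max_of_le_right (hB σ N h8)⟩
      · cases e <;> simp [Expr.isVar] at h
        exact ⟨0, fun σ N M _ hM => le_max_of_le_left (hM _)⟩
    refine ⟨1 + p, B, fun S W q E _ _ A msg s N M h8 hM u hu => ?_⟩
    simp only [exec, List.mem_singleton] at hu
    subst hu
    have h1 := (hp s.vars M hM).1
    have h2 := eval_nat_mono p (show M ≤ N + M by omega)
    refine ⟨?_, update_bounds h8 hM (le_max_left _ _) hc.1 (hB s.vars N M h8 hM)⟩
    simp [Branch.tick, Branch.setVar] at h2 ⊢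
    omega
  | ite e c d ihc ihd =>
    simp only [Cmd.tame, Bool.and_eq_true] at hc
    obtain ⟨p, B, hp⟩ := ihc hc.1
    obtain ⟨r, D, hr⟩ := ihd hc.2
    obtain ⟨k, hk⟩ := e.exists_cost_le
    refine ⟨1 + k + p + r, B + D, fun S W q E _ _ A msg s N M h8 hM u hu => ?_⟩
    have h1 := (hk s.vars M hM).1
    have h2 := eval_nat_mono k (show M ≤ N + M by omega)
    simp only [exec] at hu
    split at hu
    · obtain ⟨h4, h5, h6⟩ := hp S W q E A msg (s.tick _) N M h8 hM u hu
      refine ⟨?_, h5, fun v => (h6 v).trans ?_⟩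
      · simp [Branch.tick] at h2 h4 ⊢
        omega
      · simp only [Polynomial.eval_add]
        omega
    · obtain ⟨h4, h5, h6⟩ := hr S W q E A msg (s.tick _) N M h8 hM u hu
      refine ⟨?_, h5, fun v => (h6 v).trans ?_⟩
      · simp [Branch.tick] at h2 h4 ⊢
        omega
      · simp only [Polynomial.eval_add]
        omega
  | loop v e c ih =>
    simp only [Cmd.tame, Bool.and_eq_true, decide_eq_true_eq] at hc
    obtain ⟨p, B, hp⟩ := ih hc.2
    obtain ⟨k, hk⟩ := e.exists_cost_le
    obtain ⟨D, hD⟩ := e.exists_eval_le hc.1.2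
    refine ⟨1 + k + D * (1 + p.comp (Polynomial.X + B + D)), B + D,
      fun S W q E _ _ A msg s N M h8 hM u hu => ?_⟩
    have hDN := hD s.vars N h8
    -- `D` covers the loop counter and `B` the values written by the body, so `M'` is preserved by
    -- every iteration.
    set M' := max M (B.eval N + D.eval N) with hM'
    have key : ∀ n ≤ e.eval s.vars, ∀ u ∈ (List.range n).foldl
        (fun L i => L.flatMap fun t => exec A msg c ((t.setVar v i).tick 1))
        [s.tick (1 + e.cost s.vars)],
        s.Reaches u N M' (1 + e.cost s.vars + n * (1 + p.eval (N + M'))) := by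
      intro n
      induction n with
      | zero =>
        intro _ u hu
        simp only [List.range_zero, List.foldl_nil, List.mem_singleton] at hu
        subst hu
        exact ⟨by simp [Branch.tick], h8, fun v => le_max_of_le_left (hM v)⟩
      | succ n ihn =>
        intro hn u hu
        rw [List.range_succ, List.foldl_append, List.foldl_cons, List.foldl_nil,
          List.mem_flatMap] at hu
        obtain ⟨t, ht, hu⟩ := hu
        obtain ⟨h1, h2, h3⟩ := ihn (by omega) t ht
        obtain ⟨h4, h5⟩ := update_bounds (v := v) (n := n) h2 h3 le_rfl hc.1.1
          (by simp only [hM']; omega)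
        obtain ⟨h6, h7, h8⟩ := hp S W q E A msg ((t.setVar v n).tick 1) N M' h4 h5 u hu
        refine ⟨?_, h7, fun v => (h8 v).trans ?_⟩
        · simp only [Branch.tick, Branch.setVar] at h6
          have : (n + 1) * (1 + p.eval (N + M')) =
            n * (1 + p.eval (N + M')) + (1 + p.eval (N + M')) := by ring
          omega
        · simp only [hM']; omega
    simp only [exec] at hu
    obtain ⟨h1, h2, h3⟩ := key _ le_rfl u hu
    refine ⟨h1.trans (Nat.add_le_add_left ?_ _), h2, by simpa [hM'] using h3⟩
    have hB' := eval_nat_mono B (show N ≤ N + M by omega)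
    have hD' := eval_nat_mono D (show N ≤ N + M by omega)
    have hk' := eval_nat_mono k (show M ≤ N + M by omega)
    have hk1 := (hk s.vars M hM).1
    have := eval_nat_mono p (show N + M' ≤ N + M + B.eval (N + M) + D.eval (N + M) by
      simp only at hB' hD'; omega)
    simp only [Polynomial.eval_add, Polynomial.eval_comp, Polynomial.eval_X, Polynomial.eval_mul,
      Polynomial.eval_one] at *
    exact add_le_add (by omega) (Nat.mul_le_mul (by omega) (by omega))
  | rand v e =>
    simp only [Cmd.tame, Bool.and_eq_true, decide_eq_true_eq] at hc
    obtain ⟨p, hp⟩ := e.exists_cost_le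
    obtain ⟨B, hB⟩ := e.exists_eval_le hc.2
    refine ⟨1 + p, B, fun S W q E _ _ A msg s N M h8 hM u hu => ?_⟩
    have h1 := (hp s.vars M hM).1
    have h2 := eval_nat_mono p (show M ≤ N + M by omega)
    have h3 := hB s.vars N h8
    simp only [exec] at hu
    split at hu
    · simp only [List.mem_singleton] at hu
      subst hu
      refine ⟨?_, update_bounds h8 hM (le_max_left _ _) hc.1 (Nat.zero_le _)⟩
      simp [Branch.tick, Branch.setVar] at h2 ⊢
      omega
    · simp only [List.mem_map, List.mem_range] at hu
      obtain ⟨i, hi, rfl⟩ := hu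
      refine ⟨?_, update_bounds h8 hM (le_max_left _ _) hc.1 (by omega)⟩
      simp [Branch.tick, Branch.setVar] at h2 ⊢
      omega
  | gate g =>
    obtain ⟨p, hp⟩ := g.exists_cost_le
    refine ⟨p, 0, fun S W q E _ _ A msg s N M h8 hM u hu => ?_⟩
    simp only [exec, List.mem_singleton] at hu
    subst hu
    refine ⟨?_, h8, fun v => le_max_of_le_left (hM v)⟩
    have h2 := eval_nat_mono p (show M ≤ N + M by omega)
    simpa [Branch.tick] using (hp s.vars M hM).trans h2
  | measure v l =>
    simp only [Cmd.tame, decide_eq_true_eq] at hc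
    obtain ⟨p, hp⟩ := l.index.exists_cost_le
    refine ⟨1 + p, 1, fun S W q E _ _ A msg s N M h8 hM u hu => ?_⟩
    have h1 := (hp s.vars M hM).1
    have h2 := eval_nat_mono p (show M ≤ N + M by omega)
    simp only at h2
    simp only [exec] at hu
    split at hu
    · simp only [List.mem_map] at hu
      obtain ⟨r, _, rfl⟩ := hu
      refine ⟨?_, update_bounds h8 hM (le_max_left _ _) hc (le_max_of_le_right ?_)⟩
      · simp [Branch.tick, Branch.setVar]
        omega
      · cases r <;> simp
    · simp only [List.mem_singleton] at hu
      subst hu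
      refine ⟨?_, update_bounds h8 hM (le_max_left _ _) hc (Nat.zero_le _)⟩
      simp [Branch.tick, Branch.setVar]
      omega
  | advance =>
    refine ⟨1, 0, fun S W q E _ _ A msg s N M h8 hM u hu => ?_⟩
    simp only [exec] at hu
    split at hu
    all_goals
      simp only [List.mem_singleton] at hu
      subst hu
      exact ⟨by simp [Branch.tick], h8, fun v => le_max_of_le_left (hM v)⟩
  | read v e =>
    simp only [Cmd.tame, decide_eq_true_eq] at hc
    obtain ⟨p, hp⟩ := e.exists_cost_le
    refine ⟨1 + p, 1, fun S W q E _ _ A msg s N M h8 hM u hu => ?_⟩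
    have h1 := (hp s.vars M hM).1
    have h2 := eval_nat_mono p (show M ≤ N + M by omega)
    simp only at h2
    simp only [exec, List.mem_singleton] at hu
    subst hu
    refine ⟨?_, update_bounds h8 hM (le_max_left _ _) hc (le_max_of_le_right ?_)⟩
    · simp [Branch.tick, Branch.setVar]
      omega
    · generalize msg.getD (e.eval s.vars) false = r
      cases r <;> simp
  | send e =>
    obtain ⟨p, hp⟩ := e.exists_cost_le
    refine ⟨1 + p, 0, fun S W q E _ _ A msg s N M h8 hM u hu => ?_⟩
    have h1 := (hp s.vars M hM).1
    have h2 := eval_nat_mono p (show M ≤ N + M by omega)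
    simp only at h2
    simp only [exec, List.mem_singleton] at hu
    subst hu
    refine ⟨?_, h8, fun v => le_max_of_le_left (hM v)⟩
    simp [Branch.tick]
    omega

theorem Prover.exists_time_le (P : Prover) (h1 : P.announce.tame = true)
    (h2 : P.commit.tame = true) (h3 : P.respond.tame = true) :
    ∃ p : Polynomial ℕ, ∀ (S : Sizes) (W q : ℕ) (E : Type) [Fintype E] [DecidableEq E]
      (A : Adversary S q E), P.RunsInTime A W (p.eval (q + S.total)) := by
  obtain ⟨p₁, B₁, hp₁⟩ := Cmd.exists_time_le _ h1
  obtain ⟨p₂, B₂, hp₂⟩ := Cmd.exists_time_le _ h2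
  obtain ⟨p₃, B₃, hp₃⟩ := Cmd.exists_time_le _ h3
  -- At the start inputs and variables have the same bound N, so the first argument is N + N. The
  -- later programs begin with the variable bounds left by the earlier ones.
  refine ⟨p₁.comp (2 * Polynomial.X) + p₂.comp (2 * Polynomial.X + B₁)
    + p₃.comp (2 * Polynomial.X + B₁ + B₂), fun S W q E _ _ A c o ho => ?_⟩
  simp only [Prover.runs, List.mem_flatMap, List.mem_map] at ho
  obtain ⟨s, hs, t, ht, u, hu, rfl⟩ := ho
  set N := q + S.total with hN
  have hin : ∀ v, inputVars S q v ≤ N := by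
    intro v
    simp only [hN, Sizes.total]
    rcases v with _ | _ | _ | _ | _ | _ | _ | _ | v <;> simp [inputVars] <;> omega
  obtain ⟨a1, a2, a3⟩ := hp₁ S W q E A [] (startBranch A W) N N (fun v _ => hin v) hin s hs
  obtain ⟨b1, b2, b3⟩ := hp₂ S W q E A [] { s with sent := [] } N _ a2 a3 t ht
  obtain ⟨c1, c2, c3⟩ := hp₃ S W q E A _ { t with sent := [] } N _ b2 b3 u hu
  have e2 := eval_nat_mono p₂ (show N + max N (B₁.eval N) ≤ 2 * N + B₁.eval N by omega)
  have e3 := eval_nat_mono p₃ (show N + max (max N (B₁.eval N)) (B₂.eval N) ≤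
    2 * N + B₁.eval N + B₂.eval N by omega)
  simp only [Polynomial.eval_add, Polynomial.eval_comp, Polynomial.eval_mul, Polynomial.eval_X,
    Polynomial.eval_ofNat] at *
  have h0 : (startBranch A W).time = 0 := rfl
  rw [two_mul] at *
  omega

/-! ### Reversible circuits -/

/-- Qubits of the joint system, with an unbounded supply of work qubits. -/
abbrev Key (S : Sizes) : Type := ℕ ⊕ AdvQubit S

/-- The basis state of the joint system with the given bits. -/
def joint {S : Sizes} {W : ℕ} {E : Type} (v : Key S → Bool) (e : E) : JointBasis S W E :=
  (fun k => v (k.map Fin.val id), e)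

/-- `tgt := tgt ⊕ ⋀ ctrl`. -/
structure XGate (S : Sizes) : Type where
  ctrl : List (Key S)
  tgt : Key S

def XGate.act {S : Sizes} (g : XGate S) (v : Key S → Bool) : Key S → Bool :=
  Function.update v g.tgt (xor (v g.tgt) (g.ctrl.all v))

/-- Apply the gates of a list, the first one first. -/
def runGates {S : Sizes} (L : List (XGate S)) (v : Key S → Bool) : Key S → Bool :=
  L.foldl (fun v g => g.act v) v

/-- The gate acts on distinct qubits, and on the first `W` work qubits only. -/
def XGate.Ok {S : Sizes} (W : ℕ) (g : XGate S) : Prop :=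
  g.tgt ∉ g.ctrl ∧ g.ctrl.Nodup ∧ ∀ k ∈ g.tgt :: g.ctrl, ∀ n, k = .inl n → n < W

/-- Work qubits are numbered without a limit here; the limit is imposed later by `XGate.Ok`. The
other arrays do not depend on the number of work qubits, so they are resolved with `0` of them. -/
def keyAt (S : Sizes) (fin : Bool) (k : Bank) (i : ℕ) : Option (Key S) :=
  match k with
  | .work => some (.inl i)
  | k => (resolve S 0 fin k i).map (Sum.map Fin.val id)

def Loc.key (S : Sizes) (fin : Bool) (Γ : ℕ → ℕ) (l : Loc) : Option (Key S) :=
  keyAt S fin l.bank (l.index.eval Γ)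

/-- Reversible circuits; at nesting depth `n`, the loop variable is `n`. -/
inductive Circ : Type
  | nil : Circ
  | not (t : Loc) : Circ
  | cnot (c t : Loc) : Circ
  | toffoli (c d t : Loc) : Circ
  | seq (c d : Circ) : Circ
  | loop (e : Expr) (c : Circ) : Circ
  | guard (e : Expr) (c : Circ) : Circ

def Circ.gates (S : Sizes) (fin : Bool) : ℕ → (ℕ → ℕ) → Circ → List (XGate S)
  | _, _, .nil => []
  | _, Γ, .not t => ((t.key S fin Γ).map fun k => ⟨[], k⟩).toList
  | _, Γ, .cnot c t => match c.key S fin Γ, t.key S fin Γ with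
    | some i, some k => [⟨[i], k⟩]
    | _, _ => []
  | _, Γ, .toffoli c d t => match c.key S fin Γ, d.key S fin Γ, t.key S fin Γ with
    | some i, some j, some k => [⟨[i, j], k⟩]
    | _, _, _ => []
  | n, Γ, .seq c d => c.gates S fin n Γ ++ d.gates S fin n Γ
  | n, Γ, .loop e c => (List.range (e.eval Γ)).flatMap fun i =>
      c.gates S fin (n + 1) (Function.update Γ n i)
  | n, Γ, .guard e c => if e.eval Γ ≠ 0 then c.gates S fin n Γ else []

/-- The program for a circuit (`rev = false`) or its inverse (`rev = true`). -/
def Circ.compile (rev : Bool) : ℕ → Circ → Cmd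
  | _, .nil => .skip
  | _, .not t => .gate (.not t)
  | _, .cnot c t => .gate (.cnot c t)
  | _, .toffoli c d t => .gate (.toffoli c d t)
  | n, .seq c d => match rev with
    | true => .seq (d.compile rev n) (c.compile rev n)
    | false => .seq (c.compile rev n) (d.compile rev n)
  -- The inverse must run the iterations in descending order: the counter i is overwritten by e - 1
  -- - i before the body, and the loop sets it afresh on every pass.
  | n, .loop e c => .loop n e (match rev with
    | true => .seq (.assign n (.sub (.sub e (.const 1)) (.var n))) (c.compile rev (n + 1))
    | false => c.compile rev (n + 1))
  | n, .guard e c => .ite e (c.compile rev n) .skip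

def Expr.readsBelow (n : ℕ) : Expr → Bool
  | .const _ => true
  | .var v => decide (v < n)
  | .add e f | .mul e f | .sub e f | .div e f | .mod e f => e.readsBelow n && f.readsBelow n

def Circ.readsBelow : ℕ → Circ → Bool
  | _, .nil => true
  | n, .not t => t.index.readsBelow n
  | n, .cnot c t => c.index.readsBelow n && t.index.readsBelow n
  | n, .toffoli c d t => c.index.readsBelow n && d.index.readsBelow n && t.index.readsBelow n
  | n, .seq c d => c.readsBelow n && d.readsBelow n
  | n, .loop e c => e.readsBelow n && c.readsBelow (n + 1)
  | n, .guard e c => e.readsBelow n && c.readsBelow n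

theorem Expr.eval_congr {n : ℕ} {e : Expr} (he : e.readsBelow n = true) {σ τ : ℕ → ℕ}
    (h : ∀ v < n, σ v = τ v) : e.eval σ = e.eval τ := by
  induction e with
  | const => rfl
  | var v => exact h v (by simpa [Expr.readsBelow] using he)
  | add e f ihe ihf | sub e f ihe ihf | mul e f ihe ihf | div e f ihe ihf | mod e f ihe ihf =>
    simp only [Expr.readsBelow, Bool.and_eq_true] at he
    simp [Expr.eval, ihe he.1, ihf he.2]

section RunGates

variable {S : Sizes}

@[simp] theorem runGates_nil (v : Key S → Bool) : runGates [] v = v := rfl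

theorem runGates_cons (g : XGate S) (L : List (XGate S)) (v : Key S → Bool) :
    runGates (g :: L) v = runGates L (g.act v) := rfl

theorem runGates_append (L M : List (XGate S)) (v : Key S → Bool) :
    runGates (L ++ M) v = runGates M (runGates L v) := by
  simp [runGates]

theorem XGate.act_act {g : XGate S} (hg : g.tgt ∉ g.ctrl) (v : Key S → Bool) :
    g.act (g.act v) = v := by
  have h : g.ctrl.all (g.act v) = g.ctrl.all v := by
    rw [Bool.eq_iff_iff, List.all_eq_true, List.all_eq_true]
    refine forall₂_congr fun k hk => ?_
    rw [XGate.act, Function.update_of_ne (by rintro rfl; exact hg hk)]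
  rw [XGate.act, h]
  simp [XGate.act]

theorem runGates_reverse_cancel {L : List (XGate S)} (hL : ∀ g ∈ L, g.tgt ∉ g.ctrl)
    (v : Key S → Bool) : runGates L.reverse (runGates L v) = v := by
  induction L generalizing v with
  | nil => rfl
  | cons g L ih =>
    rw [List.reverse_cons, runGates_append, runGates_cons g L,
      ih (fun g' hg' => hL g' (List.mem_cons_of_mem _ hg'))]
    exact XGate.act_act (hL g List.mem_cons_self) v

end RunGates

section Locations

variable {S : Sizes} {W : ℕ} {E : Type}

theorem setBit_joint (v : Key S → Bool) (e : E) (k : Qubit S W) (b : Bool) :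
    setBit (joint v e) k b = joint (Function.update v (k.map Fin.val id) b) e := by
  refine Prod.ext (funext fun j => ?_) rfl
  have hinj : Function.Injective (Sum.map Fin.val id : Qubit S W → Key S) :=
    Sum.map_injective.2 ⟨Fin.val_injective, Function.injective_id⟩
  by_cases h : j = k
  · subst h; simp [setBit, joint]
  · simp [setBit, joint, h, hinj.ne h]

theorem resolve_eq_none {fin : Bool} {k : Bank} {i : ℕ} (h : keyAt S fin k i = none) :
    resolve S W fin k i = none := by
  cases k <;> cases fin <;> simp_all [keyAt, resolve, arrayIndex]

theorem exists_resolve {fin : Bool} {k : Bank} {i : ℕ} {x : Key S}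
    (h : keyAt S fin k i = some x) (hx : ∀ n, x = .inl n → n < W) :
    ∃ y, resolve S W fin k i = some y ∧ y.map Fin.val id = x := by
  cases k with
  | work =>
    simp only [keyAt, Option.some.injEq] at h
    have := hx i h.symm
    exact ⟨.inl ⟨i, this⟩, by simp [resolve, arrayIndex, this], by simp [← h]⟩
  | queryControl | querySel | queryInst | queryCom | queryResult | outInst | outCom | outResp =>
    cases fin <;> simp only [keyAt, resolve, Option.map_eq_some_iff] at h ⊢
    all_goals
      obtain ⟨a, ha, rfl⟩ := h
      first
      | (simp at ha; done)
      | (simp only [Option.ite_none_right_eq_some, Option.some.injEq] at ha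
         obtain ⟨hi, rfl⟩ := ha
         exact ⟨_, if_pos hi, rfl⟩)
      | (obtain ⟨j, hj, rfl⟩ := ha
         exact ⟨_, ⟨j, hj, rfl⟩, rfl⟩)

end Locations

/-! ### Correctness of the compilation of reversible circuits. -/

section Compile

variable {S : Sizes} {W q : ℕ} {E : Type} [Fintype E] [DecidableEq E]

/-- `t` is `s` with the gates in `L` applied; the variables below `n` have the values `Γ`. -/
structure Branch.Applied (n : ℕ) (Γ : ℕ → ℕ) (L : List (XGate S)) (s t : Branch S W E) : Prop where
  vars : ∀ v < n, t.vars v = Γ v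
  advPos : t.advPos = s.advPos
  sent : t.sent = s.sent
  weight : t.weight = s.weight
  -- States are pulled back along the inverse permutation; the gates are involutions, so the inverse
  -- is the reversed list.
  amp : ∀ v e, t.amp (joint v e) = s.amp (joint (runGates L.reverse v) e)

omit [Fintype E] [DecidableEq E] in
theorem Branch.Applied.of_eq_nil {n : ℕ} {Γ : ℕ → ℕ} {s t : Branch S W E}
    (vars : ∀ v < n, t.vars v = Γ v) (advPos : t.advPos = s.advPos) (sent : t.sent = s.sent)
    (weight : t.weight = s.weight) (amp : t.amp = s.amp) : s.Applied n Γ [] t :=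
  ⟨vars, advPos, sent, weight, by simp [amp]⟩

omit [Fintype E] [DecidableEq E] in
theorem Branch.Applied.trans {n m : ℕ} {Γ Γ' : ℕ → ℕ} {L M : List (XGate S)}
    {s t u : Branch S W E} (h : s.Applied n Γ L t) (h' : t.Applied m Γ' M u) :
    s.Applied m Γ' (L ++ M) u where
  vars := h'.vars
  advPos := h'.advPos.trans h.advPos
  sent := h'.sent.trans h.sent
  weight := h'.weight.trans h.weight
  amp v e := by rw [h'.amp, h.amp, List.reverse_append, runGates_append]

theorem Loc.resolve_eq_none {fin : Bool} {n : ℕ} {Γ σ : ℕ → ℕ} {l : Loc}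
    (hl : l.index.readsBelow n = true) (hσ : ∀ v < n, σ v = Γ v) (h : l.key S fin Γ = none) :
    resolve S W fin l.bank (l.index.eval σ) = none := by
  rw [Expr.eval_congr hl hσ]
  exact SeqOr.resolve_eq_none h

theorem Loc.exists_resolve {fin : Bool} {n : ℕ} {Γ σ : ℕ → ℕ} {l : Loc}
    (hl : l.index.readsBelow n = true) (hσ : ∀ v < n, σ v = Γ v) {x : Key S}
    (h : l.key S fin Γ = some x) (hx : ∀ n, x = .inl n → n < W) :
    ∃ y, resolve S W fin l.bank (l.index.eval σ) = some y ∧ y.map Fin.val id = x := by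
  rw [Expr.eval_congr hl hσ]
  exact SeqOr.exists_resolve h hx

theorem range_flatMap_sub_reverse {α : Type*} (N : ℕ) (f : ℕ → List α) :
    ((List.range N).flatMap fun i => (f (N - 1 - i)).reverse) =
      ((List.range N).flatMap f).reverse := by
  rw [List.reverse_flatMap, List.range_eq_range', List.reverse_range', List.flatMap_map,
    ← List.range_eq_range']
  simp

/-- Circuits involve neither randomness nor measurement, so there is exactly one branch, and the
adversary's position, hence the accessible registers, stays fixed. `XGate.Ok` is essential: the
semantics silently drops a gate on a missing or repeated qubit. -/
theorem Circ.exec_compile (A : Adversary S q E) (msg : List Bool) (rev : Bool) (c : Circ) :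
    ∀ (n : ℕ) (Γ : ℕ → ℕ) (s : Branch S W E), c.readsBelow n = true → (∀ v < n, s.vars v = Γ v) →
      (∀ g ∈ c.gates S (decide (q ≤ s.advPos)) n Γ, g.Ok W) →
      ∃ t, exec A msg (c.compile rev n) s = [t] ∧ s.Applied n Γ
        (if rev then (c.gates S (decide (q ≤ s.advPos)) n Γ).reverse
          else c.gates S (decide (q ≤ s.advPos)) n Γ) t := by
  induction c with
  | nil =>
    intro n Γ s _ hs _
    refine ⟨_, rfl, ?_⟩
    rw [show (if rev then (Circ.gates S (decide (q ≤ s.advPos)) n Γ .nil).reverse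
      else Circ.gates S (decide (q ≤ s.advPos)) n Γ .nil) = [] by cases rev <;> rfl]
    exact .of_eq_nil hs rfl rfl rfl rfl
  | not t =>
    intro n Γ s hb hs hok
    refine ⟨_, rfl, hs, rfl, rfl, rfl, fun v e => ?_⟩
    simp only [Circ.readsBelow] at hb
    simp only [Circ.gates] at hok ⊢
    rcases ht : t.key S (decide (q ≤ s.advPos)) Γ with _ | x
    · simp [applyGate, Branch.locate, Loc.resolve_eq_none hb hs ht]
    · simp only [ht, Option.map_some, Option.toList_some, List.mem_singleton, forall_eq,
        XGate.Ok] at hok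
      obtain ⟨y, hy, rfl⟩ := Loc.exists_resolve hb hs ht hok.2.2
      simp [applyGate, Branch.locate, hy, setBit_joint, runGates, XGate.act]
      simp [joint]
  | cnot c t =>
    intro n Γ s hb hs hok
    refine ⟨_, rfl, hs, rfl, rfl, rfl, fun v e => ?_⟩
    simp only [Circ.readsBelow, Bool.and_eq_true] at hb
    simp only [Circ.gates] at hok ⊢
    rcases hc : c.key S (decide (q ≤ s.advPos)) Γ with _ | x
    · simp [applyGate, Branch.locate, Loc.resolve_eq_none hb.1 hs hc]
    rcases ht : t.key S (decide (q ≤ s.advPos)) Γ with _ | y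
    · simp [applyGate, Branch.locate, Loc.resolve_eq_none hb.2 hs ht]
    simp only [hc, ht, List.mem_singleton, forall_eq, XGate.Ok] at hok
    obtain ⟨h1, -, h2⟩ := hok
    obtain ⟨x, hx, rfl⟩ := Loc.exists_resolve hb.1 hs hc (h2 _ (by simp))
    obtain ⟨y, hy, rfl⟩ := Loc.exists_resolve hb.2 hs ht (h2 _ (by simp))
    have hne : x ≠ y := by rintro rfl; simp at h1
    simp [applyGate, Branch.locate, hx, hy, setBit_joint, runGates, XGate.act, hne]
    simp [joint]
  | toffoli c d t =>
    intro n Γ s hb hs hok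
    refine ⟨_, rfl, hs, rfl, rfl, rfl, fun v e => ?_⟩
    simp only [Circ.readsBelow, Bool.and_eq_true] at hb
    simp only [Circ.gates] at hok ⊢
    rcases hc : c.key S (decide (q ≤ s.advPos)) Γ with _ | x
    · simp [applyGate, Branch.locate, Loc.resolve_eq_none hb.1.1 hs hc]
    rcases hd : d.key S (decide (q ≤ s.advPos)) Γ with _ | z
    · simp [applyGate, Branch.locate, Loc.resolve_eq_none hb.1.2 hs hd]
    rcases ht : t.key S (decide (q ≤ s.advPos)) Γ with _ | y
    · simp [applyGate, Branch.locate, Loc.resolve_eq_none hb.2 hs ht]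
    simp only [hc, hd, ht, List.mem_singleton, forall_eq, XGate.Ok] at hok
    obtain ⟨h1, h3, h2⟩ := hok
    obtain ⟨x, hx, rfl⟩ := Loc.exists_resolve hb.1.1 hs hc (h2 _ (by simp))
    obtain ⟨z, hz, rfl⟩ := Loc.exists_resolve hb.1.2 hs hd (h2 _ (by simp))
    obtain ⟨y, hy, rfl⟩ := Loc.exists_resolve hb.2 hs ht (h2 _ (by simp))
    have hne : x ≠ z ∧ x ≠ y ∧ z ≠ y := by
      refine ⟨?_, ?_, ?_⟩ <;> rintro rfl <;> simp at h1 h3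
    simp [applyGate, Branch.locate, hx, hy, hz, setBit_joint, runGates, XGate.act,
      hne]
    simp [joint]
  | seq c d ihc ihd =>
    intro n Γ s hb hs hok
    simp only [Circ.readsBelow, Bool.and_eq_true] at hb
    simp only [Circ.gates, List.mem_append] at hok
    cases rev with
    | false =>
      obtain ⟨t, ht, h1⟩ := ihc n Γ s hb.1 hs (fun g hg => hok g (.inl hg))
      obtain ⟨u, hu, h2⟩ := ihd n Γ t hb.2 h1.vars
        (by rw [h1.advPos]; exact fun g hg => hok g (.inr hg))
      rw [h1.advPos] at h2
      exact ⟨u, by simp [Circ.compile, exec, ht, hu], h1.trans h2⟩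
    | true =>
      obtain ⟨t, ht, h1⟩ := ihd n Γ s hb.2 hs (fun g hg => hok g (.inr hg))
      obtain ⟨u, hu, h2⟩ := ihc n Γ t hb.1 h1.vars
        (by rw [h1.advPos]; exact fun g hg => hok g (.inl hg))
      rw [h1.advPos] at h2
      refine ⟨u, by simp [Circ.compile, exec, ht, hu], ?_⟩
      have := h1.trans h2
      simpa [Circ.gates] using this
  | guard e c ih =>
    intro n Γ s hb hs hok
    simp only [Circ.readsBelow, Bool.and_eq_true] at hb
    simp only [Circ.gates] at hok ⊢
    have he := Expr.eval_congr hb.1 hs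
    by_cases h : e.eval Γ = 0
    · refine ⟨_, by simp [Circ.compile, exec, he, h]; rfl, ?_⟩
      rw [show (if rev then _ else _) = ([] : List (XGate S)) by simp [h]]
      exact .of_eq_nil hs rfl rfl rfl rfl
    · simp only [ne_eq, h, not_false_eq_true, if_true] at hok ⊢
      obtain ⟨t, ht, h1⟩ := ih n Γ (s.tick (1 + e.cost s.vars)) hb.2 hs hok
      exact ⟨t, by simp [Circ.compile, exec, he, h, ht], h1.vars, h1.advPos, h1.sent, h1.weight,
        h1.amp⟩
  | loop e c ih =>
    intro n Γ s hb hs hok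
    simp only [Circ.readsBelow, Bool.and_eq_true] at hb
    have he := Expr.eval_congr hb.1 hs
    set fin := decide (q ≤ s.advPos) with hfin
    simp only [Circ.gates, List.mem_flatMap, List.mem_range] at hok ⊢
    set N := e.eval Γ with hN
    set G : ℕ → List (XGate S) := fun i => c.gates S fin (n + 1) (Function.update Γ n i) with hG
    set F : ℕ → List (XGate S) := fun i => if rev then (G (N - 1 - i)).reverse else G i with hF
    have hlist : (if rev then ((List.range N).flatMap G).reverse else (List.range N).flatMap G) =
        (List.range N).flatMap F := by
      cases rev
      · rfl
      · simpa [hF] using (range_flatMap_sub_reverse N G).symm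
    rw [hlist]
    have body : ∀ i < N, ∀ t : Branch S W E, t.advPos = s.advPos → (∀ v < n, t.vars v = Γ v) →
        ∃ u, exec A msg (match rev with
          | true => .seq (.assign n (.sub (.sub e (.const 1)) (.var n))) (c.compile rev (n + 1))
          | false => c.compile rev (n + 1)) ((t.setVar n i).tick 1) = [u] ∧
          t.Applied n Γ (F i) u := by
      intro i hi t htp htv
      have hupd : ∀ (j : ℕ), (∀ v < n, Function.update t.vars n j v = Γ v) := fun j v hv => by
        rw [Function.update_of_ne (by omega)]; exact htv v hv
      have hupd' : ∀ (j : ℕ), (∀ v < n + 1, Function.update t.vars n j v =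
          Function.update Γ n j v) := fun j v hv => by
        by_cases h : v = n
        · subst h; simp
        · rw [Function.update_of_ne h, Function.update_of_ne h]; exact htv v (by omega)
      have hback : ∀ (j : ℕ) (u : Branch S W E), (∀ v < n + 1, u.vars v = Function.update Γ n j v) →
          ∀ v < n, u.vars v = Γ v := fun j u hu v hv => by
        rw [hu v (by omega), Function.update_of_ne (by omega)]
      cases rev with
      | false =>
        obtain ⟨u, hu, h1⟩ := ih (n + 1) (Function.update Γ n i) ((t.setVar n i).tick 1) hb.2
          (hupd' i) (by
            simp only [Branch.tick, Branch.setVar, htp]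
            exact fun g hg => hok g ⟨i, hi, hg⟩)
        simp only [Branch.tick, Branch.setVar, htp] at h1
        exact ⟨u, hu, hback i u h1.vars, htp ▸ h1.advPos, h1.sent, h1.weight, h1.amp⟩
      | true =>
        have hev : (Expr.sub (.sub e (.const 1)) (.var n)).eval
            ((t.setVar n i).tick 1).vars = N - 1 - i := by
          simp [Expr.eval, Branch.tick, Branch.setVar, Expr.eval_congr hb.1 (hupd i), hN]
        set t' : Branch S W E := (((t.setVar n i).tick 1).setVar n (N - 1 - i)).tick
          (1 + (Expr.sub (.sub e (.const 1)) (.var n)).cost ((t.setVar n i).tick 1).vars) with ht'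
        have hvars : t'.vars = Function.update t.vars n (N - 1 - i) := by
          simp [ht', Branch.tick, Branch.setVar]
        have hpos : t'.advPos = s.advPos := htp
        obtain ⟨u, hu, h1⟩ := ih (n + 1) (Function.update Γ n (N - 1 - i)) t' hb.2
          (by rw [hvars]; exact hupd' _) (by
            rw [hpos]
            exact fun g hg => hok g ⟨N - 1 - i, by omega, hg⟩)
        rw [hpos] at h1
        refine ⟨u, ?_, hback _ u h1.vars, h1.advPos.trans (hpos.trans htp.symm), h1.sent,
          h1.weight, h1.amp⟩
        simp only [exec, hev, List.flatMap_cons, List.flatMap_nil, List.append_nil]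
        exact hu
    have key : ∀ k ≤ N, ∃ t, (List.range k).foldl (fun L i => L.flatMap fun t => exec A msg
        (match rev with
          | true => .seq (.assign n (.sub (.sub e (.const 1)) (.var n))) (c.compile rev (n + 1))
          | false => c.compile rev (n + 1)) ((t.setVar n i).tick 1)) [s.tick (1 + e.cost s.vars)]
          = [t] ∧ s.Applied n Γ ((List.range k).flatMap F) t := by
      intro k
      induction k with
      | zero => exact fun _ => ⟨_, rfl, .of_eq_nil hs rfl rfl rfl rfl⟩
      | succ k ihk =>
        intro hk
        obtain ⟨t, ht, h1⟩ := ihk (by omega)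
        obtain ⟨u, hu, h2⟩ := body k (by omega) t h1.advPos h1.vars
        refine ⟨u, ?_, ?_⟩
        · rw [List.range_succ, List.foldl_append, ht]
          simpa using hu
        · rw [List.range_succ, List.flatMap_append]
          simpa using h1.trans h2
    obtain ⟨t, ht, h1⟩ := key N le_rfl
    refine ⟨t, ?_, h1⟩
    simp only [Circ.compile, exec, he]
    exact ht

end Compile

/-! ### A family of `(2q+1)`-wise independent hash functions -/

/-- An equivariant map carries the uniform distribution to the uniform distribution: shifting by y
only permutes the sum over a, while for fixed a the shifts of `f a` run through β exactly once. It
is used for restricting H, for the hash family and for reprogramming. -/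
theorem card_mul_sum_eq_of_shift {α β : Type*} [Fintype α] [Fintype β] (f : α → β)
    (act : β → β → β) (hact : ∀ b, Function.Bijective fun y => act y b)
    (hf : ∀ y, ∃ σ : α ≃ α, ∀ a, f (σ a) = act y (f a)) (g : β → ℂ) :
    (Fintype.card β : ℂ) * ∑ a, g (f a) = Fintype.card α * ∑ y, g y := by
  calc (Fintype.card β : ℂ) * ∑ a, g (f a) = ∑ y : β, ∑ a, g (act y (f a)) := by
        rw [← nsmul_eq_mul, ← Finset.card_univ, ← Finset.sum_const]
        refine Finset.sum_congr rfl fun y _ => ?_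
        obtain ⟨σ, hσ⟩ := hf y
        rw [← σ.sum_comp]
        simp [hσ]
    _ = ∑ a : α, ∑ y, g (act y (f a)) := Finset.sum_comm
    _ = Fintype.card α * ∑ y, g y := by
        rw [← nsmul_eq_mul, ← Finset.card_univ, ← Finset.sum_const]
        exact Finset.sum_congr rfl fun a _ => (hact (f a)).sum_comp g

/-- Involution given by adding a fixed function to Boolean functions. -/
def xorEquiv {α : Type*} {β : Type*} (g : α → β → Bool) : (α → β → Bool) ≃ (α → β → Bool) where
  toFun f a b := xor (g a b) (f a b)
  invFun f a b := xor (g a b) (f a b)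
  left_inv f := by funext a b; simp
  right_inv f := by funext a b; simp

theorem xor_bijective {α : Type*} {β : Type*} (f : α → β → Bool) :
    Function.Bijective fun (g : α → β → Bool) a b => xor (g a b) (f a b) := by
  refine Function.Involutive.bijective fun g => ?_
  funext a b
  simp

def boolZ (b : Bool) : ZMod 2 := if b then 1 else 0

theorem boolZ_xor (a b : Bool) : boolZ (xor a b) = boolZ a + boolZ b := by
  cases a <;> cases b <;> decide

theorem boolZ_and (a b : Bool) : boolZ (a && b) = boolZ a * boolZ b := by
  cases a <;> cases b <;> decide

theorem boolZ_injective : Function.Injective boolZ := by decide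

@[simp] theorem boolZ_true : boolZ true = 1 := rfl
@[simp] theorem boolZ_false : boolZ false = 0 := rfl

def zBool (z : ZMod 2) : Bool := decide (z = 1)

@[simp] theorem boolZ_zBool : ∀ z : ZMod 2, boolZ (zBool z) = z := by decide

section Hash

variable {S : Sizes}

/-- The number of bits of an input of the hash function. -/
def hashLen (S : Sizes) : ℕ := 1 + S.inst false + S.inst true + max (S.com false) (S.com true)

/-- The bits of an input of the hash function in a row. -/
def hashPos : HashBit S → ℕ
  | .sel => 0
  | .inst false i => 1 + i
  | .inst true i => 1 + S.inst false + i
  | .com i => 1 + S.inst false + S.inst true + i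

theorem hashPos_lt (u : HashBit S) : hashPos u < hashLen S := by
  rcases u with _ | ⟨_ | _, i⟩ | i <;> simp only [hashPos, hashLen] <;> omega

theorem hashPos_injective : Function.Injective (hashPos (S := S)) := by
  rintro (_ | ⟨_ | _, i⟩ | i) (_ | ⟨_ | _, j⟩ | j) h <;> simp only [hashPos] at h <;>
    first
    | rfl
    | (exfalso; omega)
    | (congr 1; ext; omega)

open Polynomial in
/-- The polynomial whose coefficients are the bits of `x`. -/
def inputPoly (x : HashBit S → Bool) : (ZMod 2)[X] :=
  ∑ u, C (boolZ (x u)) * X ^ hashPos u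

theorem inputPoly_coeff (x : HashBit S → Bool) (u : HashBit S) :
    (inputPoly x).coeff (hashPos u) = boolZ (x u) := by
  simp [inputPoly, Polynomial.finsetSum_coeff, Polynomial.coeff_X_pow, hashPos_injective.eq_iff]

theorem inputPoly_injective : Function.Injective (inputPoly (S := S)) := by
  intro x y h
  funext u
  apply boolZ_injective
  rw [← inputPoly_coeff, h, inputPoly_coeff]

theorem hashLen_pos (S : Sizes) : 0 < hashLen S := by simp only [hashLen]; omega

theorem natDegree_inputPoly_le (x : HashBit S → Bool) :
    (inputPoly x).natDegree ≤ hashLen S - 1 := by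
  refine Polynomial.natDegree_sum_le_of_forall_le _ _ fun u _ => ?_
  refine (Polynomial.natDegree_C_mul_X_pow_le _ _).trans ?_
  have := hashPos_lt u
  omega

/-- The number of coefficients kept for each power of the input polynomial. -/
def rowLen (S : Sizes) (q : ℕ) : ℕ := (2 * q + 2) * hashLen S

/-- The total number of coefficients kept. -/
def featLen (S : Sizes) (q : ℕ) : ℕ := (2 * q + 1) * rowLen S q

theorem rowLen_pos (S : Sizes) (q : ℕ) : 0 < rowLen S q :=
  Nat.mul_pos (by omega) (hashLen_pos S)

theorem natDegree_inputPoly_pow_lt (x : HashBit S → Bool) {q i : ℕ} (hi : i ≤ 2 * q) :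
    (inputPoly x ^ i).natDegree < (2 * q + 1) * hashLen S := by
  have h1 := Polynomial.natDegree_pow_le (p := inputPoly x) (n := i)
  have h2 : i * (inputPoly x).natDegree ≤ 2 * q * hashLen S :=
    Nat.mul_le_mul hi ((natDegree_inputPoly_le x).trans (Nat.sub_le _ _))
  have := hashLen_pos S
  have h3 : (2 * q + 1) * hashLen S = 2 * q * hashLen S + hashLen S := by ring
  omega

/-- The coefficients of the powers of the input polynomial, in a row. -/
def feature (q : ℕ) (x : HashBit S → Bool) (u : ℕ) : ZMod 2 :=
  (inputPoly x ^ (u / rowLen S q)).coeff (u % rowLen S q)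

theorem feature_add (q : ℕ) (x : HashBit S → Bool) (i : ℕ) {a : ℕ} (ha : a < rowLen S q) :
    feature q x (i * rowLen S q + a) = (inputPoly x ^ i).coeff a := by
  have h := rowLen_pos S q
  rw [feature, Nat.add_comm, Nat.add_mul_div_right _ _ h, Nat.add_mul_mod_self_right,
    Nat.div_eq_of_lt ha, Nat.mod_eq_of_lt ha, Nat.zero_add]

/-- The linear function of the features with the given coefficients. -/
def linHash {q : ℕ} (r : Fin S.chal → Fin (featLen S q) → Bool) : HashFun S :=
  fun x j => zBool (∑ u, boolZ (r j u) * feature q x u)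

theorem linHash_xor {q : ℕ} (r r' : Fin S.chal → Fin (featLen S q) → Bool) (x : HashBit S → Bool) :
    linHash (xorEquiv r r') x = fun j => xor (linHash r x j) (linHash r' x j) := by
  funext j
  apply boolZ_injective
  simp [linHash, xorEquiv, boolZ_xor, add_mul, Finset.sum_add_distrib]

/-- Distinct inputs give distinct polynomials, and a Vandermonde matrix with distinct nodes in the
domain F₂[X] is nonsingular. At most 2q+1 nodes need only the powers up to 2q. -/
theorem feature_linearIndependent (q : ℕ) (T : Finset (HashBit S → Bool))
    (hT : T.card ≤ 2 * q + 1) :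
    LinearIndependent (ZMod 2) fun (x : T) (u : Fin (featLen S q)) => feature q x.1 u := by
  rw [Fintype.linearIndependent_iff]
  intro c hc
  -- Row i of the features lists all coefficients of the i-th power, so a relation among feature
  -- vectors is a relation among the powers; beyond the row length all coefficients vanish for
  -- degree reasons.
  have hpow : ∀ i < 2 * q + 1, ∑ x : T, Polynomial.C (c x) * inputPoly x.1 ^ i = 0 := by
    intro i hi
    ext a
    rw [Polynomial.finsetSum_coeff, Polynomial.coeff_zero]
    simp only [Polynomial.coeff_C_mul]
    by_cases ha : a < rowLen S q
    · have hu : i * rowLen S q + a < featLen S q := by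
        have : (i + 1) * rowLen S q ≤ (2 * q + 1) * rowLen S q := Nat.mul_le_mul_right _ hi
        rw [featLen]
        have : (i + 1) * rowLen S q = i * rowLen S q + rowLen S q := by ring
        omega
      have := congrFun hc ⟨_, hu⟩
      simpa [Finset.sum_apply, feature_add q _ i ha] using this
    · refine Finset.sum_eq_zero fun x _ => ?_
      rw [Polynomial.coeff_eq_zero_of_natDegree_lt, mul_zero]
      have h1 := natDegree_inputPoly_pow_lt x.1 (show i ≤ 2 * q by omega)
      have h2 : (2 * q + 1) * hashLen S ≤ rowLen S q := Nat.mul_le_mul_right _ (by omega)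
      omega
  let e : Fin T.card ≃ T := T.equivFin.symm
  have hdet : (Matrix.vandermonde fun k => inputPoly (e k).1).det ≠ 0 :=
    Matrix.det_vandermonde_ne_zero_iff.2 fun k l h =>
      e.injective (Subtype.ext (inputPoly_injective h))
  have hzero := Matrix.eq_zero_of_vecMul_eq_zero hdet
    (v := fun k => Polynomial.C (c (e k))) (by
      funext i
      have := hpow i (by omega)
      rw [← e.sum_comp] at this
      simpa [Matrix.vecMul, dotProduct, Matrix.vandermonde_apply] using this)
  intro x
  have := congrFun hzero (e.symm x)
  simpa using this

/-- Linearly independent rows give full row rank, so the feature matrix is surjective; each output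
bit has its own functional. -/
theorem exists_linHash_eq (q : ℕ) (T : Finset (HashBit S → Bool)) (hT : T.card ≤ 2 * q + 1)
    (y : T → Bits S.chal) :
    ∃ r : Fin S.chal → Fin (featLen S q) → Bool, ∀ x : T, linHash r x.1 = y x := by
  let M : Matrix T (Fin (featLen S q)) (ZMod 2) := fun x u => feature q x.1 u
  have hM : LinearIndependent (ZMod 2) M.row := feature_linearIndependent q T hT
  have hsurj : Function.Surjective M.mulVecLin := by
    rw [← LinearMap.range_eq_top]
    apply Submodule.eq_top_of_finrank_eq
    rw [Module.finrank_fintype_fun_eq_card]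
    exact hM.rank_matrix
  choose ρ hρ using fun j => hsurj fun x => boolZ (y x j)
  refine ⟨fun j u => zBool (ρ j u), fun x => funext fun j => ?_⟩
  apply boolZ_injective
  have := congrFun (hρ j) x
  simp only [linHash, boolZ_zBool]
  rw [← this]
  exact Finset.sum_congr rfl fun u _ => mul_comm _ _

/-- Functions of `H` that are combinations of functions depending on at most `k` values of `H`. -/
def boundedDegree (S : Sizes) (k : ℕ) : Submodule ℂ (HashFun S → ℂ) :=
  Submodule.span ℂ {f | ∃ T : Finset (HashBit S → Bool), T.card ≤ k ∧ DependsOn f (T : Set _)}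

theorem mul_mem_boundedDegree {k l : ℕ} {f g : HashFun S → ℂ} (hf : f ∈ boundedDegree S k)
    (hg : g ∈ boundedDegree S l) : f * g ∈ boundedDegree S (k + l) := by
  classical
  have h := Submodule.mul_mem_mul hf hg
  rw [boundedDegree, boundedDegree, Submodule.span_mul_span] at h
  refine Submodule.span_mono ?_ h
  rintro _ ⟨f, ⟨T, hT, hf⟩, g, ⟨U, hU, hg⟩, rfl⟩
  refine ⟨T ∪ U, (Finset.card_union_le _ _).trans (by omega), fun H H' hH => ?_⟩
  have h1 := hf fun i hi => hH i (by simp [Finset.mem_coe.1 hi])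
  have h2 := hg fun i hi => hH i (by simp [Finset.mem_coe.1 hi])
  simp only [Pi.mul_apply, h1, h2]

theorem star_mem_boundedDegree {k : ℕ} {f : HashFun S → ℂ} (hf : f ∈ boundedDegree S k) :
    star f ∈ boundedDegree S k := by
  induction hf using Submodule.span_induction with
  | mem f hf =>
    obtain ⟨T, hT, hf⟩ := hf
    exact Submodule.subset_span ⟨T, hT, fun H H' h => by simp [hf h]⟩
  | zero => simp
  | add f g _ _ hf hg => simpa using add_mem hf hg
  | smul c f _ hf => simpa using Submodule.smul_mem _ (star c) hf

theorem mem_boundedDegree_of_dependsOn {k : ℕ} {f : HashFun S → ℂ}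
    (T : Finset (HashBit S → Bool)) (hT : T.card ≤ k) (hf : DependsOn f (T : Set _)) :
    f ∈ boundedDegree S k :=
  Submodule.subset_span ⟨T, hT, hf⟩

/-- The family `linHash r` looks uniformly random to functions of low degree. -/
theorem sum_linHash (q : ℕ) {k : ℕ} (hk : k ≤ 2 * q + 1) {f : HashFun S → ℂ}
    (hf : f ∈ boundedDegree S k) :
    (Fintype.card (HashFun S) : ℂ) *
        ∑ r : Fin S.chal → Fin (featLen S q) → Bool, f (linHash r) =
      Fintype.card (Fin S.chal → Fin (featLen S q) → Bool) * ∑ H, f H := by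
  classical
  induction hf using Submodule.span_induction with
  | mem f hf =>
    obtain ⟨T, hT, hf⟩ := hf
    -- `f` factors through the restriction to `T`. Both H and `linHash r` restrict to uniform
    -- functions on `T`: a shift by y is realised by a shift of H, respectively of the coefficients
    -- r.
    let g : (T → Bits S.chal) → ℂ := fun y =>
      f fun x => if h : x ∈ T then y ⟨x, h⟩ else fun _ => false
    have hg : ∀ H, f H = g fun x => H x.1 := fun H => hf fun x hx => by
      simp [Finset.mem_coe.1 hx]
    have h1 := card_mul_sum_eq_of_shift (fun (H : HashFun S) (x : T) => H x.1)
      (fun y b x j => xor (y x j) (b x j)) xor_bijective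
      (fun y => ⟨xorEquiv fun x => if h : x ∈ T then y ⟨x, h⟩ else fun _ => false,
        fun H => by funext x j; simp [xorEquiv]⟩) g
    have h2 := card_mul_sum_eq_of_shift
      (fun (r : Fin S.chal → Fin (featLen S q) → Bool) (x : T) => linHash r x.1)
      (fun y b x j => xor (y x j) (b x j)) xor_bijective
      (fun y => by
        obtain ⟨r', hr'⟩ := exists_linHash_eq q T (hT.trans hk) y
        exact ⟨xorEquiv r', fun r => by funext x j; rw [linHash_xor, hr']⟩) g
    simp only [← hg] at h1 h2
    have hne : (Fintype.card (T → Bits S.chal) : ℂ) ≠ 0 := by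
      exact_mod_cast Fintype.card_ne_zero
    apply mul_left_cancel₀ hne
    calc _ = (Fintype.card (HashFun S) : ℂ) * ((Fintype.card (T → Bits S.chal) : ℂ) *
          ∑ r : Fin S.chal → Fin (featLen S q) → Bool, f (linHash r)) := by ring
      _ = Fintype.card (Fin S.chal → Fin (featLen S q) → Bool) *
          ((Fintype.card (HashFun S) : ℂ) * ∑ y, g y) := by rw [h2]; ring
      _ = _ := by rw [← h1]; ring
  | zero => simp
  | add f g _ _ hf hg =>
    simp only [Pi.add_apply, Finset.sum_add_distrib, mul_add, hf, hg]
  | smul c f _ hf =>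
    simp only [Pi.smul_apply, smul_eq_mul, ← Finset.mul_sum]
    rw [mul_left_comm, hf]
    ring

end Hash

/-! ### Measure and reprogram -/

section Telescope

variable {V : Type*} [AddCommGroup V] [Module ℂ V]

/-- Apply `D 0, …, D (n - 1)` one after the other. -/
def iter (D : ℕ → V →ₗ[ℂ] V) (φ : V) : ℕ → V
  | 0 => φ
  | n + 1 => D n (iter D φ n)

theorem iter_congr {D D' : ℕ → V →ₗ[ℂ] V} {φ : V} {n : ℕ} (h : ∀ i < n, D i = D' i) :
    iter D φ n = iter D' φ n := by
  induction n with
  | zero => rfl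
  | succ n ih => rw [iter, iter, ih fun i hi => h i (by omega), h n (by omega)]

/-- `C` up to step `k / 2`, then `P` once, then `B`; step `k / 2` itself is `B` if `k` is even. -/
def hybrid (B C P : ℕ → V →ₗ[ℂ] V) (k i : ℕ) : V →ₗ[ℂ] V :=
  (if k ≤ 2 * i then B i else C i) ∘ₗ (if k / 2 = i then P i else LinearMap.id)

/-- The identity is B = C + BP − CP, applied to the part of the state that has not yet been
reprogrammed. Parts that already contain P are continued with B. -/
theorem iter_eq_add_sum_hybrid (B C P : ℕ → V →ₗ[ℂ] V)
    (h : ∀ i, B i - C i = (B i - C i) ∘ₗ P i) (φ : V) (n : ℕ) :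
    iter B φ n = iter C φ n + ∑ k ∈ Finset.range (2 * n), (-1 : ℂ) ^ k •
      iter (hybrid B C P k) φ n := by
  have hC : ∀ n k, 2 * n ≤ k → iter (hybrid B C P k) φ n = iter C φ n := fun n k hk =>
    iter_congr fun i hi => by
      rw [hybrid, if_neg (by omega), if_neg (by omega), LinearMap.comp_id]
  induction n with
  | zero => simp [iter]
  | succ n ih =>
    have h1 : ∀ k ∈ Finset.range (2 * n), (-1 : ℂ) ^ k • iter (hybrid B C P k) φ (n + 1) =
        B n ((-1 : ℂ) ^ k • iter (hybrid B C P k) φ n) := by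
      intro k hk
      rw [Finset.mem_range] at hk
      rw [iter, hybrid, if_pos (by omega), if_neg (by omega), LinearMap.comp_id, map_smul]
    have h2 : B n (iter C φ n) = C n (iter C φ n) + (B n (P n (iter C φ n))
        - C n (P n (iter C φ n))) := by
      have := LinearMap.congr_fun (h n) (iter C φ n)
      simp only [LinearMap.sub_apply, LinearMap.comp_apply] at this
      rw [← this]
      abel
    rw [show 2 * (n + 1) = 2 * n + 1 + 1 by ring, Finset.sum_range_succ, Finset.sum_range_succ,
      Finset.sum_congr rfl h1, ← map_sum]
    rw [iter, ih, map_add, h2]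
    simp only [iter]
    -- The new hybrids 2n and 2n + 1 are the terms BP and −CP at step n.
    rw [hC n _ le_rfl, hC n _ (by omega), hybrid, hybrid, if_pos le_rfl, if_pos (by omega),
      if_neg (by omega), if_pos (by omega)]
    simp only [LinearMap.comp_apply, pow_succ, pow_mul]
    simp
    abel

/-- The remaining pure C term is the hybrid with index 2n, whose observation lies after the last
step. Its sign is positive. -/
theorem iter_eq_sum_hybrid (B C P : ℕ → V →ₗ[ℂ] V)
    (h : ∀ i, B i - C i = (B i - C i) ∘ₗ P i) (φ : V) (n : ℕ) :
    iter B φ n = ∑ k ∈ Finset.range (2 * n + 1), (-1 : ℂ) ^ k • iter (hybrid B C P k) φ n := by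
  rw [iter_eq_add_sum_hybrid B C P h, Finset.sum_range_succ, add_comm]
  congr 1
  rw [pow_mul]
  simp only [even_two, Even.neg_pow, one_pow, one_smul]
  exact iter_congr fun i hi => by
    rw [hybrid, if_neg (by omega), if_neg (by omega), LinearMap.comp_id]

end Telescope

/-! ### Hybrids of the adversary for two reprogrammed points. -/

section Ideal

variable {S : Sizes} {q : ℕ} {E : Type} [Fintype E] [DecidableEq E]

/-- The function `H`, with the value at `h β` replaced by `Θ β` if `e β`. -/
def reprogram (H : HashFun S) (e : Bool → Bool) (h : Bool → HashBit S → Bool)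
    (Θ : Bool → Bits S.chal) : HashFun S := fun x j =>
  xor (xor (!(e false && decide (x = h false)) && !(e true && decide (x = h true)) && H x j)
    (e false && decide (x = h false) && Θ false j)) (e true && decide (x = h true) && Θ true j)

/-- The contents of the register that the simulator looks at after `i` steps: the query input, or
the part of the final output that determines the hash value for `Σ_{!β}`. -/
def shown (q i : ℕ) (β : Bool) (s : AdvQubit S → Bool) : HashBit S → Bool :=
  if q ≤ i then hashInput β (fun b i => s (.outInst b i)) (fun i => s (.outCom β i))
  else fun u => s (.queryInput u)

/-- The restriction of a state to the basis states with the property `p`. -/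
def mask {ι : Type*} (p : ι → Prop) [DecidablePred p] : (ι → ℂ) →ₗ[ℂ] (ι → ℂ) where
  toFun ψ s := if p s then ψ s else 0
  map_add' ψ χ := by funext s; by_cases h : p s <;> simp [h]
  map_smul' c ψ := by funext s; by_cases h : p s <;> simp [h]

/-- The `i`-th operation of the adversary. -/
def Adversary.stepAt (A : Adversary S q E) (i : ℕ) :
    (AdvBasis S E → ℂ) →ₗ[ℂ] (AdvBasis S E → ℂ) :=
  if h : i < q then (A.step ⟨i, h⟩).mulVecLin else LinearMap.id

def oracleLin (E : Type) (H : HashFun S) : (AdvBasis S E → ℂ) →ₗ[ℂ] (AdvBasis S E → ℂ) :=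
  LinearMap.funLeft ℂ ℂ (oracleMap H)

theorem Adversary.finalState_eq_iter (A : Adversary S q E) (H : HashFun S) :
    A.finalState H = iter (fun i => A.stepAt i ∘ₗ oracleLin E H) A.start q := by
  have h1 : A.finalState H = (List.range q).foldl
      (fun ψ i => A.stepAt i (applyOracle H ψ)) A.start := by
    rw [← List.map_coe_finRange_eq_range, List.foldl_map, Adversary.finalState]
    congr 1
    funext ψ i
    simp [Adversary.stepAt]
  have h2 : ∀ n, (List.range n).foldl (fun ψ i => A.stepAt i (applyOracle H ψ)) A.start =
      iter (fun i => A.stepAt i ∘ₗ oracleLin E H) A.start n := by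
    intro n
    induction n with
    | zero => rfl
    | succ n ih => rw [List.range_succ, List.foldl_append, ih]; rfl
  rw [h1, h2]

/-- From query `κ β / 2` on, or after it if `κ β` is odd, the value at `h β` is reprogrammed. -/
def enabled (κ : Bool → ℕ) (i : ℕ) (β : Bool) : Bool := decide (κ β ≤ 2 * i)

/-- The points `h β` with `κ β / 2 = i` agree with what the simulator sees after `i` steps. -/
def Agrees (q : ℕ) (κ : Bool → ℕ) (h : Bool → HashBit S → Bool) (i : ℕ)
    (s : AdvQubit S → Bool) : Prop :=
  ∀ β, κ β / 2 = i → shown q i β s = h β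

instance (q : ℕ) (κ : Bool → ℕ) (h : Bool → HashBit S → Bool) (i : ℕ) (s : AdvQubit S → Bool) :
    Decidable (Agrees q κ h i s) :=
  inferInstanceAs (Decidable (∀ β, κ β / 2 = i → shown q i β s = h β))

/-- The state before step `i` of the simulation, given that `h 0` and `h 1` were observed. -/
def Adversary.preIdeal (A : Adversary S q E) (κ : Bool → ℕ) (H : HashFun S)
    (h : Bool → HashBit S → Bool) (Θ : Bool → Bits S.chal) : ℕ → AdvBasis S E → ℂ :=
  iter (fun i => A.stepAt i ∘ₗ oracleLin E (reprogram H (enabled κ i) h Θ) ∘ₗ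
    mask fun s => Agrees q κ h i s.1) A.start

/-- The same, after the observation at step `i`. -/
def Adversary.ideal (A : Adversary S q E) (κ : Bool → ℕ) (H : HashFun S)
    (h : Bool → HashBit S → Bool) (Θ : Bool → Bits S.chal) (i : ℕ) : AdvBasis S E → ℂ :=
  mask (fun s => Agrees q κ h i s.1) (A.preIdeal κ H h Θ i)

def pairNat (k l : ℕ) (β : Bool) : ℕ := if β then l else k

omit [Fintype E] [DecidableEq E] in
theorem oracleMap_congr {H H' : HashFun S} {s : AdvBasis S E}
    (h : H (fun u => s.1 (.queryInput u)) = H' (fun u => s.1 (.queryInput u))) :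
    oracleMap H s = oracleMap H' s := by
  simp [oracleMap, h]

omit [Fintype E] [DecidableEq E] in
@[simp] theorem oracleMap_queryInput (H : HashFun S) (s : AdvBasis S E) (u : HashBit S) :
    (oracleMap H s).1 (.queryInput u) = s.1 (.queryInput u) := rfl

/-- Off φ the two oracles act alike and the difference vanishes; since both oracle maps give φ the
same truth value, the projection can be moved in front of the oracle call. -/
theorem reprogram_sub {φ : AdvBasis S E → Prop} [DecidablePred φ] {H H' : HashFun S}
    (T : (AdvBasis S E → ℂ) →ₗ[ℂ] (AdvBasis S E → ℂ))
    (hφ : ∀ s, φ (oracleMap H s) ↔ φ (oracleMap H' s))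
    (h : ∀ s : AdvBasis S E, ¬ φ (oracleMap H s) → oracleMap H s = oracleMap H' s) :
    T ∘ₗ oracleLin E H - T ∘ₗ oracleLin E H' =
      (T ∘ₗ oracleLin E H - T ∘ₗ oracleLin E H') ∘ₗ mask φ := by
  rw [← LinearMap.comp_sub, LinearMap.comp_assoc]
  congr 1
  ext ψ s
  · simp only [LinearMap.comp_apply, LinearMap.sub_apply, oracleLin, LinearMap.funLeft_apply,
      mask, LinearMap.coe_mk, AddHom.coe_mk, Pi.sub_apply, ← hφ]
    by_cases hs : φ (oracleMap H s)
    · simp [hs]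
    · simp [h s hs]

theorem mask_comm {ι : Type*} (p r : ι → Prop) [DecidablePred p] [DecidablePred r] :
    mask p ∘ₗ mask r = mask r ∘ₗ mask p := by
  refine LinearMap.ext fun ψ => funext fun s => ?_
  by_cases h : p s <;> by_cases h' : r s <;> simp [mask, h, h']

/-- The telescoping is done first for the point of index `false`, with the other point reprogrammed
throughout, and then inside each resulting hybrid for the point of index `true`. -/
theorem Adversary.finalState_reprogram (A : Adversary S q E) (H : HashFun S)
    (h : Bool → HashBit S → Bool) (Θ : Bool → Bits S.chal) :
    A.finalState (reprogram H (fun _ => true) h Θ) =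
      ∑ k ∈ Finset.range (2 * q + 1), ∑ l ∈ Finset.range (2 * q + 1),
        ((-1 : ℂ) ^ k * (-1) ^ l) • A.preIdeal (pairNat k l) H h Θ q := by
  let O (e e' : Bool) : (AdvBasis S E → ℂ) →ₗ[ℂ] (AdvBasis S E → ℂ) :=
    oracleLin E (reprogram H (fun β => if β then e' else e) h Θ)
  let M (β : Bool) : (AdvBasis S E → ℂ) →ₗ[ℂ] (AdvBasis S E → ℂ) :=
    mask fun s => (fun u => s.1 (.queryInput u)) = h β
  have e1 : ∀ (i : ℕ) (T : (AdvBasis S E → ℂ) →ₗ[ℂ] (AdvBasis S E → ℂ)),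
      T ∘ₗ O true true - T ∘ₗ O false true =
        (T ∘ₗ O true true - T ∘ₗ O false true) ∘ₗ M false := by
    intro i T
    refine reprogram_sub T (fun s => Iff.rfl) fun s hs => oracleMap_congr ?_
    simp only [oracleMap_queryInput] at hs
    funext j
    simp [reprogram, hs]
  have e2 : ∀ (e : Bool) (T : (AdvBasis S E → ℂ) →ₗ[ℂ] (AdvBasis S E → ℂ)),
      T ∘ₗ O e true - T ∘ₗ O e false = (T ∘ₗ O e true - T ∘ₗ O e false) ∘ₗ M true := by
    intro e T
    refine reprogram_sub T (fun s => Iff.rfl) fun s hs => oracleMap_congr ?_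
    simp only [oracleMap_queryInput] at hs
    funext j
    simp [reprogram, hs]
  have s1 : A.finalState (reprogram H (fun _ => true) h Θ) =
      iter (fun i => A.stepAt i ∘ₗ O true true) A.start q := by
    rw [A.finalState_eq_iter]
    simp only [O, ite_self]
  rw [s1, iter_eq_sum_hybrid _ (fun i => A.stepAt i ∘ₗ O false true) (fun _ => M false)
    (fun i => e1 i _)]
  refine Finset.sum_congr rfl fun k _ => ?_
  let N (i : ℕ) : (AdvBasis S E → ℂ) →ₗ[ℂ] (AdvBasis S E → ℂ) :=
    if k / 2 = i then M false else LinearMap.id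
  have s2 : iter (hybrid (fun i => A.stepAt i ∘ₗ O true true)
      (fun i => A.stepAt i ∘ₗ O false true) (fun _ => M false) k) A.start q =
      iter (fun i => (A.stepAt i ∘ₗ O (decide (k ≤ 2 * i)) true) ∘ₗ N i) A.start q := by
    refine iter_congr fun i _ => ?_
    simp only [hybrid, N]
    by_cases hk : k ≤ 2 * i <;> simp [hk]
  have hcomm : ∀ i, M true ∘ₗ N i = N i ∘ₗ M true := by
    intro i
    simp only [N]
    split
    · exact mask_comm _ _
    · rfl
  -- The projection `N i` of the first telescoping stands to the right of the oracle. It commutes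
  -- with `M true`, both being diagonal, so the second telescoping still has the required form.
  rw [s2, iter_eq_sum_hybrid _
    (fun i => (A.stepAt i ∘ₗ O (decide (k ≤ 2 * i)) false) ∘ₗ N i) (fun _ => M true)
    (fun i => by
      rw [← LinearMap.sub_comp, LinearMap.comp_assoc, ← hcomm, ← LinearMap.comp_assoc]
      exact congrArg (· ∘ₗ N i) (e2 _ _)), Finset.smul_sum]
  refine Finset.sum_congr rfl fun l _ => ?_
  rw [smul_smul]
  congr 1
  refine iter_congr fun i hi => ?_
  have hmask : (mask fun s : AdvBasis S E => Agrees q (pairNat k l) h i s.1) =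
      N i ∘ₗ (if l / 2 = i then M true else LinearMap.id) := by
    refine LinearMap.ext fun ψ => funext fun s => ?_
    simp only [Agrees, shown, N, M, Bool.forall_bool, pairNat, if_neg (show ¬ q ≤ i by omega)]
    by_cases h1 : k / 2 = i <;> by_cases h2 : l / 2 = i <;>
      simp [h1, h2, mask, ite_and]
  have hO : O (decide (k ≤ 2 * i)) (decide (l ≤ 2 * i)) =
      oracleLin E (reprogram H (enabled (pairNat k l) i) h Θ) := by
    simp only [O]
    congr 2
    funext β
    cases β <;> simp [enabled, pairNat]
  rw [hmask, ← hO]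
  simp only [hybrid, LinearMap.comp_assoc]
  by_cases hl : l ≤ 2 * i <;> simp [hl, LinearMap.comp_assoc]

end Ideal

/-! ### The success probability of the ideal simulation -/

section Average

variable {S : Sizes} {q : ℕ} {E : Type} [Fintype E] [DecidableEq E]

theorem Adversary.preIdeal_succ (A : Adversary S q E) (κ : Bool → ℕ) (H : HashFun S)
    (h : Bool → HashBit S → Bool) (Θ : Bool → Bits S.chal) (i : ℕ) :
    A.preIdeal κ H h Θ (i + 1) = A.stepAt i (applyOracle (reprogram H (enabled κ i) h Θ)
      (A.ideal κ H h Θ i)) := rfl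

theorem Adversary.ideal_apply (A : Adversary S q E) (κ : Bool → ℕ) (H : HashFun S)
    (h : Bool → HashBit S → Bool) (Θ : Bool → Bits S.chal) (i : ℕ) (s : AdvBasis S E) :
    A.ideal κ H h Θ i s = if Agrees q κ h i s.1 then A.preIdeal κ H h Θ i s else 0 := rfl

/-- Causality: the point of index β enters at step κ β / 2, and its value at steps j with κ β ≤ 2j.
Before step i this can happen only if κ β < 2i. This is what permits the challenge to arrive late.
-/
theorem Adversary.preIdeal_congr (A : Adversary S q E) (κ : Bool → ℕ) (H : HashFun S)
    {h h' : Bool → HashBit S → Bool} {Θ Θ' : Bool → Bits S.chal} {i : ℕ}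
    (hh : ∀ β, κ β < 2 * i → h β = h' β) (hΘ : ∀ β, κ β < 2 * i → Θ β = Θ' β) :
    A.preIdeal κ H h Θ i = A.preIdeal κ H h' Θ' i := by
  refine iter_congr fun j hj => ?_
  have e1 : reprogram H (enabled κ j) h Θ = reprogram H (enabled κ j) h' Θ' := by
    have key : ∀ β x k, (enabled κ j β && decide (x = h β)) = (enabled κ j β && decide (x = h' β))
        ∧ (enabled κ j β && decide (x = h' β) && Θ β k) =
          (enabled κ j β && decide (x = h' β) && Θ' β k) := by
      intro β x k
      by_cases hβ : κ β ≤ 2 * j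
      · rw [hh β (by omega), hΘ β (by omega)]
        exact ⟨rfl, rfl⟩
      · simp [enabled, hβ]
    funext x k
    simp only [reprogram]
    rw [(key false x k).1, (key true x k).1, (key false x k).2, (key true x k).2]
  have e2 : (mask fun s : AdvBasis S E => Agrees q κ h j s.1) =
      mask fun s => Agrees q κ h' j s.1 := by
    refine LinearMap.ext fun ψ => funext fun s => ?_
    have : Agrees q κ h j s.1 ↔ Agrees q κ h' j s.1 :=
      forall₂_congr fun β hβ => by rw [hh β (by omega)]
    simp [mask, this]
  rw [e1, e2]

/-- The polynomial method: a query raises the degree in the values of H by at most one, and the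
other operations are linear and do not depend on H. -/
theorem Adversary.preIdeal_mem_boundedDegree (A : Adversary S q E) (κ : Bool → ℕ)
    (h : Bool → HashBit S → Bool) (Θ : Bool → Bits S.chal) (i : ℕ) :
    ∀ s, (fun H => A.preIdeal κ H h Θ i s) ∈ boundedDegree S i := by
  classical
  induction i with
  | zero => exact fun s => mem_boundedDegree_of_dependsOn ∅ (by simp) fun _ _ _ => rfl
  | succ i ih =>
    have hid : ∀ s, (fun H => A.ideal κ H h Θ i s) ∈ boundedDegree S i := by
      intro s
      simp only [A.ideal_apply]
      split
      · exact ih s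
      · exact zero_mem _
    have hor : ∀ s, (fun H => applyOracle (reprogram H (enabled κ i) h Θ)
        (A.ideal κ H h Θ i) s) ∈ boundedDegree S (1 + i) := by
      intro s
      set x : HashBit S → Bool := fun u => s.1 (.queryInput u) with hx
      -- Split by the value y at the queried input: an indicator that depends on a single value of
      -- H, times an amplitude at a basis state that no longer depends on H.
      have : (fun H => applyOracle (reprogram H (enabled κ i) h Θ) (A.ideal κ H h Θ i) s) =
          ∑ y : Bits S.chal, (fun H => if reprogram H (enabled κ i) h Θ x = y then (1 : ℂ) else 0) *
            fun H => A.ideal κ H h Θ i (oracleMap (fun _ => y) s) := by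
        funext H
        simp only [Finset.sum_apply, Pi.mul_apply, ite_mul, one_mul, zero_mul,
          Finset.sum_ite_eq, Finset.mem_univ, if_true]
        rw [applyOracle, oracleMap_congr (H' := fun _ => reprogram H (enabled κ i) h Θ x) rfl]
      rw [this]
      refine sum_mem fun y _ => mul_mem_boundedDegree ?_ (hid _)
      refine mem_boundedDegree_of_dependsOn {x} (by simp) fun H H' hH => ?_
      have : reprogram H (enabled κ i) h Θ x = reprogram H' (enabled κ i) h Θ x := by
        funext j
        simp only [reprogram, hH x (by simp)]
      simp only [this]
    rw [add_comm] at hor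
    intro s
    by_cases hi : i < q
    · have : (fun H => A.preIdeal κ H h Θ (i + 1) s) = ∑ t, A.step ⟨i, hi⟩ s t •
          fun H => applyOracle (reprogram H (enabled κ i) h Θ) (A.ideal κ H h Θ i) t := by
        funext H
        simp [A.preIdeal_succ, Adversary.stepAt, hi, Matrix.mulVec, dotProduct]
      rw [this]
      exact sum_mem fun t _ => Submodule.smul_mem _ _ (hor t)
    · simpa [A.preIdeal_succ, Adversary.stepAt, hi] using hor s

/-- The squared modulus is the amplitude times its conjugate and so has degree at most 2q, within
the independence of the family. -/
theorem Adversary.sum_norm_ideal (A : Adversary S q E) (κ : Bool → ℕ)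
    (h : Bool → HashBit S → Bool) (Θ : Bool → Bits S.chal) (s : AdvBasis S E) :
    (Fintype.card (HashFun S) : ℝ) *
        ∑ r : Fin S.chal → Fin (featLen S q) → Bool, ‖A.ideal κ (linHash r) h Θ q s‖ ^ 2 =
      Fintype.card (Fin S.chal → Fin (featLen S q) → Bool) *
        ∑ H, ‖A.ideal κ H h Θ q s‖ ^ 2 := by
  have h1 : (fun H => A.ideal κ H h Θ q s) ∈ boundedDegree S q := by
    simp only [A.ideal_apply]
    split
    · exact A.preIdeal_mem_boundedDegree κ h Θ q s
    · exact zero_mem _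
  have h2 := sum_linHash q (by omega) (mul_mem_boundedDegree h1 (star_mem_boundedDegree h1))
  simp only [Pi.mul_apply, Pi.star_apply, RCLike.star_def, Complex.mul_conj,
    Complex.normSq_eq_norm_sq] at h2
  exact_mod_cast h2

/-- Resampling a uniform function at two distinct points leaves it uniform. Distinctness is needed
because coinciding points would have to carry both values. -/
theorem sum_reprogram (h : Bool → HashBit S → Bool) (hne : h false ≠ h true)
    (F : HashFun S → ℝ) :
    (Fintype.card (Bool → Bits S.chal) : ℝ) * ∑ H, F H =
      ∑ Θ : Bool → Bits S.chal, ∑ H, F (reprogram H (fun _ => true) h Θ) := by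
  have hval : ∀ (H : HashFun S) Θ x j, reprogram H (fun _ => true) h Θ x j =
      if x = h false then Θ false j else if x = h true then Θ true j else H x j := by
    intro H Θ x j
    by_cases h0 : x = h false
    · have : x ≠ h true := fun h1 => hne (h0.symm.trans h1)
      simp [reprogram, h0, hne]
    · by_cases h1 : x = h true <;> simp [reprogram, h0, h1, hne.symm]
  have key := card_mul_sum_eq_of_shift
    (fun p : (Bool → Bits S.chal) × HashFun S => reprogram p.2 (fun _ => true) h p.1)
    (fun y b x j => xor (y x j) (b x j)) xor_bijective
    (fun y => ⟨(xorEquiv fun β => y (h β)).prodCongr (xorEquiv y), fun p => by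
      funext x j
      simp only [Equiv.prodCongr_apply, Prod.map, hval, xorEquiv, Equiv.coe_fn_mk]
      split_ifs with h0 h1
      · rw [h0]
      · rw [h1]
      · rfl⟩) (fun H => (F H : ℂ))
  rw [Fintype.sum_prod_type, Fintype.card_prod] at key
  have hne' : (Fintype.card (HashFun S) : ℂ) ≠ 0 := by exact_mod_cast Fintype.card_ne_zero
  push_cast at key
  have key' : (Fintype.card (HashFun S) : ℂ) * ∑ Θ : Bool → Bits S.chal, ∑ H,
      (F (reprogram H (fun _ => true) h Θ) : ℂ) = (Fintype.card (HashFun S) : ℂ) *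
      ((Fintype.card (Bool → Bits S.chal) : ℂ) * ∑ H, (F H : ℂ)) := by
    rw [key]; ring
  have := mul_left_cancel₀ hne' key'
  exact_mod_cast this.symm

/-- The hash inputs for the OR-proof that the basis state contains. -/
def proofPoint (x : Instances S) (s : AdvQubit S → Bool) (β : Bool) : HashBit S → Bool :=
  hashInput β x fun i => s (.outCom β i)

theorem proofPoint_ne (x : Instances S) (s : AdvQubit S → Bool) :
    proofPoint x s false ≠ proofPoint x s true := fun h => by
  have := congrFun h .sel
  simp [proofPoint, hashInput] at this

/-- The protocol that the simulator attacks: the one whose first message is determined first. -/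
def pickBit (κ : Bool → ℕ) : Bool := decide (κ true < κ false)

/-- The output registers contain the instances `x` and an accepting transcript of `Σ_b`. -/
def Accepts (V : Verifiers S) (x : Instances S) (b : Bool) (c : Bits S.chal)
    (s : AdvQubit S → Bool) : Prop :=
  (∀ β i, s (.outInst β i) = x β i) ∧
    V b (x b) (fun i => s (.outCom b i)) c (fun i => s (.outResp b i))

open Classical in
/-- The success probability of the simulation with the guess `κ`. -/
def Adversary.simProb (A : Adversary S q E) (V : Verifiers S) (x : Instances S)
    (κ : Bool → ℕ) : ℝ :=
  (∑ Θ : Bool → Bits S.chal, ∑ r : Fin S.chal → Fin (featLen S q) → Bool, ∑ s : AdvBasis S E,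
    if Accepts V x (pickBit κ) (Θ (!pickBit κ)) s.1
    then ‖A.ideal κ (linHash r) (proofPoint x s.1) Θ q s‖ ^ 2 else 0) /
  ((Fintype.card (Bool → Bits S.chal) : ℝ) *
    Fintype.card (Fin S.chal → Fin (featLen S q) → Bool))

/-- The points are read off the output `s` itself, so an observation deferred to the end always
agrees and the last mask is trivial. The rest is Cauchy–Schwarz for (2q+1)² terms. -/
theorem Adversary.norm_finalState_le (A : Adversary S q E) (H : HashFun S)
    (Θ : Bool → Bits S.chal) {x : Instances S} {s : AdvBasis S E}
    (hs : ∀ β i, s.1 (.outInst β i) = x β i) :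
    ‖A.finalState (reprogram H (fun _ => true) (proofPoint x s.1) Θ) s‖ ^ 2 ≤
      (2 * (q : ℝ) + 1) ^ 2 * ∑ k ∈ Finset.range (2 * q + 1), ∑ l ∈ Finset.range (2 * q + 1),
        ‖A.ideal (pairNat k l) H (proofPoint x s.1) Θ q s‖ ^ 2 := by
  have hag : ∀ κ, Agrees q κ (proofPoint x s.1) q s.1 := by
    intro κ β _
    simp only [shown, if_pos le_rfl, proofPoint]
    congr 1
    funext β i
    exact hs β i
  rw [A.finalState_reprogram]
  simp only [Finset.sum_apply, Pi.smul_apply, A.ideal_apply, hag, if_true, smul_eq_mul]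
  rw [← Finset.sum_product', ← Finset.sum_product']
  calc _ ≤ (∑ p ∈ Finset.range (2 * q + 1) ×ˢ Finset.range (2 * q + 1),
        ‖A.preIdeal (pairNat p.1 p.2) H (proofPoint x s.1) Θ q s‖) ^ 2 := by
        gcongr
        refine (norm_sum_le _ _).trans (Finset.sum_le_sum fun p _ => ?_)
        simp
    _ ≤ _ := by
        refine sq_sum_le_card_mul_sum_sq.trans (le_of_eq ?_)
        simp only [Finset.card_product, Finset.card_range]
        push_cast
        ring

theorem reprogram_apply_point (H : HashFun S) {h : Bool → HashBit S → Bool}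
    (hne : h false ≠ h true) (Θ : Bool → Bits S.chal) (β : Bool) :
    reprogram H (fun _ => true) h Θ (h β) = Θ β := by
  funext j
  cases β <;> simp [reprogram, hne, hne.symm]

omit [Fintype E] [DecidableEq E] in
theorem accepts_of_validOrProof {V : Verifiers S} {x : Instances S} {H : HashFun S}
    {Θ : Bool → Bits S.chal} {s : AdvBasis S E} (hs : ∀ β i, s.1 (.outInst β i) = x β i)
    (hv : ValidOrProof V (reprogram H (fun _ => true) (proofPoint x s.1) Θ) x
      (fun b i => s.1 (.outCom b i)) (fun b i => s.1 (.outResp b i))) (b : Bool) :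
    Accepts V x b (Θ (!b)) s.1 := by
  refine ⟨hs, ?_⟩
  have h := hv b
  have e : reprogram H (fun _ => true) (proofPoint x s.1) Θ
      (hashInput (!b) x fun i => s.1 (.outCom (!b) i)) = Θ (!b) :=
    reprogram_apply_point H (proofPoint_ne x s.1) Θ (!b)
  rwa [e] at h

theorem ite_le_of_imp {p : Prop} [Decidable p] {a b : ℝ} (h : p → a ≤ b) (hb : 0 ≤ b) :
    (if p then a else 0) ≤ b := by
  split
  · exact h ‹_›
  · exact hb

theorem sum_sum_rotate {α β γ : Type*} [Fintype α] [Fintype β] [Fintype γ] (R T : Finset ℕ)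
    (f : ℕ → ℕ → α → β → γ → ℝ) : ∑ k ∈ R, ∑ l ∈ T, ∑ a, ∑ b, ∑ c, f k l a b c =
      ∑ c, ∑ a, ∑ b, ∑ k ∈ R, ∑ l ∈ T, f k l a b c := by
  simp only [← Finset.sum_product' R T fun k l => _]
  rw [Finset.sum_comm]
  conv_rhs => rw [Finset.sum_comm]
  refine Finset.sum_congr rfl fun a _ => ?_
  rw [Finset.sum_comm]
  conv_rhs => rw [Finset.sum_comm]
  exact Finset.sum_congr rfl fun b _ => Finset.sum_comm

/-- For each output state the probability over H is rewritten with reprogramming at the points of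
that output. A valid OR-proof is in particular an accepting transcript of Σ_b with challenge Θ_{!b},
for whichever b the hybrid picks. -/
theorem Adversary.successProb_le (A : Adversary S q E) (V : Verifiers S) (x : Instances S) :
    A.successProb V x ≤ (2 * (q : ℝ) + 1) ^ 2 * ∑ k ∈ Finset.range (2 * q + 1),
      ∑ l ∈ Finset.range (2 * q + 1), A.simProb V x (pairNat k l) := by
  classical
  set cH : ℝ := (Fintype.card (HashFun S) : ℝ) with hcH
  set cΘ : ℝ := (Fintype.card (Bool → Bits S.chal) : ℝ) with hcΘ
  set cR : ℝ := (Fintype.card (Fin S.chal → Fin (featLen S q) → Bool) : ℝ) with hcR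
  have pH : 0 < cH := by simp only [hcH]; exact_mod_cast Fintype.card_pos
  have pΘ : 0 < cΘ := by simp only [hcΘ]; exact_mod_cast Fintype.card_pos
  have pR : 0 < cR := by simp only [hcR]; exact_mod_cast Fintype.card_pos
  set R := Finset.range (2 * q + 1) with hR
  let good (κ : Bool → ℕ) (Θ : Bool → Bits S.chal) (s : AdvBasis S E) : Prop :=
    Accepts V x (pickBit κ) (Θ (!pickBit κ)) s.1
  let w (κ : Bool → ℕ) (Θ : Bool → Bits S.chal) (H : HashFun S) (s : AdvBasis S E) : ℝ :=
    ‖A.ideal κ H (proofPoint x s.1) Θ q s‖ ^ 2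
  have hsim : ∀ κ, cH * cΘ * A.simProb V x κ =
      ∑ Θ, ∑ H, ∑ s : AdvBasis S E, if good κ Θ s then w κ Θ H s else 0 := by
    intro κ
    rw [Adversary.simProb, ← hcΘ, ← hcR]
    have : cR * (cH * cΘ * ((∑ Θ : Bool → Bits S.chal,
        ∑ r : Fin S.chal → Fin (featLen S q) → Bool, ∑ s : AdvBasis S E,
        if good κ Θ s then w κ Θ (linHash r) s else 0) / (cΘ * cR))) =
        cR * ∑ Θ, ∑ H, ∑ s : AdvBasis S E, if good κ Θ s then w κ Θ H s else 0 := by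
      rw [show ∀ X : ℝ, cR * (cH * cΘ * (X / (cΘ * cR))) = cH * X from fun X => by
        field_simp, Finset.mul_sum, Finset.mul_sum]
      refine Finset.sum_congr rfl fun Θ _ => ?_
      rw [Finset.sum_comm, Finset.mul_sum, Finset.sum_comm (γ := HashFun S), Finset.mul_sum]
      refine Finset.sum_congr rfl fun s _ => ?_
      by_cases hg : good κ Θ s
      · simp only [hg, if_true]
        exact A.sum_norm_ideal κ _ Θ s
      · simp [hg]
    exact mul_left_cancel₀ pR.ne' this
  have hmain : cΘ * (cH * A.successProb V x) ≤ cΘ * (cH * ((2 * (q : ℝ) + 1) ^ 2 *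
      ∑ k ∈ R, ∑ l ∈ R, A.simProb V x (pairNat k l))) := by
    -- The sum over `s` is outermost, since the points to be reprogrammed depend on `s`.
    have e1 : cΘ * (cH * A.successProb V x) = ∑ s : AdvBasis S E, ∑ Θ : Bool → Bits S.chal, ∑ H,
        if (∀ b i, s.1 (.outInst b i) = x b i) ∧
          ValidOrProof V (reprogram H (fun _ => true) (proofPoint x s.1) Θ) x
            (fun b i => s.1 (.outCom b i)) (fun b i => s.1 (.outResp b i))
        then ‖A.finalState (reprogram H (fun _ => true) (proofPoint x s.1) Θ) s‖ ^ 2 else 0 := by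
      rw [Adversary.successProb, ← hcH, mul_div_cancel₀ _ pH.ne']
      simp only [Adversary.successGiven]
      rw [Finset.sum_comm, Finset.mul_sum]
      exact Finset.sum_congr rfl fun s _ =>
        sum_reprogram (proofPoint x s.1) (proofPoint_ne x s.1) fun H =>
          if (∀ b i, s.1 (.outInst b i) = x b i) ∧ ValidOrProof V H x
            (fun b i => s.1 (.outCom b i)) (fun b i => s.1 (.outResp b i))
          then ‖A.finalState H s‖ ^ 2 else 0
    have e2 : cΘ * (cH * ((2 * (q : ℝ) + 1) ^ 2 * ∑ k ∈ R, ∑ l ∈ R,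
        A.simProb V x (pairNat k l))) = ∑ s : AdvBasis S E, ∑ Θ : Bool → Bits S.chal, ∑ H,
        (2 * (q : ℝ) + 1) ^ 2 * ∑ k ∈ R, ∑ l ∈ R,
          if good (pairNat k l) Θ s then w (pairNat k l) Θ H s else 0 := by
      have : cΘ * (cH * ((2 * (q : ℝ) + 1) ^ 2 * ∑ k ∈ R, ∑ l ∈ R,
        A.simProb V x (pairNat k l))) = (2 * (q : ℝ) + 1) ^ 2 * ∑ k ∈ R, ∑ l ∈ R,
          cH * cΘ * A.simProb V x (pairNat k l) := by
        simp only [← Finset.mul_sum]; ring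
      rw [this]
      simp only [hsim, ← Finset.mul_sum]
      congr 1
      exact sum_sum_rotate R R _
    rw [e1, e2]
    refine Finset.sum_le_sum fun s _ => Finset.sum_le_sum fun Θ _ => Finset.sum_le_sum fun H _ => ?_
    have hnn : ∀ κ, 0 ≤ if good κ Θ s then w κ Θ H s else 0 := by
      intro κ
      split
      · exact sq_nonneg _
      · exact le_rfl
    have hsum : 0 ≤ ∑ k ∈ R, ∑ l ∈ R,
        if good (pairNat k l) Θ s then w (pairNat k l) Θ H s else 0 :=
      Finset.sum_nonneg fun k _ => Finset.sum_nonneg fun l _ => hnn _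
    refine ite_le_of_imp (fun hv => ?_) (mul_nonneg (sq_nonneg _) hsum)
    have hg : ∀ k l, (if good (pairNat k l) Θ s then w (pairNat k l) Θ H s else 0) =
        w (pairNat k l) Θ H s := fun k l => if_pos (accepts_of_validOrProof hv.1 hv.2 _)
    simp only [hg]
    exact A.norm_finalState_le H Θ hv.1
  exact le_of_mul_le_mul_left (le_of_mul_le_mul_left hmain pΘ) pH

end Average

/-! ### Evaluation of circuits -/

section Layers

variable {S : Sizes}

/-- If no target serves as a control, all gates read the original bits, so their effects simply add
up over F₂ and their order is irrelevant. -/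
theorem runGates_apply_of_layer {L : List (XGate S)} (hL : ∀ g ∈ L, ∀ g' ∈ L, g.tgt ∉ g'.ctrl)
    (v : Key S → Bool) (k : Key S) : boolZ (runGates L v k) = boolZ (v k) +
      (L.map fun g => if g.tgt = k then boolZ (g.ctrl.all v) else 0).sum := by
  induction L generalizing v with
  | nil => simp
  | cons g L ih =>
    have hctrl : ∀ g' ∈ L, g'.ctrl.all (g.act v) = g'.ctrl.all v := by
      intro g' hg'
      rw [Bool.eq_iff_iff, List.all_eq_true, List.all_eq_true]
      refine forall₂_congr fun k hk => ?_
      rw [XGate.act, Function.update_of_ne]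
      rintro rfl
      exact hL g List.mem_cons_self g' (List.mem_cons_of_mem _ hg') hk
    rw [runGates_cons, ih fun g hg g' hg' =>
      hL g (List.mem_cons_of_mem _ hg) g' (List.mem_cons_of_mem _ hg'), List.map_cons,
      List.sum_cons, ← add_assoc]
    congr 1
    · by_cases h : g.tgt = k
      · subst h; simp [XGate.act, boolZ_xor]
      · rw [XGate.act, Function.update_of_ne (Ne.symm h), if_neg h, add_zero]
    · congr 1
      exact List.map_congr_left fun g' hg' => by rw [hctrl g' hg']

theorem runGates_apply_of_ne {L : List (XGate S)} {k : Key S} (h : ∀ g ∈ L, g.tgt ≠ k)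
    (v : Key S → Bool) : runGates L v k = v k := by
  induction L generalizing v with
  | nil => rfl
  | cons g L ih =>
    rw [runGates_cons, ih fun g hg => h g (List.mem_cons_of_mem _ hg), XGate.act,
      Function.update_of_ne (h g List.mem_cons_self).symm]

/-- Changes on qubits that the circuit never touches do not influence the rest. This is what makes
uncomputation work after the result has been added. -/
theorem runGates_congr_off {L : List (XGate S)} {Y : Set (Key S)}
    (hL : ∀ g ∈ L, ∀ k ∈ g.tgt :: g.ctrl, k ∉ Y) {v w : Key S → Bool} (h : ∀ k ∉ Y, v k = w k) :
    ∀ k ∉ Y, runGates L v k = runGates L w k := by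
  induction L generalizing v w with
  | nil => exact h
  | cons g L ih =>
    refine ih (fun g hg => hL g (List.mem_cons_of_mem _ hg)) fun k hk => ?_
    have hctrl : g.ctrl.all v = g.ctrl.all w := by
      rw [Bool.eq_iff_iff, List.all_eq_true, List.all_eq_true]
      exact forall₂_congr fun k hk => by
        rw [h k (hL g List.mem_cons_self k (List.mem_cons_of_mem _ hk))]
    by_cases hg : k = g.tgt
    · subst hg; simp [XGate.act, hctrl, h _ hk]
    · simp [XGate.act, hg, h k hk]

theorem sum_map_range_flatMap {α : Type*} (n : ℕ) (f : ℕ → List α) (F : α → ZMod 2) :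
    (((List.range n).flatMap f).map F).sum = ∑ i ∈ Finset.range n, ((f i).map F).sum := by
  induction n with
  | zero => simp
  | succ n ih => simp [List.range_succ, Finset.sum_range_succ, ih]

theorem sum_map_range {α : Type*} (n : ℕ) (f : ℕ → α) (F : α → ZMod 2) :
    (((List.range n).map f).map F).sum = ∑ i ∈ Finset.range n, F (f i) := by
  induction n with
  | zero => simp
  | succ n ih => simp [List.range_succ, Finset.sum_range_succ, ← ih]

/-- The `i`-th work qubit of the array with number `τ < 16`. -/
def wk (τ i : ℕ) : Key S := .inl (16 * i + τ)

/-- Sixteen arrays are interleaved by residues modulo 16. Their roles: 0 the powers, 14 the copied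
query input, 12 the random coefficients, 6 the hash value, 8 + β the recorded points, 10 + β their
new values, 1 + β the bitwise comparisons, 3 + β their running conjunctions, 5 the flag for no
match, 7 the reprogrammed value. -/
theorem wk_inj {τ i j : ℕ} : (wk τ i : Key S) = wk τ j ↔ i = j := by
  simp only [wk, Sum.inl.injEq]
  omega

theorem wk_ne {τ υ : ℕ} (hτ : τ < 16) (hυ : υ < 16) (h : τ ≠ υ) (i j : ℕ) :
    (wk τ i : Key S) ≠ wk υ j := by
  simp only [wk, ne_eq, Sum.inl.injEq]
  omega

/-- All targets of the gates are in the array `τ`. -/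
def Targets (τ : ℕ) (L : List (XGate S)) : Prop := ∀ g ∈ L, ∃ i, g.tgt = wk τ i

theorem Targets.run_wk {τ : ℕ} {L : List (XGate S)} (h : Targets τ L) (hτ : τ < 16) {υ : ℕ}
    (hυ : υ < 16) (hne : τ ≠ υ) (v : Key S → Bool) (i : ℕ) :
    runGates L v (wk υ i) = v (wk υ i) :=
  runGates_apply_of_ne (fun g hg => by
    obtain ⟨j, hj⟩ := h g hg
    rw [hj]
    exact wk_ne hτ hυ hne j i) v

end Layers

/-! ### Building blocks of the hash circuit: copying, powers, inner products, comparison. -/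

section Blocks

variable {S : Sizes}

/-- The bits of `x` as an infinite array. -/
def rawBits (x : HashBit S → Bool) (n : ℕ) : Bool := decide (∃ u, hashPos u = n ∧ x u = true)

@[simp] theorem rawBits_hashPos (x : HashBit S → Bool) (u : HashBit S) :
    rawBits x (hashPos u) = x u := by
  rw [rawBits, Bool.eq_iff_iff, decide_eq_true_eq]
  exact ⟨fun ⟨w, hw, h⟩ => hashPos_injective hw ▸ h, fun h => ⟨u, rfl, h⟩⟩

theorem rawBits_of_ne {x : HashBit S → Bool} {n : ℕ} (h : ∀ u : HashBit S, hashPos u ≠ n) :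
    rawBits x n = false := by
  simp [rawBits, h]

theorem boolZ_rawBits (x : HashBit S → Bool) (n : ℕ) :
    boolZ (rawBits x n) = (inputPoly x).coeff n := by
  by_cases h : ∃ u : HashBit S, hashPos u = n
  · obtain ⟨u, rfl⟩ := h
    rw [rawBits_hashPos, inputPoly_coeff]
  · push Not at h
    rw [rawBits_of_ne h]
    simp only [inputPoly, Polynomial.finsetSum_coeff, Polynomial.coeff_C_mul,
      Polynomial.coeff_X_pow]
    simp [fun u => (h u).symm]

theorem rawBits_eq_iff {x y : HashBit S → Bool} :
    (∀ n < hashLen S, rawBits x n = rawBits y n) ↔ x = y := by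
  refine ⟨fun h => funext fun u => ?_, fun h => by simp [h]⟩
  simpa using h _ (hashPos_lt u)

/-- All bits of a hash input. -/
def hashBits (S : Sizes) : List (HashBit S) :=
  .sel :: ((List.finRange (S.inst false)).map (.inst false) ++
    ((List.finRange (S.inst true)).map (.inst true) ++
      (List.finRange (max (S.com false) (S.com true))).map .com))

theorem mem_hashBits (u : HashBit S) : u ∈ hashBits S := by
  rcases u with _ | ⟨_ | _, i⟩ | i <;> simp [hashBits]

theorem runGates_copy {ι : Type*} {l : List ι} (hl : l.Nodup) {src tgt : ι → Key S}
    (htgt : Function.Injective tgt) (hne : ∀ i j, src i ≠ tgt j) (v : Key S → Bool) :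
    (∀ i ∈ l, runGates (l.map fun i => ⟨[src i], tgt i⟩) v (tgt i) = xor (v (tgt i)) (v (src i))) ∧
      ∀ k, (∀ i ∈ l, k ≠ tgt i) → runGates (l.map fun i => ⟨[src i], tgt i⟩) v k = v k := by
  refine ⟨?_, fun k hk => runGates_apply_of_ne (by simpa using fun i hi => (hk i hi).symm) v⟩
  induction l generalizing v with
  | nil => simp
  | cons j l ih =>
    intro i hi
    rw [List.map_cons, runGates_cons]
    rw [List.nodup_cons] at hl
    rcases List.mem_cons.1 hi with rfl | hi
    · rw [runGates_apply_of_ne (by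
        simp only [List.mem_map, forall_exists_index, and_imp, forall_apply_eq_imp_iff₂]
        exact fun j hj h => hl.1 (htgt h ▸ hj))]
      simp [XGate.act]
    · rw [ih hl.2 _ i hi]
      have : i ≠ j := fun h => hl.1 (h ▸ hi)
      simp [XGate.act, htgt.ne this, hne]

theorem hashBits_nodup : (hashBits S).Nodup := by
  have h1 : Function.Injective (HashBit.inst (S := S) false) := fun i j h => by injection h
  have h2 : Function.Injective (HashBit.inst (S := S) true) := fun i j h => by injection h
  have h3 : Function.Injective (HashBit.com (S := S)) := fun i j h => by injection h
  simp [hashBits, List.nodup_append, List.nodup_map_iff, h1, h2, h3, List.nodup_finRange]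
  rintro a b (⟨c, rfl⟩ | ⟨c, rfl⟩) <;> simp

/-- Copy the query input to the array `τ`. -/
def copyGates (S : Sizes) (τ : ℕ) : List (XGate S) :=
  (hashBits S).map fun u => ⟨[.inr (.queryInput u)], wk τ (hashPos u)⟩

theorem targets_copyGates (τ : ℕ) : Targets τ (copyGates S τ) := by
  simp only [Targets, copyGates, List.mem_map]
  rintro g ⟨u, _, rfl⟩
  exact ⟨_, rfl⟩

theorem runGates_copyGates (τ : ℕ) (v : Key S → Bool) (n : ℕ) :
    runGates (copyGates S τ) v (wk τ n) =
      xor (v (wk τ n)) (rawBits (fun u => v (.inr (.queryInput u))) n) := by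
  obtain ⟨h1, h2⟩ := runGates_copy (S := S) hashBits_nodup
    (src := fun u => .inr (.queryInput u)) (tgt := fun u => wk τ (hashPos u))
    (fun u w h => hashPos_injective (wk_inj.1 h)) (fun u w => by simp [wk]) v
  by_cases h : ∃ u : HashBit S, hashPos u = n
  · obtain ⟨u, rfl⟩ := h
    rw [rawBits_hashPos]
    exact h1 u (mem_hashBits u)
  · push Not at h
    rw [rawBits_of_ne h, Bool.xor_false]
    exact h2 _ fun u _ => by rw [ne_eq, wk_inj]; exact (h u).symm

/-- From the `i`-th power of the input polynomial to the next one. -/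
def powStage (S : Sizes) (q i : ℕ) : List (XGate S) :=
  (List.range ((2 * q + 1) * hashLen S)).flatMap fun a => (List.range (hashLen S)).map fun b =>
    ⟨[wk 0 (i * rowLen S q + a), wk 14 b], wk 0 ((i + 1) * rowLen S q + (a + b))⟩

def powGates (S : Sizes) (q n : ℕ) : List (XGate S) := (List.range n).flatMap (powStage S q)

theorem mem_powStage {q i : ℕ} {g : XGate S} (hg : g ∈ powStage S q i) :
    ∃ a < (2 * q + 1) * hashLen S, ∃ b < hashLen S,
      g = ⟨[wk 0 (i * rowLen S q + a), wk 14 b], wk 0 ((i + 1) * rowLen S q + (a + b))⟩ := by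
  simp only [powStage, List.mem_flatMap, List.mem_map, List.mem_range] at hg
  obtain ⟨a, ha, b, hb, rfl⟩ := hg
  exact ⟨a, ha, b, hb, rfl⟩

theorem targets_powStage (q i : ℕ) : Targets 0 (powStage S q i) := fun g hg => by
  obtain ⟨a, _, b, _, rfl⟩ := mem_powStage hg
  exact ⟨_, rfl⟩

theorem targets_powGates (q n : ℕ) : Targets 0 (powGates S q n) := fun g hg => by
  obtain ⟨i, _, hg⟩ := List.mem_flatMap.1 hg
  exact targets_powStage q i g hg

/-- The first summand exceeds the degree of every power used, and the second leaves room for the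
index sums a + b of a product, so that no row spills into the next. -/
theorem rowLen_eq (S : Sizes) (q : ℕ) :
    rowLen S q = (2 * q + 1) * hashLen S + hashLen S := by
  rw [rowLen]; ring

theorem coeff_inputPoly_pow_succ (x : HashBit S → Bool) {q i : ℕ} (hi : i ≤ 2 * q) (c : ℕ) :
    (inputPoly x ^ (i + 1)).coeff c = ∑ a ∈ Finset.range ((2 * q + 1) * hashLen S),
      ∑ b ∈ Finset.range (hashLen S),
        if a + b = c then (inputPoly x ^ i).coeff a * (inputPoly x).coeff b else 0 := by
  have h1 := Polynomial.as_sum_range' (inputPoly x ^ i) _ (natDegree_inputPoly_pow_lt x hi)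
  have h2 := Polynomial.as_sum_range' (inputPoly x) (hashLen S) (by
    have := natDegree_inputPoly_le x
    have := hashLen_pos S
    omega)
  rw [pow_succ]
  generalize inputPoly x ^ i = P at h1 ⊢
  conv_lhs => rw [h1, h2, Finset.sum_mul_sum]
  simp only [Polynomial.finsetSum_coeff, Polynomial.monomial_mul_monomial,
    Polynomial.coeff_monomial]

/-- Schoolbook multiplication: row n + 1, still zero, receives the product of row n with the input
polynomial in array 14. Row 0 starts as the constant polynomial 1. The second conjunct, that later
rows are empty, keeps the induction going. -/
theorem runGates_powGates {q : ℕ} (x : HashBit S → Bool) (v : Key S → Bool)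
    (hQ : ∀ b, v (wk 14 b) = rawBits x b) (hP : ∀ c, v (wk 0 c) = decide (c = 0)) :
    ∀ n ≤ 2 * q, (∀ i ≤ n, ∀ a < rowLen S q,
      boolZ (runGates (powGates S q n) v (wk 0 (i * rowLen S q + a))) =
        (inputPoly x ^ i).coeff a) ∧
      ∀ c, (n + 1) * rowLen S q ≤ c → runGates (powGates S q n) v (wk 0 c) = false := by
  have hZ := rowLen_pos S q
  intro n
  induction n with
  | zero =>
    intro _
    refine ⟨fun i hi a ha => ?_, fun c hc => ?_⟩
    · obtain rfl : i = 0 := by omega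
      rw [powGates, List.range_zero, List.flatMap_nil, runGates_nil, hP]
      by_cases h : a = 0 <;> simp [h, Polynomial.coeff_one]
    · rw [powGates, List.range_zero, List.flatMap_nil, runGates_nil, hP]
      simp only [decide_eq_false_iff_not]
      omega
  | succ n ih =>
    intro hn
    obtain ⟨h1, h2⟩ := ih (by omega)
    have hstep : runGates (powGates S q (n + 1)) v =
        runGates (powStage S q n) (runGates (powGates S q n) v) := by
      rw [powGates, List.range_succ, List.flatMap_append, runGates_append]
      simp [powGates]
    set w := runGates (powGates S q n) v with hw
    have hwQ : ∀ b, w (wk 14 b) = rawBits x b := fun b => by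
      rw [hw, (targets_powGates q n).run_wk (by omega) (by omega) (by omega), hQ]
    have hmul : (n + 1) * rowLen S q = n * rowLen S q + rowLen S q := by ring
    have hmul2 : (n + 1 + 1) * rowLen S q = (n + 1) * rowLen S q + rowLen S q := by ring
    have hZe := rowLen_eq S q
    rw [hstep]
    refine ⟨fun i hi a ha => ?_, fun c hc => ?_⟩
    · rcases (show i ≤ n ∨ i = n + 1 by omega) with hi' | rfl
      · rw [runGates_apply_of_ne, h1 i hi' a ha]
        intro g hg
        obtain ⟨a', _, b', _, rfl⟩ := mem_powStage hg
        rw [ne_eq, wk_inj]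
        have : i * rowLen S q ≤ n * rowLen S q := Nat.mul_le_mul_right _ hi'
        omega
      -- Controls lie in row n and in array 14, targets in row n + 1, so the stage is a layer and
      -- its XOR sum is the convolution of the coefficients.
      · rw [runGates_apply_of_layer, h2 _ (by omega), boolZ_false, zero_add,
          powStage, sum_map_range_flatMap, coeff_inputPoly_pow_succ x (show n ≤ 2 * q by omega)]
        · refine Finset.sum_congr rfl fun a' ha' => ?_
          rw [sum_map_range]
          refine Finset.sum_congr rfl fun b hb => ?_
          rw [Finset.mem_range] at ha'
          simp only [wk_inj, Nat.add_left_cancel_iff, List.all_cons, List.all_nil, Bool.and_true,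
            boolZ_and]
          rw [h1 n le_rfl a' (by omega), hwQ, boolZ_rawBits]
        · intro g hg g' hg'
          obtain ⟨a, _, b, _, rfl⟩ := mem_powStage hg
          obtain ⟨a', _, b', _, rfl⟩ := mem_powStage hg'
          simp only [List.mem_cons, List.not_mem_nil, or_false, not_or, wk_inj]
          exact ⟨by omega, wk_ne (by omega) (by omega) (by omega) _ _⟩
    · rw [runGates_apply_of_ne, h2 c (by omega)]
      intro g hg
      obtain ⟨a', _, b', _, rfl⟩ := mem_powStage hg
      rw [ne_eq, wk_inj]
      omega

/-- The inner products of the features with the rows of random bits. -/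
def dotGates (S : Sizes) (q : ℕ) : List (XGate S) :=
  (List.range S.chal).flatMap fun j => (List.range (featLen S q)).map fun u =>
    ⟨[wk 12 (j * featLen S q + u), wk 0 u], wk 6 j⟩

theorem mem_dotGates {q : ℕ} {g : XGate S} (hg : g ∈ dotGates S q) :
    ∃ j < S.chal, ∃ u < featLen S q, g = ⟨[wk 12 (j * featLen S q + u), wk 0 u], wk 6 j⟩ := by
  simp only [dotGates, List.mem_flatMap, List.mem_map, List.mem_range] at hg
  obtain ⟨j, hj, u, hu, rfl⟩ := hg
  exact ⟨j, hj, u, hu, rfl⟩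

theorem targets_dotGates (q : ℕ) : Targets 6 (dotGates S q) := fun g hg => by
  obtain ⟨a, _, b, _, rfl⟩ := mem_dotGates hg
  exact ⟨_, rfl⟩

theorem runGates_dotGates (q : ℕ) (v : Key S → Bool) {j : ℕ} (hj : j < S.chal) :
    boolZ (runGates (dotGates S q) v (wk 6 j)) = boolZ (v (wk 6 j)) +
      ∑ u ∈ Finset.range (featLen S q),
        boolZ (v (wk 12 (j * featLen S q + u))) * boolZ (v (wk 0 u)) := by
  rw [runGates_apply_of_layer, dotGates, sum_map_range_flatMap]
  · congr 1
    rw [Finset.sum_eq_single_of_mem j (Finset.mem_range.2 hj)]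
    · rw [sum_map_range]
      simp [boolZ_and]
    · intro i _ hi
      rw [sum_map_range]
      simp [wk_inj, hi]
  · intro g hg g' hg'
    obtain ⟨a, _, b, _, rfl⟩ := mem_dotGates hg
    obtain ⟨a', _, b', _, rfl⟩ := mem_dotGates hg'
    simp only [List.mem_cons, List.not_mem_nil, or_false, not_or]
    exact ⟨wk_ne (by omega) (by omega) (by omega) _ _, wk_ne (by omega) (by omega) (by omega) _ _⟩

/-- Compare the arrays `14` and `8 + β`, the result being the last bit of the array `3 + β`. -/
def eqGates (S : Sizes) (β n : ℕ) : List (XGate S) :=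
  ⟨[], wk (3 + β) 0⟩ :: (List.range n).flatMap fun u =>
    [⟨[wk 14 u], wk (1 + β) u⟩, ⟨[wk (8 + β) u], wk (1 + β) u⟩, ⟨[], wk (1 + β) u⟩,
      ⟨[wk (3 + β) u, wk (1 + β) u], wk (3 + β) (u + 1)⟩]

theorem targets_eqGates {β n : ℕ} {g : XGate S} (hg : g ∈ eqGates S β n) :
    ∃ i, g.tgt = wk (3 + β) i ∨ g.tgt = wk (1 + β) i := by
  simp only [eqGates, List.mem_cons, List.mem_flatMap, List.mem_range, List.not_mem_nil,
    or_false] at hg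
  rcases hg with rfl | ⟨u, _, rfl | rfl | rfl | rfl⟩
  · exact ⟨_, .inl rfl⟩
  · exact ⟨_, .inr rfl⟩
  · exact ⟨_, .inr rfl⟩
  · exact ⟨_, .inr rfl⟩
  · exact ⟨_, .inl rfl⟩

theorem runGates_eqGates_of_ne {β n : ℕ} (v : Key S → Bool) {k : Key S}
    (h : ∀ i, k ≠ wk (3 + β) i ∧ k ≠ wk (1 + β) i) : runGates (eqGates S β n) v k = v k :=
  runGates_apply_of_ne (fun g hg => by
    obtain ⟨i, hi | hi⟩ := targets_eqGates hg
    · rw [hi]; exact (h i).1.symm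
    · rw [hi]; exact (h i).2.symm) v

/-- Array 1 + β receives the negated XOR of the two bits at each position, and bit u of array 3 + β
the conjunction of the first u of them, starting from true. The result is therefore at index n, one
past the last position. -/
theorem runGates_eqGates {β : ℕ} (hβ : β ≤ 1) (v : Key S → Bool)
    (hX : ∀ u, v (wk (1 + β) u) = false) (hE : ∀ u, v (wk (3 + β) u) = false) (n : ℕ) :
    runGates (eqGates S β n) v (wk (3 + β) n) =
      decide (∀ u < n, v (wk 14 u) = v (wk (8 + β) u)) ∧
    (∀ u, n < u → runGates (eqGates S β n) v (wk (3 + β) u) = false) ∧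
    ∀ u, n ≤ u → runGates (eqGates S β n) v (wk (1 + β) u) = false := by
  have hne : ∀ i j, (wk (3 + β) i : Key S) ≠ wk (1 + β) j :=
    wk_ne (by omega) (by omega) (by omega)
  induction n with
  | zero =>
    have : ∀ k, runGates (eqGates S β 0) v k = Function.update v (wk (3 + β) 0) true k := by
      intro k
      simp [eqGates, runGates, XGate.act, hE]
    refine ⟨by simp [this], fun u hu => ?_, fun u _ => ?_⟩
    · rw [this, Function.update_of_ne (by rw [ne_eq, wk_inj]; omega), hE]
    · rw [this, Function.update_of_ne (hne _ _).symm, hX]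
  | succ n ih =>
    obtain ⟨h1, h2, h3⟩ := ih
    set w := runGates (eqGates S β n) v with hw
    have h14 : w (wk 14 n) = v (wk 14 n) := runGates_eqGates_of_ne v fun i =>
      ⟨wk_ne (by omega) (by omega) (by omega) _ _, wk_ne (by omega) (by omega) (by omega) _ _⟩
    have h8 : w (wk (8 + β) n) = v (wk (8 + β) n) := runGates_eqGates_of_ne v fun i =>
      ⟨wk_ne (by omega) (by omega) (by omega) _ _, wk_ne (by omega) (by omega) (by omega) _ _⟩
    have hstep : runGates (eqGates S β (n + 1)) v =
        Function.update (Function.update w (wk (1 + β) n)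
          (!(xor (v (wk 14 n)) (v (wk (8 + β) n))))) (wk (3 + β) (n + 1))
          (w (wk (3 + β) n) && !(xor (v (wk 14 n)) (v (wk (8 + β) n)))) := by
      have : eqGates S β (n + 1) = eqGates S β n ++ [⟨[wk 14 n], wk (1 + β) n⟩,
          ⟨[wk (8 + β) n], wk (1 + β) n⟩, ⟨[], wk (1 + β) n⟩,
          ⟨[wk (3 + β) n, wk (1 + β) n], wk (3 + β) (n + 1)⟩] := by
        simp [eqGates, List.range_succ]
      have a1 : (wk 14 n : Key S) ≠ wk (1 + β) n := wk_ne (by omega) (by omega) (by omega) _ _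
      have a2 : (wk (8 + β) n : Key S) ≠ wk (1 + β) n := wk_ne (by omega) (by omega) (by omega) _ _
      rw [this, runGates_append, ← hw]
      simp [runGates, XGate.act, hne, h2, h3, h14, h8, a2]
    rw [hstep]
    refine ⟨?_, fun u hu => ?_, fun u hu => ?_⟩
    · rw [Function.update_self, h1, Bool.eq_iff_iff]
      simp only [Bool.and_eq_true, decide_eq_true_eq, Bool.not_eq_true', Nat.lt_succ_iff_lt_or_eq,
        or_imp, forall_and, forall_eq]
      refine and_congr_right fun _ => ?_
      cases v (wk 14 n) <;> cases v (wk (8 + β) n) <;> simp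
    · rw [Function.update_of_ne (by rw [ne_eq, wk_inj]; omega), Function.update_of_ne (hne _ _),
        h2 u (by omega)]
    · rw [Function.update_of_ne (hne _ _).symm,
        Function.update_of_ne (by rw [ne_eq, wk_inj]; omega), h3 u (by omega)]

end Blocks

/-! ### The oracle circuit -/

section Oracle

variable {S : Sizes}

/-- Whether neither of the comparisons succeeded. -/
def flagGates (S : Sizes) : List (XGate S) :=
  [⟨[], wk 5 0⟩, ⟨[wk 3 (hashLen S)], wk 5 0⟩, ⟨[wk 4 (hashLen S)], wk 5 0⟩,
    ⟨[wk 3 (hashLen S), wk 4 (hashLen S)], wk 5 0⟩]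

theorem targets_flagGates : Targets 5 (flagGates S) := by
  simp only [Targets, flagGates, List.mem_cons, List.not_mem_nil, or_false]
  rintro g (rfl | rfl | rfl | rfl) <;> exact ⟨_, rfl⟩

/-- Over F₂, 1 + a + b + ab = (1 + a)(1 + b). -/
theorem runGates_flagGates (v : Key S → Bool) (h : v (wk 5 0) = false) :
    runGates (flagGates S) v (wk 5 0) =
      (!v (wk 3 (hashLen S)) && !v (wk 4 (hashLen S))) := by
  have h3 : ∀ i, (wk 3 i : Key S) ≠ wk 5 0 := fun i => wk_ne (by omega) (by omega) (by omega) _ _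
  have h4 : ∀ i, (wk 4 i : Key S) ≠ wk 5 0 := fun i => wk_ne (by omega) (by omega) (by omega) _ _
  simp only [flagGates, runGates, List.foldl_cons, List.foldl_nil, XGate.act]
  simp [h3, h4, h]
  cases v (wk 3 (hashLen S)) <;> cases v (wk 4 (hashLen S)) <;> rfl

/-- The value of the reprogrammed function. -/
def outGates (S : Sizes) : List (XGate S) :=
  (List.range S.chal).flatMap fun j => [⟨[wk 5 0, wk 6 j], wk 7 j⟩,
    ⟨[wk 3 (hashLen S), wk 10 j], wk 7 j⟩, ⟨[wk 4 (hashLen S), wk 11 j], wk 7 j⟩]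

theorem mem_outGates {g : XGate S} (hg : g ∈ outGates S) : ∃ j < S.chal,
    g = ⟨[wk 5 0, wk 6 j], wk 7 j⟩ ∨ g = ⟨[wk 3 (hashLen S), wk 10 j], wk 7 j⟩ ∨
      g = ⟨[wk 4 (hashLen S), wk 11 j], wk 7 j⟩ := by
  simpa [outGates] using hg

/-- The XOR of the old value masked by the flag and of the two new values masked by the comparisons.
This is the form in which `reprogram` is defined. -/
theorem runGates_outGates (v : Key S → Bool) {j : ℕ} (hj : j < S.chal)
    (h : v (wk 7 j) = false) : runGates (outGates S) v (wk 7 j) =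
      xor (xor (v (wk 5 0) && v (wk 6 j)) (v (wk 3 (hashLen S)) && v (wk 10 j)))
        (v (wk 4 (hashLen S)) && v (wk 11 j)) := by
  apply boolZ_injective
  rw [runGates_apply_of_layer, outGates, sum_map_range_flatMap,
    Finset.sum_eq_single_of_mem j (Finset.mem_range.2 hj)]
  · simp [h, boolZ_xor, boolZ_and]
  · intro i _ hi
    simp [wk_inj, hi]
  · intro g hg g' hg'
    have h7 : ∃ i, g.tgt = wk 7 i := by
      obtain ⟨i, _, rfl | rfl | rfl⟩ := mem_outGates hg <;> exact ⟨_, rfl⟩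
    obtain ⟨i, hi⟩ := h7
    obtain ⟨k, _, rfl | rfl | rfl⟩ := mem_outGates hg' <;>
    · simp only [hi, List.mem_cons, List.not_mem_nil, or_false, not_or]
      exact ⟨wk_ne (by omega) (by omega) (by omega) _ _,
        wk_ne (by omega) (by omega) (by omega) _ _⟩

/-- Add the result to the result register of the query if the control qubit is set. -/
def resultGates (S : Sizes) : List (XGate S) :=
  (List.finRange S.chal).map fun j : Fin S.chal => ⟨[.inr .queryControl, wk 7 j], .inr (.queryResult j)⟩

def bitNum (β : Bool) : ℕ := if β then 1 else 0

theorem bitNum_le (β : Bool) : bitNum β ≤ 1 := by cases β <;> simp [bitNum]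

/-- The computation of the hash value, with reprogramming at the points in the arrays `8 + β`
with `e β`. -/
def computeGates (S : Sizes) (q : ℕ) (e : Bool → Bool) : List (XGate S) :=
  copyGates S 14 ++ (⟨[], wk 0 0⟩ :: (powGates S q (2 * q) ++ (dotGates S q ++
    ((if e false then eqGates S (bitNum false) (hashLen S) else []) ++
      ((if e true then eqGates S (bitNum true) (hashLen S) else []) ++
        (flagGates S ++ outGates S))))))

/-- The classical information in the work qubits. -/
structure Memory (S : Sizes) (q : ℕ) where
  coef : Fin S.chal → Fin (featLen S q) → Bool
  point : Bool → HashBit S → Bool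
  val : Bool → Bits S.chal

theorem featLen_pos (S : Sizes) (q : ℕ) : 0 < featLen S q :=
  Nat.mul_pos (by omega) (rowLen_pos S q)

def rawVal {n : ℕ} (c : Bits n) (i : ℕ) : Bool := if h : i < n then c ⟨i, h⟩ else false

def rawCoef {q : ℕ} (r : Fin S.chal → Fin (featLen S q) → Bool) (i : ℕ) : Bool :=
  if h : i / featLen S q < S.chal then
    r ⟨_, h⟩ ⟨i % featLen S q, Nat.mod_lt _ (featLen_pos S q)⟩ else false

/-- The contents of the array `τ`. -/
def Memory.array {q : ℕ} (p : Memory S q) (τ : ℕ) : ℕ → Bool :=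
  if τ = 8 then rawBits (p.point false)
  else if τ = 9 then rawBits (p.point true)
  else if τ = 10 then rawVal (p.val false)
  else if τ = 11 then rawVal (p.val true)
  else if τ = 12 then rawCoef p.coef
  else fun _ => false

/-- The work qubits. -/
def Memory.bits {q : ℕ} (p : Memory S q) (n : ℕ) : Bool := p.array (n % 16) (n / 16)

/-- The bits of the joint system. -/
def Memory.state {q : ℕ} (p : Memory S q) (s : AdvQubit S → Bool) : Key S → Bool :=
  Sum.elim p.bits s

theorem Memory.state_wk {q : ℕ} (p : Memory S q) (s : AdvQubit S → Bool) {τ : ℕ} (hτ : τ < 16)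
    (i : ℕ) : p.state s (wk τ i) = p.array τ i := by
  simp only [Memory.state, wk, Sum.elim_inl, Memory.bits]
  rw [show (16 * i + τ) % 16 = τ by omega, show (16 * i + τ) / 16 = i by omega]

@[simp] theorem Memory.state_inr {q : ℕ} (p : Memory S q) (s : AdvQubit S → Bool)
    (k : AdvQubit S) : p.state s (.inr k) = s k := rfl

theorem rawCoef_add {q : ℕ} (r : Fin S.chal → Fin (featLen S q) → Bool) (j : Fin S.chal)
    (u : Fin (featLen S q)) : rawCoef r (j * featLen S q + u) = r j u := by
  have h := featLen_pos S q
  have h1 : ((j : ℕ) * featLen S q + u) / featLen S q = j := by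
    rw [Nat.add_comm, Nat.add_mul_div_right _ _ h, Nat.div_eq_of_lt u.2, Nat.zero_add]
  have h2 : ((j : ℕ) * featLen S q + u) % featLen S q = u := by
    rw [Nat.add_comm, Nat.add_mul_mod_self_right, Nat.mod_eq_of_lt u.2]
  simp only [rawCoef, h1, h2, j.2, dif_pos]

/-- The stages are followed one at a time: each writes only to its own arrays, so what later stages
read is unchanged. In the proof `v1`, `v2`, … are the bits after the successive stages, and `k1`,
`k2`, … say which arrays a stage leaves alone. -/
theorem runGates_computeGates {q : ℕ} (e : Bool → Bool) (p : Memory S q)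
    (s : AdvQubit S → Bool) (j : Fin S.chal) :
    runGates (computeGates S q e) (p.state s) (wk 7 j) =
      reprogram (linHash p.coef) e p.point p.val (fun u => s (.queryInput u)) j := by
  set x : HashBit S → Bool := fun u => s (.queryInput u) with hx
  have hzero : ∀ τ < 16, τ < 8 ∨ 12 < τ → ∀ i, p.state s (wk τ i) = false := by
    intro τ hτ h i
    rw [p.state_wk s hτ, Memory.array, if_neg (by omega), if_neg (by omega), if_neg (by omega),
      if_neg (by omega), if_neg (by omega)]
  set v := p.state s with hv
  simp only [computeGates, runGates_append, runGates_cons]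
  set v1 := runGates (copyGates S 14) v with hv1
  have k1 : ∀ τ < 16, 14 ≠ τ → ∀ i, v1 (wk τ i) = v (wk τ i) := fun τ hτ h i =>
    (targets_copyGates 14).run_wk (by omega) hτ h v i
  have q1 : ∀ b, v1 (wk 14 b) = rawBits x b := fun b => by
    rw [hv1, runGates_copyGates, hzero 14 (by omega) (by omega)]
    simp [hv, hx]
  set v2 := XGate.act ⟨[], wk 0 0⟩ v1 with hv2
  have k2 : ∀ τ < 16, 0 ≠ τ → ∀ i, v2 (wk τ i) = v1 (wk τ i) := fun τ hτ h i => by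
    rw [hv2, XGate.act, Function.update_of_ne (wk_ne hτ (by omega) h.symm _ _)]
  have p2 : ∀ c, v2 (wk 0 c) = decide (c = 0) := fun c => by
    by_cases hc : c = 0
    · subst hc
      simp [hv2, XGate.act, k1 0, hzero 0]
    · rw [hv2, XGate.act, Function.update_of_ne (by rw [ne_eq, wk_inj]; exact hc), k1 0 (by omega)
        (by omega), hzero 0 (by omega) (by omega)]
      simp [hc]
  have p3 := (runGates_powGates x v2 (fun b => by rw [k2 14 (by omega) (by omega), q1]) p2
    (2 * q) le_rfl).1
  set v3 := runGates (powGates S q (2 * q)) v2 with hv3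
  have k3 : ∀ τ < 16, 0 ≠ τ → ∀ i, v3 (wk τ i) = v2 (wk τ i) := fun τ hτ h i =>
    (targets_powGates q (2 * q)).run_wk (by omega) hτ h v2 i
  have f3 : ∀ u < featLen S q, boolZ (v3 (wk 0 u)) = feature q x u := by
    intro u hu
    have hZ := rowLen_pos S q
    have h1 := p3 (u / rowLen S q) (by
      have := (Nat.div_lt_iff_lt_mul hZ).2 hu
      omega) (u % rowLen S q) (Nat.mod_lt _ hZ)
    rwa [Nat.div_add_mod'] at h1
  have t4 := runGates_dotGates q v3 j.2
  set v4 := runGates (dotGates S q) v3 with hv4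
  have k4 : ∀ τ < 16, 6 ≠ τ → ∀ i, v4 (wk τ i) = v3 (wk τ i) := fun τ hτ h i =>
    (targets_dotGates q).run_wk (by omega) hτ h v3 i
  have h4 : v4 (wk 6 j) = linHash p.coef x j := by
    apply boolZ_injective
    rw [t4, k3 6 (by omega) (by omega), k2 6 (by omega) (by omega), k1 6 (by omega) (by omega),
      hzero 6 (by omega) (by omega), boolZ_false, zero_add, linHash, boolZ_zBool,
      Finset.sum_range]
    refine Finset.sum_congr rfl fun u _ => ?_
    rw [f3 u u.2, k3 12 (by omega) (by omega), k2 12 (by omega) (by omega),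
      k1 12 (by omega) (by omega), hv, p.state_wk s (by omega)]
    simp [Memory.array, rawCoef_add]
  have g4 : ∀ τ < 16, 14 ≠ τ → 0 ≠ τ → 6 ≠ τ → ∀ i, v4 (wk τ i) = v (wk τ i) :=
    fun τ hτ h h' h'' i => by rw [k4 τ hτ h'', k3 τ hτ h', k2 τ hτ h', k1 τ hτ h]
  have q4 : ∀ b, v4 (wk 14 b) = rawBits x b := fun b => by
    rw [k4 14 (by omega) (by omega), k3 14 (by omega) (by omega), k2 14 (by omega) (by omega), q1]
  have eqRun : ∀ (β : Bool) (w : Key S → Bool), (∀ b, w (wk 14 b) = rawBits x b) →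
      (∀ i, w (wk (8 + bitNum β) i) = rawBits (p.point β) i) →
      (∀ i, w (wk (1 + bitNum β) i) = false) → (∀ i, w (wk (3 + bitNum β) i) = false) →
      runGates (if e β then eqGates S (bitNum β) (hashLen S) else []) w
        (wk (3 + bitNum β) (hashLen S)) = (e β && decide (x = p.point β)) := by
    intro β w w1 w2 w3 w4
    by_cases he : e β = true
    · rw [if_pos he, (runGates_eqGates (bitNum_le β) w w3 w4 _).1, he, Bool.true_and]
      simp only [w1, w2]
      exact decide_eq_decide.2 rawBits_eq_iff
    · simp [he, w4]
  have eqKeep : ∀ (β : Bool) (w : Key S → Bool) τ, τ < 16 → τ ≠ 3 + bitNum β →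
      τ ≠ 1 + bitNum β → ∀ i, runGates (if e β then eqGates S (bitNum β) (hashLen S) else []) w
        (wk τ i) = w (wk τ i) := by
    intro β w τ hτ h1 h2 i
    have := bitNum_le β
    split
    · exact runGates_eqGates_of_ne w fun i' =>
        ⟨wk_ne hτ (by omega) h1 _ _, wk_ne hτ (by omega) h2 _ _⟩
    · rfl
  have b0 : bitNum false = 0 := rfl
  have b1 : bitNum true = 1 := rfl
  have e5 := eqRun false v4 q4
    (fun i => by rw [b0, g4 8 (by omega) (by omega) (by omega) (by omega), hv,
      p.state_wk s (by omega)]; simp [Memory.array])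
    (fun i => by rw [b0, g4 1 (by omega) (by omega) (by omega) (by omega),
      hzero 1 (by omega) (by omega)])
    (fun i => by rw [b0, g4 3 (by omega) (by omega) (by omega) (by omega),
      hzero 3 (by omega) (by omega)])
  have k5 := eqKeep false v4
  set v5 := runGates (if e false then eqGates S (bitNum false) (hashLen S) else []) v4 with hv5
  have e6 := eqRun true v5
    (fun b => by rw [k5 14 (by omega) (by omega) (by omega), q4])
    (fun i => by rw [b1, k5 9 (by omega) (by omega) (by omega),
      g4 9 (by omega) (by omega) (by omega) (by omega), hv,
      p.state_wk s (by omega)]; simp [Memory.array])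
    (fun i => by rw [b1, k5 2 (by omega) (by omega) (by omega),
      g4 2 (by omega) (by omega) (by omega) (by omega), hzero 2 (by omega) (by omega)])
    (fun i => by rw [b1, k5 4 (by omega) (by omega) (by omega),
      g4 4 (by omega) (by omega) (by omega) (by omega), hzero 4 (by omega) (by omega)])
  have k6 := eqKeep true v5
  set v6 := runGates (if e true then eqGates S (bitNum true) (hashLen S) else []) v5 with hv6
  have g6 : ∀ τ, 4 < τ → τ < 16 → 14 ≠ τ → 6 ≠ τ → ∀ i, v6 (wk τ i) = v (wk τ i) :=
    fun τ h1 h2 h3 h4 i => by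
      rw [k6 τ h2 (by omega) (by omega), k5 τ h2 (by omega) (by omega),
        g4 τ h2 h3 (by omega) h4]
  have n7 := runGates_flagGates v6 (by
    rw [g6 5 (by omega) (by omega) (by omega) (by omega), hzero 5 (by omega) (by omega)])
  set v7 := runGates (flagGates S) v6 with hv7
  have k7 : ∀ τ < 16, 5 ≠ τ → ∀ i, v7 (wk τ i) = v6 (wk τ i) := fun τ hτ h i =>
    targets_flagGates.run_wk (by omega) hτ h v6 i
  have e5' : v6 (wk 3 (hashLen S)) = (e false && decide (x = p.point false)) := by
    rw [k6 3 (by omega) (by omega) (by omega)]; exact e5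
  have e6' : v6 (wk 4 (hashLen S)) = (e true && decide (x = p.point true)) := e6
  rw [runGates_outGates v7 j.2 (by
    rw [k7 7 (by omega) (by omega), g6 7 (by omega) (by omega) (by omega) (by omega),
      hzero 7 (by omega) (by omega)]), n7, k7 6 (by omega) (by omega), k7 3 (by omega) (by omega),
    k7 4 (by omega) (by omega), k7 10 (by omega) (by omega), k7 11 (by omega) (by omega),
    k6 6 (by omega) (by omega) (by omega), k5 6 (by omega) (by omega) (by omega), h4, e5', e6',
    g6 10 (by omega) (by omega) (by omega) (by omega),
    g6 11 (by omega) (by omega) (by omega) (by omega), hv, p.state_wk s (by omega),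
    p.state_wk s (by omega)]
  simp [Memory.array, rawVal, reprogram]

/-- The gate acts on work qubits with numbers in `[0, M]` of the arrays and on adversary qubits
other than the result register. -/
def XGate.Inside (M : ℕ) (g : XGate S) : Prop :=
  g.tgt ∉ g.ctrl ∧ g.ctrl.Nodup ∧ ∀ k ∈ g.tgt :: g.ctrl,
    (∃ τ < 16, ∃ i ≤ M, k = wk τ i) ∨ ∃ u, k = .inr (.queryInput u)

/-- An upper bound for the indices of the work qubits within their arrays. -/
def maxIndex (S : Sizes) (q : ℕ) : ℕ :=
  S.chal * featLen S q + featLen S q + hashLen S + S.chal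

theorem XGate.inside_nil {M τ i : ℕ} (hτ : τ < 16) (hi : i ≤ M) :
    (⟨[], wk τ i⟩ : XGate S).Inside M :=
  ⟨by simp, by simp, by simpa using Or.inl ⟨τ, hτ, i, hi, rfl⟩⟩

theorem XGate.inside_one {M τ i υ j : ℕ} (hτ : τ < 16) (hi : i ≤ M) (hυ : υ < 16) (hj : j ≤ M)
    (hne : τ ≠ υ) : (⟨[wk υ j], wk τ i⟩ : XGate S).Inside M := by
  refine ⟨by simpa using wk_ne hτ hυ hne i j, by simp, ?_⟩
  simp only [List.mem_cons, List.not_mem_nil, or_false, forall_eq_or_imp, forall_eq]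
  exact ⟨.inl ⟨τ, hτ, i, hi, rfl⟩, .inl ⟨υ, hυ, j, hj, rfl⟩⟩

theorem XGate.inside_two {M : ℕ} {a b c : ℕ × ℕ} (ha : a.1 < 16) (ha' : a.2 ≤ M)
    (hb : b.1 < 16) (hb' : b.2 ≤ M) (hc : c.1 < 16) (hc' : c.2 ≤ M) (hab : a ≠ b)
    (hac : c ≠ a) (hbc : c ≠ b) :
    (⟨[wk a.1 a.2, wk b.1 b.2], wk c.1 c.2⟩ : XGate S).Inside M := by
  have key : ∀ x y : ℕ × ℕ, x.1 < 16 → y.1 < 16 → x ≠ y → (wk x.1 x.2 : Key S) ≠ wk y.1 y.2 := by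
    rintro ⟨x, x'⟩ ⟨y, y'⟩ hx hy h h'
    simp only [wk, Sum.inl.injEq] at h' hx hy
    exact h (Prod.ext (by simp only; omega) (by simp only; omega))
  refine ⟨?_, ?_, ?_⟩
  · simp only [List.mem_cons, List.not_mem_nil, or_false, not_or]
    exact ⟨key _ _ hc ha hac, key _ _ hc hb hbc⟩
  · simpa using key _ _ ha hb hab
  · simp only [List.mem_cons, List.not_mem_nil, or_false, forall_eq_or_imp, forall_eq]
    exact ⟨.inl ⟨_, hc, _, hc', rfl⟩, .inl ⟨_, ha, _, ha', rfl⟩, .inl ⟨_, hb, _, hb', rfl⟩⟩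

theorem inside_copyGates {q τ : ℕ} (hτ : τ < 16) :
    ∀ g ∈ copyGates S τ, g.Inside (maxIndex S q) := by
  simp only [copyGates, List.mem_map]
  rintro g ⟨u, _, rfl⟩
  refine ⟨by simp [wk], by simp, ?_⟩
  simp only [List.mem_cons, List.not_mem_nil, or_false, forall_eq_or_imp, forall_eq]
  exact ⟨.inl ⟨τ, hτ, _, by have := hashPos_lt u; simp only [maxIndex]; omega, rfl⟩, .inr ⟨u, rfl⟩⟩

/-- This bounds the number of work qubits and shows that the computation never touches the result
register or the control qubit of the query. -/
theorem inside_computeGates (q : ℕ) (e : Bool → Bool) :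
    ∀ g ∈ computeGates S q e, g.Inside (maxIndex S q) := by
  have hZe := rowLen_eq S q
  have hD : featLen S q = (2 * q + 1) * rowLen S q := rfl
  have hM : maxIndex S q = S.chal * featLen S q + featLen S q + hashLen S + S.chal := rfl
  have heq : ∀ β : Bool, ∀ g ∈ (if e β then eqGates S (bitNum β) (hashLen S) else []),
      g.Inside (maxIndex S q) := by
    intro β g hg
    have := bitNum_le β
    split at hg
    · simp only [eqGates, List.mem_cons, List.mem_flatMap, List.mem_range, List.not_mem_nil,
        or_false] at hg
      rcases hg with rfl | ⟨u, hu, rfl | rfl | rfl | rfl⟩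
      · exact XGate.inside_nil (by omega) (by omega)
      · exact XGate.inside_one (by omega) (by omega) (by omega) (by omega) (by omega)
      · exact XGate.inside_one (by omega) (by omega) (by omega) (by omega) (by omega)
      · exact XGate.inside_nil (by omega) (by omega)
      · exact XGate.inside_two (a := (3 + bitNum β, u)) (b := (1 + bitNum β, u))
          (c := (3 + bitNum β, u + 1)) (by simp only; omega) (by simp only; omega)
          (by simp only; omega) (by simp only; omega) (by simp only; omega) (by simp only; omega)
          (by simp) (by simp) (by simp)
    · simp at hg
  intro g hg
  simp only [computeGates, List.mem_append, List.mem_cons] at hg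
  rcases hg with hg | rfl | hg | hg | hg | hg | hg | hg
  · exact inside_copyGates (by omega) g hg
  · exact XGate.inside_nil (by omega) (by omega)
  · obtain ⟨i, hi, hg⟩ := List.mem_flatMap.1 hg
    rw [List.mem_range] at hi
    obtain ⟨a, ha, b, hb, rfl⟩ := mem_powStage hg
    have h1 : (i + 1 + 1) * rowLen S q ≤ featLen S q := Nat.mul_le_mul_right _ (by omega)
    have h2 : (i + 1 + 1) * rowLen S q = (i + 1) * rowLen S q + rowLen S q := by ring
    have h3 : (i + 1) * rowLen S q = i * rowLen S q + rowLen S q := by ring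
    exact XGate.inside_two (a := (0, i * rowLen S q + a)) (b := (14, b))
      (c := (0, (i + 1) * rowLen S q + (a + b))) (by simp only; omega) (by simp only; omega)
      (by simp only; omega) (by simp only; omega) (by simp only; omega) (by simp only; omega)
      (by simp) (by simp only [ne_eq, Prod.mk.injEq, true_and]; omega) (by simp)
  · obtain ⟨j, hj, u, hu, rfl⟩ := mem_dotGates hg
    have h1 : (j + 1) * featLen S q ≤ S.chal * featLen S q := Nat.mul_le_mul_right _ hj
    have h2 : (j + 1) * featLen S q = j * featLen S q + featLen S q := by ring
    exact XGate.inside_two (a := (12, j * featLen S q + u)) (b := (0, u)) (c := (6, j))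
      (by simp only; omega) (by simp only; omega)
      (by simp only; omega) (by simp only; omega) (by simp only; omega) (by simp only; omega)
      (by simp) (by simp) (by simp)
  · exact heq false g hg
  · exact heq true g hg
  · simp only [flagGates, List.mem_cons, List.not_mem_nil, or_false] at hg
    rcases hg with rfl | rfl | rfl | rfl
    · exact XGate.inside_nil (by omega) (by omega)
    · exact XGate.inside_one (by omega) (by omega) (by omega) (by omega) (by omega)
    · exact XGate.inside_one (by omega) (by omega) (by omega) (by omega) (by omega)
    · exact XGate.inside_two (a := (3, hashLen S)) (b := (4, hashLen S)) (c := (5, 0))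
        (by simp only; omega) (by simp only; omega)
        (by simp only; omega) (by simp only; omega) (by simp only; omega) (by simp only; omega)
        (by simp) (by simp) (by simp)
  · obtain ⟨j, hj, rfl | rfl | rfl⟩ := mem_outGates hg
    · exact XGate.inside_two (a := (5, 0)) (b := (6, j)) (c := (7, j))
        (by simp only; omega) (by simp only; omega)
        (by simp only; omega) (by simp only; omega) (by simp only; omega) (by simp only; omega)
        (by simp) (by simp) (by simp)
    · exact XGate.inside_two (a := (3, hashLen S)) (b := (10, j)) (c := (7, j))
        (by simp only; omega) (by simp only; omega)
        (by simp only; omega) (by simp only; omega) (by simp only; omega) (by simp only; omega)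
        (by simp) (by simp) (by simp)
    · exact XGate.inside_two (a := (4, hashLen S)) (b := (11, j)) (c := (7, j))
        (by simp only; omega) (by simp only; omega)
        (by simp only; omega) (by simp only; omega) (by simp only; omega) (by simp only; omega)
        (by simp) (by simp) (by simp)

theorem XGate.Inside.ok {M W : ℕ} {g : XGate S} (h : g.Inside M) (hW : 16 * M + 16 ≤ W) :
    g.Ok W := by
  refine ⟨h.1, h.2.1, fun k hk n hn => ?_⟩
  rcases h.2.2 k hk with ⟨τ, hτ, i, hi, rfl⟩ | ⟨u, rfl⟩
  · simp only [wk, Sum.inl.injEq] at hn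
    omega
  · cases hn

theorem ok_resultGates {q W : ℕ} (hW : 16 * maxIndex S q + 16 ≤ W) :
    ∀ g ∈ resultGates S, g.Ok W := by
  simp only [resultGates, List.mem_map]
  rintro g ⟨j, _, rfl⟩
  refine ⟨by simp [wk], by simp [wk], ?_⟩
  simp only [List.mem_cons, List.not_mem_nil, or_false, forall_eq_or_imp, forall_eq, wk,
    Sum.inl.injEq]
  have := j.2
  refine ⟨by simp, by simp, fun n hn => ?_⟩
  simp only [maxIndex] at hW
  omega

/-- The oracle circuit acts as the oracle for the reprogrammed hash function. -/
theorem runGates_oracle {q : ℕ} {E : Type} (e : Bool → Bool) (p : Memory S q)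
    (s : AdvBasis S E) :
    runGates (computeGates S q e ++ (resultGates S).reverse ++ (computeGates S q e).reverse)
        (p.state s.1) =
      p.state (oracleMap (reprogram (linHash p.coef) e p.point p.val) s).1 := by
  set C := computeGates S q e with hC
  set v := p.state s.1 with hv
  -- `Y` is the result register, the only place where the net effect of the circuit is visible.
  let Y : Set (Key S) := {k | ∃ j, k = .inr (.queryResult j)}
  have hin := inside_computeGates (S := S) q e
  have hoff : ∀ g ∈ C.reverse, ∀ k ∈ g.tgt :: g.ctrl, k ∉ Y := by
    rintro g hg k hk ⟨j, rfl⟩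
    rcases (hin g (List.mem_reverse.1 hg)).2.2 _ hk with ⟨τ, _, i, _, h⟩ | ⟨u, h⟩
    · simp [wk] at h
    · simp at h
  have htgt : ∀ (L : List (XGate S)), (∀ g ∈ L, ∀ k ∈ g.tgt :: g.ctrl, k ∉ Y) → ∀ w,
      ∀ k ∈ Y, runGates L w k = w k := fun L hL w k hk =>
    runGates_apply_of_ne (fun g hg h => hL g hg _ List.mem_cons_self (h ▸ hk)) w
  have hoff' : ∀ g ∈ C, ∀ k ∈ g.tgt :: g.ctrl, k ∉ Y := fun g hg =>
    hoff g (List.mem_reverse.2 hg)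
  rw [runGates_append, runGates_append]
  set w := runGates C v with hw
  have hres : ∀ k ∉ Y, runGates (resultGates S).reverse w k = w k := fun k hk =>
    runGates_apply_of_ne (by
      simp only [resultGates, List.mem_reverse, List.mem_map]
      rintro g ⟨j, _, rfl⟩ rfl
      exact hk ⟨j, rfl⟩) w
  have hval : ∀ j, runGates (resultGates S).reverse w (.inr (.queryResult j)) =
      xor (w (.inr (.queryResult j))) (w (.inr .queryControl) && w (wk 7 j)) := by
    intro j
    apply boolZ_injective
    rw [runGates_apply_of_layer]
    · rw [boolZ_xor, List.map_reverse, List.sum_reverse, resultGates, List.map_map,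
        ← List.ofFn_eq_map, List.sum_ofFn]
      simp [boolZ_and]
    · simp only [resultGates, List.mem_reverse, List.mem_map]
      rintro g ⟨i, _, rfl⟩ g' ⟨i', _, rfl⟩
      simp [wk]
  have hback : runGates C.reverse w = v := runGates_reverse_cancel (fun g hg => (hin g hg).1) v
  have hinr : ∀ k, w (.inr k) = s.1 k := fun k => by
    rw [hw, runGates_apply_of_ne]
    · rfl
    · intro g hg h
      have key : ∃ τ i, g.tgt = wk τ i := by
        simp only [hC, computeGates, List.mem_append, List.mem_cons] at hg
        have heq : ∀ β : Bool, ∀ g ∈ (if e β then eqGates S (bitNum β) (hashLen S) else []),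
            ∃ τ i, g.tgt = wk τ i := by
          intro β g hg
          split at hg
          · obtain ⟨i, hi | hi⟩ := targets_eqGates hg <;> exact ⟨_, _, hi⟩
          · simp at hg
        rcases hg with hg | rfl | hg | hg | hg | hg | hg | hg
        · exact ⟨_, targets_copyGates 14 g hg⟩
        · exact ⟨_, _, rfl⟩
        · exact ⟨_, targets_powGates q _ g hg⟩
        · exact ⟨_, targets_dotGates q g hg⟩
        · exact heq false g hg
        · exact heq true g hg
        · exact ⟨_, targets_flagGates g hg⟩
        · obtain ⟨j, _, rfl | rfl | rfl⟩ := mem_outGates hg <;> exact ⟨_, _, rfl⟩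
      obtain ⟨τ, i, hg⟩ := key
      rw [hg] at h
      simp [wk] at h
  funext k
  by_cases hk : k ∈ Y
  · obtain ⟨j, rfl⟩ := hk
    rw [htgt _ hoff _ _ ⟨j, rfl⟩, hval, hinr, hinr, hw, hv, runGates_computeGates]
    rfl
  -- Off the result register the uncomputation sees the state left by the computation and hence
  -- restores the initial one.
  · rw [runGates_congr_off hoff hres k hk, hback, hv]
    rcases k with n | k
    · rfl
    · cases k with
      | queryResult j => exact absurd ⟨j, rfl⟩ hk
      | _ => rfl

end Oracle

/-! ### The circuits of the simulator -/

namespace Sim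

def c (n : ℕ) : Expr := .const n

/-- Variables 0–7 are the inputs q, n₀, n₁, k₀, k₁, m, l₀, l₁; 8 and 9 hold the guess κ, 10 the bit
b, 11 the number of the current step; from 12 on they are loop counters and scratch. -/
def v (n : ℕ) : Expr := .var n

/-- A work qubit of the array `τ`. -/
def work (τ : ℕ) (e : Expr) : Loc := ⟨.work, .add (.mul (c 16) e) (c τ)⟩

/-- With truncated subtraction, max(a, b) = a + (b − a). -/
def maxCom : Expr := .add (v 3) (.sub (v 4) (v 3))

def afterInst : Expr := .add (.add (c 1) (v 1)) (v 2)

def hashLenE : Expr := .add afterInst maxCom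

def powLenE : Expr := .mul (.add (.mul (c 2) (v 0)) (c 1)) hashLenE

def rowLenE : Expr := .mul (.add (.mul (c 2) (v 0)) (c 2)) hashLenE

def featLenE : Expr := .mul (.add (.mul (c 2) (v 0)) (c 1)) rowLenE

def copy (τ : ℕ) : Circ :=
  .seq (.cnot ⟨.querySel, c 0⟩ (work τ (c 0)))
    (.seq (.loop (v 1) (.cnot ⟨.queryInst false, v 12⟩ (work τ (.add (c 1) (v 12)))))
      (.seq (.loop (v 2) (.cnot ⟨.queryInst true, v 12⟩ (work τ (.add (.add (c 1) (v 1)) (v 12)))))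
        (.loop maxCom (.cnot ⟨.queryCom, v 12⟩ (work τ (.add afterInst (v 12)))))))

def pow : Circ :=
  .loop (.mul (c 2) (v 0)) (.loop powLenE (.loop hashLenE
    (.toffoli (work 0 (.add (.mul (v 12) rowLenE) (v 13))) (work 14 (v 14))
      (work 0 (.add (.mul (.add (v 12) (c 1)) rowLenE) (.add (v 13) (v 14)))))))

def dot : Circ :=
  .loop (v 5) (.loop featLenE
    (.toffoli (work 12 (.add (.mul (v 12) featLenE) (v 13))) (work 0 (v 13)) (work 6 (v 12))))

/-- Comparison with the point for the index `β`, if reprogramming is enabled at query `v 11`. -/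
def compare (β : ℕ) : Circ :=
  -- With truncated subtraction, 2i + 1 − κ is nonzero exactly if κ ≤ 2i.
  .guard (.sub (.add (.mul (c 2) (v 11)) (c 1)) (v (8 + β)))
    (.seq (.not (work (3 + β) (c 0))) (.loop hashLenE
      (.seq (.cnot (work 14 (v 12)) (work (1 + β) (v 12)))
        (.seq (.cnot (work (8 + β) (v 12)) (work (1 + β) (v 12)))
          (.seq (.not (work (1 + β) (v 12)))
            (.toffoli (work (3 + β) (v 12)) (work (1 + β) (v 12))
              (work (3 + β) (.add (v 12) (c 1)))))))))

def flag : Circ :=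
  .seq (.not (work 5 (c 0))) (.seq (.cnot (work 3 hashLenE) (work 5 (c 0)))
    (.seq (.cnot (work 4 hashLenE) (work 5 (c 0)))
      (.toffoli (work 3 hashLenE) (work 4 hashLenE) (work 5 (c 0)))))

def out : Circ :=
  .loop (v 5) (.seq (.toffoli (work 5 (c 0)) (work 6 (v 12)) (work 7 (v 12)))
    (.seq (.toffoli (work 3 hashLenE) (work 10 (v 12)) (work 7 (v 12)))
      (.toffoli (work 4 hashLenE) (work 11 (v 12)) (work 7 (v 12)))))

def compute : Circ :=
  .seq (copy 14) (.seq (.not (work 0 (c 0))) (.seq pow (.seq dot (.seq (compare 0)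
    (.seq (compare 1) (.seq flag out))))))

def result : Circ :=
  .loop (v 5) (.toffoli ⟨.queryControl, c 0⟩ (work 7 (v 12)) ⟨.queryResult, v 12⟩)

/-- Copy the final output that determines the hash input for the index `β`. -/
def copyOut (β : Bool) (idx : Expr) : Circ :=
  .seq (.loop (v 1) (.cnot ⟨.outInst false, v 12⟩ (work (8 + bitNum β) (.add (c 1) (v 12)))))
    (.seq (.loop (v 2) (.cnot ⟨.outInst true, v 12⟩
        (work (8 + bitNum β) (.add (.add (c 1) (v 1)) (v 12)))))
      (.seq (.loop (v (3 + bitNum β)) (.cnot ⟨.outCom β, v 12⟩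
          (work (8 + bitNum β) (.add afterInst (v 12)))))
        -- Nonzero exactly if β is true and q ≤ idx. The test is needed because this NOT acts on a
        -- work qubit and, unlike the copies above, is not disabled while the adversary is still at
        -- a query.
        (.guard (.sub (c (bitNum β)) (.sub (v 0) idx)) (.not (work (8 + bitNum β) (c 0))))))

/-- Record what is to be observed after `idx` steps. -/
def observe (β : Bool) (idx : Expr) : Circ :=
  -- The two truncated differences add up to |κ/2 − idx|, so the guard holds exactly if idx = κ/2.
  .guard (.sub (c 1) (.add (.sub (.div (v (8 + bitNum β)) (c 2)) idx)
      (.sub idx (.div (v (8 + bitNum β)) (c 2)))))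
    -- Only one of the two circuits has any gates: at a query the output registers are inaccessible,
    -- and after the last step the query registers are.
    (.seq (copy (8 + bitNum β)) (copyOut β idx))

def observeAll (idx : Expr) : Circ := .seq (observe false idx) (observe true idx)

end Sim

section Gates

variable {S : Sizes} {q : ℕ} {Γ : ℕ → ℕ}

/-- The input variables have their initial values. -/
def InputsOk (S : Sizes) (q : ℕ) (Γ : ℕ → ℕ) : Prop := ∀ v < 8, Γ v = inputVars S q v

theorem InputsOk.update (h : InputsOk S q Γ) {n : ℕ} (hn : 8 ≤ n) (i : ℕ) :
    InputsOk S q (Function.update Γ n i) := fun v hv => by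
  rw [Function.update_of_ne (by omega)]
  exact h v hv

theorem InputsOk.all (h : InputsOk S q Γ) : Γ 0 = q ∧ Γ 1 = S.inst false ∧ Γ 2 = S.inst true ∧
    Γ 3 = S.com false ∧ Γ 4 = S.com true ∧ Γ 5 = S.chal ∧ Γ 6 = S.resp false ∧
    Γ 7 = S.resp true :=
  ⟨h 0 (by omega), h 1 (by omega), h 2 (by omega), h 3 (by omega), h 4 (by omega),
    h 5 (by omega), h 6 (by omega), h 7 (by omega)⟩

theorem range_flatMap_eq {α : Type*} (n : ℕ) {f : ℕ → List α} {g : Fin n → α}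
    (h : ∀ i : Fin n, f i = [g i]) : (List.range n).flatMap f = (List.finRange n).map g := by
  rw [← List.map_coe_finRange_eq_range, List.flatMap_map]
  simp only [h]
  exact List.map_eq_flatMap.symm

open Sim

theorem work_key (fin : Bool) (τ : ℕ) (e : Expr) :
    (work τ e).key S fin Γ = some (wk τ (e.eval Γ)) := rfl

theorem eval_maxCom (h : InputsOk S q Γ) :
    maxCom.eval Γ = max (S.com false) (S.com true) := by
  obtain ⟨-, -, -, h3, h4, -⟩ := h.all
  simp only [maxCom, Expr.eval, Sim.v, h3, h4]
  omega

theorem eval_afterInst (h : InputsOk S q Γ) :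
    afterInst.eval Γ = 1 + S.inst false + S.inst true := by
  obtain ⟨-, h1, h2, -⟩ := h.all
  simp only [afterInst, Expr.eval, Sim.v, Sim.c, h1, h2]

theorem eval_hashLenE (h : InputsOk S q Γ) : hashLenE.eval Γ = hashLen S := by
  simp only [hashLenE, Expr.eval, eval_maxCom h, eval_afterInst h, hashLen]

theorem eval_powLenE (h : InputsOk S q Γ) : powLenE.eval Γ = (2 * q + 1) * hashLen S := by
  simp only [powLenE, Expr.eval, eval_hashLenE h, Sim.v, Sim.c, h.all.1]

theorem eval_rowLenE (h : InputsOk S q Γ) : rowLenE.eval Γ = rowLen S q := by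
  simp only [rowLenE, Expr.eval, eval_hashLenE h, Sim.v, Sim.c, h.all.1, rowLen]

theorem eval_featLenE (h : InputsOk S q Γ) : featLenE.eval Γ = featLen S q := by
  simp only [featLenE, Expr.eval, eval_rowLenE h, Sim.v, Sim.c, h.all.1, featLen]

theorem gates_copy (h : InputsOk S q Γ) (τ : ℕ) :
    (copy τ).gates S false 12 Γ = copyGates S τ := by
  obtain ⟨-, h1, h2, -⟩ := h.all
  simp only [copy, Circ.gates, copyGates, hashBits, List.map_cons, List.map_append, List.map_map]
  change _ ++ _ = [_] ++ _
  refine congrArg₂ _ rfl (congrArg₂ _ ?_ (congrArg₂ _ ?_ ?_))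
  · simp only [Expr.eval, Sim.v, h1]
    exact range_flatMap_eq _ fun i => by
      simp [Loc.key, keyAt, resolve, arrayIndex, Expr.eval, Sim.c, Sim.work, wk, hashPos]
  · simp only [Expr.eval, Sim.v, h2]
    exact range_flatMap_eq _ fun i => by
      simp [Loc.key, keyAt, resolve, arrayIndex, Expr.eval, Sim.c, Sim.work, wk, hashPos,
        h1]
  · rw [eval_maxCom h]
    exact range_flatMap_eq _ fun i => by
      have := eval_afterInst (h.update (n := 12) (by omega) i)
      have h' := i.2
      simp only [lt_sup_iff] at h'
      simp [Loc.key, keyAt, resolve, arrayIndex, Expr.eval, Sim.c, Sim.v, Sim.work, wk, hashPos,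
        this, h']

theorem gates_copy_finished (τ : ℕ) : (copy τ).gates S true 12 Γ = [] := by
  simp [copy, Circ.gates, Loc.key, keyAt, resolve]

theorem range_flatMap_singleton {α : Type*} (n : ℕ) (f : ℕ → α) :
    ((List.range n).flatMap fun i => [f i]) = (List.range n).map f := by
  induction n with
  | zero => rfl
  | succ n ih => simp [List.range_succ, ih]

theorem gates_pow (fin : Bool) (h : InputsOk S q Γ) :
    Sim.pow.gates S fin 12 Γ = powGates S q (2 * q) := by
  simp only [Sim.pow, Circ.gates, powGates]
  rw [show (Expr.mul (c 2) (Sim.v 0)).eval Γ = 2 * q by simp [Expr.eval, Sim.c, Sim.v, h.all.1]]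
  congr 1
  funext i
  rw [eval_powLenE (h.update (by omega) i), powStage]
  congr 1
  funext a
  rw [eval_hashLenE ((h.update (by omega) i).update (by omega) a), ← range_flatMap_singleton]
  congr 1
  funext b
  have := eval_rowLenE (((h.update (n := 12) (by omega) i).update (n := 13) (by omega) a).update
    (n := 14) (by omega) b)
  simp [work_key, Expr.eval, Sim.v, Sim.c, this]

theorem gates_dot (fin : Bool) (h : InputsOk S q Γ) :
    Sim.dot.gates S fin 12 Γ = dotGates S q := by
  simp only [Sim.dot, Circ.gates, dotGates]
  rw [show (Sim.v 5).eval Γ = S.chal from h.all.2.2.2.2.2.1]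
  congr 1
  funext j
  rw [eval_featLenE (h.update (by omega) j), ← range_flatMap_singleton]
  congr 1
  funext u
  have := eval_featLenE ((h.update (n := 12) (by omega) j).update (n := 13) (by omega) u)
  simp [work_key, Expr.eval, Sim.v, this]

theorem gates_compare (fin : Bool) (h : InputsOk S q Γ) {β : ℕ} {κ : ℕ}
    (hκ : Γ (8 + β) = κ) {e : Bool} (he : e = decide (κ ≤ 2 * Γ 11)) :
    (Sim.compare β).gates S fin 12 Γ = if e then eqGates S β (hashLen S) else [] := by
  simp only [Sim.compare, Circ.gates, eval_hashLenE h]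
  have h1 : (Expr.sub (.add (.mul (c 2) (Sim.v 11)) (c 1)) (Sim.v (8 + β))).eval Γ ≠ 0 ↔
      e = true := by
    simp only [Expr.eval, Sim.v, Sim.c, hκ, he, decide_eq_true_eq]
    omega
  simp only [h1]
  congr 1

theorem gates_flag (fin : Bool) (h : InputsOk S q Γ) :
    Sim.flag.gates S fin 12 Γ = flagGates S := by
  simp [Sim.flag, Circ.gates, flagGates, work_key, eval_hashLenE h, Expr.eval, Sim.c]

theorem gates_out (fin : Bool) (h : InputsOk S q Γ) :
    Sim.out.gates S fin 12 Γ = outGates S := by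
  simp only [Sim.out, Circ.gates, outGates]
  rw [show (Sim.v 5).eval Γ = S.chal from h.all.2.2.2.2.2.1]
  congr 1
  funext j
  have := eval_hashLenE (h.update (n := 12) (by omega) j)
  simp [work_key, Expr.eval, Sim.v, Sim.c, this]

/-- The variables `8` and `9` hold `κ`. -/
def KappaOk (κ : Bool → ℕ) (Γ : ℕ → ℕ) : Prop := ∀ β, Γ (8 + bitNum β) = κ β

theorem gates_compute (h : InputsOk S q Γ) {κ : Bool → ℕ} (hκ : KappaOk κ Γ) {i : ℕ}
    (hi : Γ 11 = i) :
    Sim.compute.gates S false 12 Γ = computeGates S q (enabled κ i) := by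
  have h0 := gates_compare (S := S) false h (β := bitNum false) (hκ false)
    (e := enabled κ i false) (by rw [hi]; rfl)
  have h1 := gates_compare (S := S) false h (β := bitNum true) (hκ true)
    (e := enabled κ i true) (by rw [hi]; rfl)
  simp only [Sim.compute, Circ.gates, computeGates, gates_copy h, gates_pow false h,
    gates_dot false h, gates_flag false h, gates_out false h, work_key]
  rw [← h0, ← h1]
  rfl

theorem gates_result (h : InputsOk S q Γ) :
    Sim.result.gates S false 12 Γ = resultGates S := by
  simp only [Sim.result, Circ.gates, resultGates]
  rw [show (Sim.v 5).eval Γ = S.chal from h.all.2.2.2.2.2.1]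
  exact range_flatMap_eq _ fun j => by
    simp [Loc.key, keyAt, resolve, arrayIndex, Sim.work, wk, Expr.eval, Sim.v, Sim.c]

end Gates

/-! ### Coherent recording of the two points. -/

section Observe

variable {S : Sizes} {q : ℕ} {Γ : ℕ → ℕ}

theorem com_le_max (S : Sizes) (β : Bool) : S.com β ≤ max (S.com false) (S.com true) := by
  cases β
  · exact le_max_left _ _
  · exact le_max_right _ _

/-- The bits of a hash input that are found in the output registers. -/
def outBits (S : Sizes) (β : Bool) : List (HashBit S) :=
  (List.finRange (S.inst false)).map (.inst false) ++
    ((List.finRange (S.inst true)).map (.inst true) ++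
      (List.finRange (S.com β)).map fun i => .com (i.castLE (com_le_max S β)))

/-- The value `queryControl` is a dummy on the positions outside `outBits`. -/
def outSource (β : Bool) : HashBit S → AdvQubit S
  | .sel => .queryControl
  | .inst b i => .outInst b i
  | .com i => if h : (i : ℕ) < S.com β then .outCom β ⟨i, h⟩ else .queryControl

theorem mem_outBits_com {β : Bool} {i : Fin (max (S.com false) (S.com true))} :
    HashBit.com i ∈ outBits S β ↔ (i : ℕ) < S.com β := by
  simp only [outBits, List.mem_append, List.mem_map, List.mem_finRange, true_and, reduceCtorEq,
    exists_false, false_or, HashBit.com.injEq]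
  exact ⟨fun ⟨j, hj⟩ => hj ▸ j.2, fun h => ⟨⟨i, h⟩, rfl⟩⟩

theorem mem_outBits_inst {β b : Bool} {i : Fin (S.inst b)} : HashBit.inst b i ∈ outBits S β := by
  cases b <;> simp [outBits]

theorem sel_notMem_outBits {β : Bool} : HashBit.sel ∉ outBits S β := by
  simp [outBits]

theorem outBits_nodup (β : Bool) : (outBits S β).Nodup := by
  have h1 : Function.Injective (HashBit.inst (S := S) false) := fun i j h => by injection h
  have h2 : Function.Injective (HashBit.inst (S := S) true) := fun i j h => by injection h
  have h3 : Function.Injective fun i : Fin (S.com β) =>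
      HashBit.com (S := S) (i.castLE (com_le_max S β)) := fun i j h => by
    simpa [Fin.ext_iff] using h
  simp only [outBits, List.nodup_append, List.nodup_map_iff, h1, h2, h3, List.nodup_finRange,
    List.mem_map, List.mem_append, true_and]
  constructor
  · rintro a ⟨i, _, rfl⟩ b ⟨j, _, rfl⟩
    simp
  · rintro a ⟨i, _, rfl⟩ b (⟨j, _, rfl⟩ | ⟨j, _, rfl⟩) <;> simp

def copyOutGates (S : Sizes) (β : Bool) : List (XGate S) :=
  ((outBits S β).map fun u => ⟨[.inr (outSource β u)], wk (8 + bitNum β) (hashPos u)⟩) ++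
    if β then [⟨[], wk (8 + bitNum β) 0⟩] else []

theorem hashPos_eq_zero {u : HashBit S} : hashPos u = 0 ↔ u = .sel := by
  rw [show (0 : ℕ) = hashPos (.sel : HashBit S) from rfl, hashPos_injective.eq_iff]

/-- The selector bit is not in the output; it is supplied by a NOT if β is true. Positions past the
end of a_β receive no gate, which is the zero padding of `hashInput`. -/
theorem runGates_copyOutGates (β : Bool) (v : Key S → Bool) (n : ℕ) :
    runGates (copyOutGates S β) v (wk (8 + bitNum β) n) =
      xor (v (wk (8 + bitNum β) n)) (rawBits (hashInput β (fun b i => v (.inr (.outInst b i)))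
        (fun i => v (.inr (.outCom β i)))) n) := by
  obtain ⟨h1, h2⟩ := runGates_copy (S := S) (outBits_nodup β)
    (src := fun u => .inr (outSource β u)) (tgt := fun u => wk (8 + bitNum β) (hashPos u))
    (fun u w h => hashPos_injective (wk_inj.1 h)) (fun u w => by simp [wk]) v
  rw [copyOutGates, runGates_append]
  set w := runGates ((outBits S β).map fun u =>
    (⟨[.inr (outSource β u)], wk (8 + bitNum β) (hashPos u)⟩ : XGate S)) v with hw
  have h3 : ∀ n ≠ 0, runGates (if β then [⟨[], wk (8 + bitNum β) 0⟩] else []) w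
      (wk (8 + bitNum β) n) = w (wk (8 + bitNum β) n) := by
    intro n hn
    refine runGates_apply_of_ne (fun g hg => ?_) w
    split at hg
    · simp only [List.mem_singleton] at hg
      rw [hg, ne_eq, wk_inj]
      exact hn.symm
    · simp at hg
  by_cases h : ∃ u : HashBit S, hashPos u = n
  · obtain ⟨u, rfl⟩ := h
    rw [rawBits_hashPos]
    rcases u with _ | ⟨b, i⟩ | i
    · have h4 := h2 (wk (8 + bitNum β) (hashPos (.sel : HashBit S))) fun u hu h =>
        sel_notMem_outBits (hashPos_injective (wk_inj.1 h) ▸ hu)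
      cases β
      · simp [h4, hashInput]
      · simp only [if_true, runGates, List.foldl_cons, List.foldl_nil, XGate.act, hashPos,
          List.all_nil, hashInput] at h4 ⊢
        simp [h4]
    · rw [h3 _ (by rw [ne_eq, hashPos_eq_zero]; simp), h1 _ mem_outBits_inst]
      rfl
    · rw [h3 _ (by rw [ne_eq, hashPos_eq_zero]; simp)]
      by_cases hi : (i : ℕ) < S.com β
      · rw [h1 _ (mem_outBits_com.2 hi)]
        simp [hashInput, outSource, hi]
      · rw [h2 _ fun u hu h => hi (mem_outBits_com.1 (by
          rwa [hashPos_injective (wk_inj.1 h)]))]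
        simp [hashInput, hi]
  · push Not at h
    rw [rawBits_of_ne h, Bool.xor_false]
    have hn : n ≠ 0 := fun h0 => h .sel h0.symm
    rw [h3 n hn]
    exact h2 _ fun u _ => by rw [ne_eq, wk_inj]; exact (h u).symm

open Sim

theorem gates_copyOut_finished (h : InputsOk S q Γ) (β : Bool) {idx : Expr}
    (hi : q ≤ idx.eval Γ) : (copyOut β idx).gates S true 12 Γ = copyOutGates S β := by
  obtain ⟨h0, h1, h2, h3, h4, -⟩ := h.all
  simp only [copyOut, Circ.gates, copyOutGates, outBits, List.map_append, List.map_map,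
    List.append_assoc]
  refine congrArg₂ _ ?_ (congrArg₂ _ ?_ (congrArg₂ _ ?_ ?_))
  · simp only [Expr.eval, Sim.v, h1]
    exact range_flatMap_eq _ fun i => by
      simp [Loc.key, keyAt, resolve, arrayIndex, Expr.eval, Sim.c, Sim.work, wk, hashPos, outSource]
  · simp only [Expr.eval, Sim.v, h2]
    exact range_flatMap_eq _ fun i => by
      simp [Loc.key, keyAt, resolve, arrayIndex, Expr.eval, Sim.c, Sim.work, wk, hashPos, outSource,
        h1]
  · have : (Sim.v (3 + bitNum β)).eval Γ = S.com β := by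
      cases β
      · exact h3
      · exact h4
    rw [this]
    exact range_flatMap_eq _ fun i => by
      have := eval_afterInst (h.update (n := 12) (by omega) i)
      simp [Loc.key, keyAt, resolve, arrayIndex, Expr.eval, Sim.c, Sim.v, Sim.work, wk, hashPos,
        this, outSource]
  · have : (Expr.sub (c (bitNum β)) (.sub (Sim.v 0) idx)).eval Γ = bitNum β := by
      simp only [Expr.eval, Sim.c, Sim.v, h0]
      omega
    rw [this]
    cases β
    · rfl
    · rfl

theorem gates_copyOut_of_lt (h : InputsOk S q Γ) (β : Bool) {idx : Expr}
    (hi : idx.eval Γ < q) : (copyOut β idx).gates S false 12 Γ = [] := by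
  have h0 := h.all.1
  have := bitNum_le β
  have : (Expr.sub (c (bitNum β)) (.sub (Sim.v 0) idx)).eval Γ = 0 := by
    simp only [Expr.eval, Sim.c, Sim.v, h0]
    omega
  simp [copyOut, Circ.gates, Loc.key, keyAt, resolve, this]

/-- Record the observation for the index `β` after `i` steps. -/
def observeGates (S : Sizes) (q i : ℕ) (β : Bool) : List (XGate S) :=
  if q ≤ i then copyOutGates S β else copyGates S (8 + bitNum β)

theorem runGates_observeGates (q i : ℕ) (β : Bool) (v : Key S → Bool) (n : ℕ) :
    runGates (observeGates S q i β) v (wk (8 + bitNum β) n) =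
      xor (v (wk (8 + bitNum β) n)) (rawBits (shown q i β fun k => v (.inr k)) n) := by
  rw [observeGates, shown]
  split
  · exact runGates_copyOutGates β v n
  · exact runGates_copyGates _ v n

theorem mem_observeGates {i : ℕ} {β : Bool} {g : XGate S} (hg : g ∈ observeGates S q i β) :
    (∃ u : HashBit S, g.tgt = wk (8 + bitNum β) (hashPos u)) ∧
      (g.ctrl = [] ∨ ∃ k, g.ctrl = [.inr k]) := by
  rw [observeGates] at hg
  split at hg
  · rw [copyOutGates, List.mem_append, List.mem_map] at hg
    rcases hg with ⟨u, _, rfl⟩ | hg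
    · exact ⟨⟨u, rfl⟩, .inr ⟨_, rfl⟩⟩
    · split at hg
      · rw [List.mem_singleton] at hg
        subst hg
        exact ⟨⟨.sel, rfl⟩, .inl rfl⟩
      · simp at hg
  · simp only [copyGates, List.mem_map] at hg
    obtain ⟨u, _, rfl⟩ := hg
    exact ⟨⟨u, rfl⟩, .inr ⟨_, rfl⟩⟩

theorem gates_observe (h : InputsOk S q Γ) {κ : Bool → ℕ} (hκ : KappaOk κ Γ) (β : Bool)
    {idx : Expr} {i : ℕ} (hi : idx.eval Γ = i) :
    (observe β idx).gates S (decide (q ≤ i)) 12 Γ =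
      if κ β / 2 = i then observeGates S q i β else [] := by
  have h1 : (Expr.sub (c 1) (.add (.sub (.div (Sim.v (8 + bitNum β)) (c 2)) idx)
      (.sub idx (.div (Sim.v (8 + bitNum β)) (c 2))))).eval Γ ≠ 0 ↔ κ β / 2 = i := by
    simp only [Expr.eval, Sim.c, Sim.v, hκ β, hi]
    omega
  simp only [observe, Circ.gates, h1]
  congr 1
  rw [observeGates]
  by_cases hq : q ≤ i
  · simp only [hq, decide_true, if_true]
    rw [gates_copy_finished, gates_copyOut_finished h β (by omega), List.nil_append]
  · simp only [hq, decide_false, if_false]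
    rw [gates_copy h, gates_copyOut_of_lt h β (by omega), List.append_nil]

/-- The gates that record the observations after `i` steps. -/
def observeAllGates (S : Sizes) (q i : ℕ) (κ : Bool → ℕ) : List (XGate S) :=
  (if κ false / 2 = i then observeGates S q i false else []) ++
    if κ true / 2 = i then observeGates S q i true else []

theorem gates_observeAll (h : InputsOk S q Γ) {κ : Bool → ℕ} (hκ : KappaOk κ Γ)
    {idx : Expr} {i : ℕ} (hi : idx.eval Γ = i) :
    (observeAll idx).gates S (decide (q ≤ i)) 12 Γ = observeAllGates S q i κ := by
  simp only [observeAll, Circ.gates, gates_observe h hκ _ hi, observeAllGates]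

theorem mem_observeAllGates {i : ℕ} {κ : Bool → ℕ} {g : XGate S}
    (hg : g ∈ observeAllGates S q i κ) :
    (∃ (β : Bool) (u : HashBit S), g.tgt = wk (8 + bitNum β) (hashPos u)) ∧
      (g.ctrl = [] ∨ ∃ k, g.ctrl = [.inr k]) := by
  rw [observeAllGates, List.mem_append] at hg
  rcases hg with hg | hg <;>
  · split at hg
    · obtain ⟨⟨u, hu⟩, h⟩ := mem_observeGates hg
      exact ⟨⟨_, u, hu⟩, h⟩
    · simp at hg

theorem ok_observeAllGates {i W : ℕ} {κ : Bool → ℕ} (hW : 16 * maxIndex S q + 16 ≤ W) :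
    ∀ g ∈ observeAllGates S q i κ, g.Ok W := by
  intro g hg
  obtain ⟨⟨β, u, hu⟩, h⟩ := mem_observeAllGates hg
  have h1 := hashPos_lt u
  have h2 := bitNum_le β
  have h3 : ∀ n, g.tgt = .inl n → n < W := by
    intro n hn
    rw [hu] at hn
    simp only [wk, Sum.inl.injEq] at hn
    simp only [maxIndex] at hW
    omega
  rcases h with h | ⟨k, h⟩
  · refine ⟨by simp [h], by simp [h], fun k hk n hn => ?_⟩
    simp only [h, List.mem_singleton] at hk
    exact h3 n (hk ▸ hn)
  · refine ⟨by simp [h, hu, wk], by simp [h], fun k hk n hn => ?_⟩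
    simp only [h, List.mem_cons, List.not_mem_nil, or_false] at hk
    rcases hk with rfl | rfl
    · exact h3 n hn
    · cases hn

theorem rawBits_xor (x y : HashBit S → Bool) (n : ℕ) :
    rawBits (fun u => xor (x u) (y u)) n = xor (rawBits x n) (rawBits y n) := by
  apply boolZ_injective
  rw [boolZ_xor, boolZ_rawBits, boolZ_rawBits, boolZ_rawBits]
  simp [inputPoly, boolZ_xor, add_mul, Finset.sum_add_distrib]

theorem runGates_reverse_of_layer {L : List (XGate S)}
    (hL : ∀ g ∈ L, ∀ g' ∈ L, g.tgt ∉ g'.ctrl) (v : Key S → Bool) :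
    runGates L.reverse v = runGates L v := by
  funext k
  apply boolZ_injective
  rw [runGates_apply_of_layer hL, runGates_apply_of_layer (by simpa using hL), List.map_reverse,
    List.sum_reverse]

/-- The memory after recording the observations after `i` steps. -/
def Memory.observe (p : Memory S q) (κ : Bool → ℕ) (i : ℕ) (s : AdvQubit S → Bool) :
    Memory S q :=
  { p with point := fun β => if κ β / 2 = i then fun u => xor (p.point β u) (shown q i β s u)
      else p.point β }

/-- Controls are adversary qubits and targets work qubits, so the gates form a layer: reversing them
changes nothing, and the whole effect is to XOR the shown inputs into arrays 8 and 9. -/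
theorem runGates_observeAllGates (κ : Bool → ℕ) (i : ℕ) (p : Memory S q)
    (s : AdvQubit S → Bool) :
    runGates (observeAllGates S q i κ).reverse (p.state s) = (p.observe κ i s).state s := by
  rw [runGates_reverse_of_layer]
  swap
  · intro g hg g' hg'
    obtain ⟨⟨β, u, hu⟩, -⟩ := mem_observeAllGates hg
    obtain ⟨-, h | ⟨k, h⟩⟩ := mem_observeAllGates hg' <;> simp [hu, h, wk]
  have hone : ∀ (β : Bool) (w : Key S → Bool),
      (∀ n, runGates (if κ β / 2 = i then observeGates S q i β else []) w
        (wk (8 + bitNum β) n) = xor (w (wk (8 + bitNum β) n))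
          (if κ β / 2 = i then rawBits (shown q i β fun k => w (.inr k)) n else false)) ∧
      ∀ k, (∀ n, k ≠ wk (8 + bitNum β) n) →
        runGates (if κ β / 2 = i then observeGates S q i β else []) w k = w k := by
    intro β w
    by_cases h : κ β / 2 = i
    · simp only [h, if_true]
      refine ⟨fun n => runGates_observeGates q i β w n, fun k hk => ?_⟩
      refine runGates_apply_of_ne (fun g hg => ?_) w
      obtain ⟨⟨u, hu⟩, -⟩ := mem_observeGates hg
      rw [hu]
      exact (hk _).symm
    · simp [h]
  rw [observeAllGates, runGates_append]
  obtain ⟨f1, f2⟩ := hone false (p.state s)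
  set w := runGates (if κ false / 2 = i then observeGates S q i false else []) (p.state s)
  obtain ⟨t1, t2⟩ := hone true w
  have b0 : 8 + bitNum false = 8 := rfl
  have b1 : 8 + bitNum true = 9 := rfl
  simp only [b0] at f1 f2
  simp only [b1] at t1 t2
  have hinr : ∀ k, w (.inr k) = s k := fun k => f2 (.inr k) fun n => by simp [wk]
  funext k
  by_cases h9 : ∃ n, k = wk 9 n
  · obtain ⟨n, rfl⟩ := h9
    rw [t1, f2 _ fun n' => wk_ne (by omega) (by omega) (by omega) _ _, Memory.state_wk _ _ (by omega),
      Memory.state_wk _ _ (by omega)]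
    simp only [hinr, Memory.array, Memory.observe]
    by_cases h : κ true / 2 = i
    · simp [h, rawBits_xor]
    · simp [h]
  · push Not at h9
    rw [t2 k h9]
    by_cases h8 : ∃ n, k = wk 8 n
    · obtain ⟨n, rfl⟩ := h8
      rw [f1, Memory.state_wk _ _ (by omega), Memory.state_wk _ _ (by omega)]
      simp only [Memory.state_inr, Memory.array, Memory.observe]
      by_cases h : κ false / 2 = i
      · simp [h, rawBits_xor]
      · simp [h]
    · push Not at h8
      rw [f2 k h8]
      rcases k with n | k
      · have h8' : n % 16 ≠ 8 := fun h => h8 (n / 16) (by simp only [wk]; congr 1; omega)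
        have h9' : n % 16 ≠ 9 := fun h => h9 (n / 16) (by simp only [wk]; congr 1; omega)
        simp only [Memory.state, Sum.elim_inl, Memory.bits, Memory.array, Memory.observe, h8', h9',
          if_false]
      · rfl

end Observe

/-! ### Sums over the branches of an execution -/

section Branches

variable {S : Sizes} {W q : ℕ} {E : Type} [Fintype E] [DecidableEq E]

/-- The sum of `f` over the branches that result from a program. -/
def branchSum (A : Adversary S q E) (msg : List Bool) (c : Cmd) (f : Branch S W E → ℝ)
    (s : Branch S W E) : ℝ :=
  ((exec A msg c s).map f).sum

theorem sum_map_flatMap {α β : Type*} (L : List α) (g : α → List β) (f : β → ℝ) :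
    ((L.flatMap g).map f).sum = (L.map fun a => ((g a).map f).sum).sum := by
  induction L with
  | nil => simp
  | cons a L ih => simp [ih]

theorem branchSum_seq (A : Adversary S q E) (msg : List Bool) (c d : Cmd)
    (f : Branch S W E → ℝ) (s : Branch S W E) :
    branchSum A msg (.seq c d) f s = branchSum A msg c (branchSum A msg d f) s := by
  simp only [branchSum, exec, sum_map_flatMap]
  rfl

theorem branchSum_of_eq {A : Adversary S q E} {msg : List Bool} {c : Cmd} {s t : Branch S W E}
    (h : exec A msg c s = [t]) (f : Branch S W E → ℝ) : branchSum A msg c f s = f t := by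
  simp [branchSum, h]

theorem weight_nonneg_of_mem_exec (A : Adversary S q E) (msg : List Bool) (c : Cmd) :
    ∀ s : Branch S W E, 0 ≤ s.weight → ∀ t ∈ exec A msg c s, 0 ≤ t.weight := by
  induction c with
  | skip | assign | gate | send | read =>
    intro s hs t ht
    simp only [exec, List.mem_singleton] at ht
    subst ht
    exact hs
  | seq c d ihc ihd =>
    intro s hs t ht
    simp only [exec, List.mem_flatMap] at ht
    obtain ⟨u, hu, ht⟩ := ht
    exact ihd u (ihc s hs u hu) t ht
  | ite e c d ihc ihd =>
    intro s hs t ht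
    simp only [exec] at ht
    split at ht
    · exact ihc (s.tick _) hs t ht
    · exact ihd (s.tick _) hs t ht
  | loop v e c ih =>
    intro s hs
    simp only [exec]
    induction e.eval s.vars with
    | zero =>
      intro t ht
      simp only [List.range_zero, List.foldl_nil, List.mem_singleton] at ht
      subst ht
      exact hs
    | succ n ihn =>
      intro t ht
      rw [List.range_succ, List.foldl_append, List.foldl_cons, List.foldl_nil,
        List.mem_flatMap] at ht
      obtain ⟨u, hu, ht⟩ := ht
      exact ih ((u.setVar v n).tick 1) (ihn u hu) t ht
  | rand v e =>
    intro s hs t ht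
    simp only [exec] at ht
    split at ht
    · simp only [List.mem_singleton] at ht
      subst ht
      exact hs
    · simp only [List.mem_map] at ht
      obtain ⟨i, _, rfl⟩ := ht
      exact div_nonneg hs (Nat.cast_nonneg _)
  | measure v l =>
    intro s hs t ht
    simp only [exec] at ht
    split at ht
    · simp only [List.mem_map] at ht
      obtain ⟨i, _, rfl⟩ := ht
      exact hs
    · simp only [List.mem_singleton] at ht
      subst ht
      exact hs
  | advance =>
    intro s hs t ht
    simp only [exec] at ht
    split at ht <;>
    · simp only [List.mem_singleton] at ht
      subst ht
      exact hs

theorem branchSum_nonneg (A : Adversary S q E) (msg : List Bool) (c : Cmd)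
    {f : Branch S W E → ℝ} (hf : ∀ t, 0 ≤ t.weight → 0 ≤ f t) {s : Branch S W E}
    (hs : 0 ≤ s.weight) : 0 ≤ branchSum A msg c f s := by
  refine List.sum_nonneg fun x hx => ?_
  obtain ⟨t, ht, rfl⟩ := List.mem_map.1 hx
  exact hf t (weight_nonneg_of_mem_exec A msg c s hs t ht)

theorem list_sum_map_range (n : ℕ) (F : ℕ → ℝ) :
    ((List.range n).map F).sum = ∑ i ∈ Finset.range n, F i := by
  induction n with
  | zero => simp
  | succ n ih => rw [List.range_succ, Finset.sum_range_succ]; simp [ih]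

theorem branchSum_rand (A : Adversary S q E) (msg : List Bool) (v : ℕ) (e : Expr)
    (f : Branch S W E → ℝ) (s : Branch S W E) {n : ℕ} (hn : e.eval s.vars = n) (h0 : n ≠ 0) :
    branchSum A msg (.rand v e) f s = ∑ i ∈ Finset.range n,
      f { (s.setVar v i).tick (1 + e.cost s.vars) with weight := s.weight / n } := by
  simp only [branchSum, exec, hn, h0, if_false, List.map_map]
  exact list_sum_map_range n _

/-- `t` arises from `s` by measuring the qubits `x 0, x 1, …`, with outcomes `y`, and sending the
outcomes. -/
structure Branch.Measured (s : Branch S W E) (x : ℕ → Key S) {n : ℕ} (y : Fin n → Bool)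
    (t : Branch S W E) : Prop where
  vars : ∀ v < 12, t.vars v = s.vars v
  advPos : t.advPos = s.advPos
  weight : t.weight = s.weight
  sent : t.sent = s.sent ++ List.ofFn y
  amp : ∀ v e, t.amp (joint v e) =
    if ∀ j : Fin n, v (x j) = y j then s.amp (joint v e) else 0

/-- Measure the qubits of an array and send the outcomes. -/
def sendLoop (e : Expr) (l : Loc) : Cmd :=
  .loop 12 e (.seq (.measure 13 l) (.send (.var 13)))

theorem sum_snoc {n : ℕ} (g : (Fin (n + 1) → Bool) → ℝ) :
    ∑ y, g y = ∑ y : Fin n → Bool, (g (Fin.snoc y false) + g (Fin.snoc y true)) := by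
  rw [← (Fin.snocEquiv fun _ => Bool).sum_comp, Fintype.sum_prod_type, Finset.sum_comm]
  refine Finset.sum_congr rfl fun y _ => ?_
  simp [Fin.snocEquiv, add_comm]

/-- One branch arises for each outcome string. A lower bound suffices, and it has to be known only
for branches satisfying `Branch.Measured`. `f` and `g` are generalized in the induction, so that the
last measurement can be absorbed into them. -/
theorem le_branchSum_sendLoop (A : Adversary S q E) (msg : List Bool) {e : Expr} {l : Loc}
    {s : Branch S W E} {N : ℕ} (hN : e.eval s.vars = N) {x : ℕ → Key S}
    (hx : ∀ j < N, ∀ σ : ℕ → ℕ, (∀ v < 12, σ v = s.vars v) → σ 12 = j →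
      ∃ y : Qubit S W, resolve S W (decide (q ≤ s.advPos)) l.bank (l.index.eval σ) = some y ∧
        y.map Fin.val id = x j)
    {f : Branch S W E → ℝ} {g : (Fin N → Bool) → ℝ}
    (h : ∀ y t, s.Measured x y t → g y ≤ f t) :
    ∑ y, g y ≤ branchSum A msg (sendLoop e l) f s := by
  have key : ∀ n ≤ N, ∀ (f : Branch S W E → ℝ) (g : (Fin n → Bool) → ℝ),
      (∀ y t, s.Measured x y t → g y ≤ f t) → ∑ y, g y ≤
        (((List.range n).foldl (fun L i => L.flatMap fun t => exec A msg
          (.seq (.measure 13 l) (.send (.var 13))) ((t.setVar 12 i).tick 1))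
          [s.tick (1 + e.cost s.vars)]).map f).sum := by
    intro n
    induction n with
    | zero =>
      intro _ f g hfg
      simp only [List.range_zero, List.foldl_nil, List.map_cons, List.map_nil, List.sum_cons,
        List.sum_nil, add_zero, Finset.univ_unique, Finset.sum_singleton]
      exact hfg _ _ ⟨fun _ _ => rfl, rfl, rfl, by simp [Branch.tick], fun v e => by
        simp [Branch.tick]⟩
    | succ n ih =>
      intro hn f g hfg
      rw [List.range_succ, List.foldl_append, List.foldl_cons, List.foldl_nil, sum_map_flatMap,
        sum_snoc]
      -- The induction hypothesis is applied to the sums of `f` and of `g` over the two outcomes of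
      -- the last measurement.
      refine ih (by omega) _ _ fun y t ht => ?_
      obtain ⟨k, hk, hkx⟩ := hx n (by omega) ((t.setVar 12 n).tick 1).vars (fun v hv => by
        simp only [Branch.tick, Branch.setVar]
        rw [Function.update_of_ne (by omega), ht.vars v hv]) (by simp [Branch.tick, Branch.setVar])
      have hloc : ((t.setVar 12 n).tick 1).locate q l = some k := by
        rw [Branch.locate, ← hk]
        simp only [Branch.tick, Branch.setVar, ht.advPos]
      have hone : ∀ (r : Bool) (u : Branch S W E), (∀ v < 12, u.vars v = t.vars v) →
          u.advPos = t.advPos → u.weight = t.weight → u.sent = t.sent ++ [r] →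
          u.amp = projectQubit k r t.amp → g (Fin.snoc y r) ≤ f u := by
        intro r u hv hp hw hs ha
        refine hfg _ _ ⟨fun v h => (hv v h).trans (ht.vars v h), hp.trans ht.advPos,
          hw.trans ht.weight, ?_, fun v e => ?_⟩
        · rw [hs, ht.sent, List.ofFn_succ']
          simp [List.concat_eq_append]
        · rw [ha, projectQubit, ht.amp]
          have hkv : (joint (W := W) v e).1 k = v (x n) := by rw [← hkx]; rfl
          rw [hkv, ← ite_and]
          refine if_congr ?_ rfl rfl
          rw [Fin.forall_fin_succ']
          simp [and_comm]
      simp only [exec, hloc, List.map_cons, List.map_nil, List.flatMap_cons, List.flatMap_nil,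
        List.append_nil, List.cons_append, List.nil_append, List.sum_cons, List.sum_nil, add_zero]
      refine add_le_add (hone false _ ?_ rfl rfl ?_ rfl) (hone true _ ?_ rfl rfl ?_ rfl)
      · intro v hv
        simp only [Branch.tick, Branch.setVar]
        rw [Function.update_of_ne (by omega), Function.update_of_ne (by omega)]
      · simp [Branch.tick, Branch.setVar, Expr.eval]
      · intro v hv
        simp only [Branch.tick, Branch.setVar]
        rw [Function.update_of_ne (by omega), Function.update_of_ne (by omega)]
      · simp [Branch.tick, Branch.setVar, Expr.eval]
  have := key N le_rfl f g h
  rw [branchSum, sendLoop]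
  simp only [exec, hN] at this ⊢
  exact this

/-- Clear the first `n` of the qubits `k 0, k 1, …`. -/
def clearKeys (k : ℕ → ℕ) (n : ℕ) (v : Key S → Bool) (x : Key S) : Bool :=
  if ∃ j < n, x = .inl (k j) then false else v x

/-- Put the `n` qubits `k 0, k 1, …` into the uniform superposition. -/
theorem exec_hadamardLoop (A : Adversary S q E) (msg : List Bool) {e : Expr} {l : Expr}
    {s : Branch S W E} {N : ℕ} (hN : e.eval s.vars = N) {k : ℕ → ℕ}
    (hk : Function.Injective k) (hkW : ∀ j < N, k j < W)
    (hx : ∀ j < N, ∀ σ : ℕ → ℕ, (∀ v < 12, σ v = s.vars v) → σ 12 = j → l.eval σ = k j)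
    (hzero : ∀ v e, (∃ j < N, v (.inl (k j)) = true) → s.amp (joint v e) = 0) :
    ∃ t, exec A msg (.loop 12 e (.gate (.hadamard ⟨.work, l⟩))) s = [t] ∧
      (∀ v < 12, t.vars v = s.vars v) ∧ t.advPos = s.advPos ∧ t.weight = s.weight ∧
      t.sent = s.sent ∧ ∀ v e, t.amp (joint v e) =
        ((√2 : ℝ) : ℂ)⁻¹ ^ N * s.amp (joint (clearKeys k N v) e) := by
  have key : ∀ n ≤ N, ∃ t, (List.range n).foldl (fun L i => L.flatMap fun t => exec A msg
        (.gate (.hadamard ⟨.work, l⟩)) ((t.setVar 12 i).tick 1)) [s.tick (1 + e.cost s.vars)] = [t] ∧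
      (∀ v < 12, t.vars v = s.vars v) ∧ t.advPos = s.advPos ∧ t.weight = s.weight ∧
      t.sent = s.sent ∧ ∀ v e, t.amp (joint v e) =
        ((√2 : ℝ) : ℂ)⁻¹ ^ n * s.amp (joint (clearKeys k n v) e) := by
    intro n
    induction n with
    | zero =>
      intro _
      refine ⟨_, rfl, fun _ _ => rfl, rfl, rfl, rfl, fun v e => ?_⟩
      have : clearKeys k 0 v = v := by funext x; simp [clearKeys]
      simp [Branch.tick, this]
    | succ n ih =>
      intro hn
      obtain ⟨t, ht, h1, h2, h3, h4, h5⟩ := ih (by omega)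
      have hl := hx n (by omega) ((t.setVar 12 n).tick 1).vars (fun v hv => by
        simp only [Branch.tick, Branch.setVar]
        rw [Function.update_of_ne (by omega), h1 v hv]) (by simp [Branch.tick, Branch.setVar])
      have hloc : ((t.setVar 12 n).tick 1).locate q ⟨.work, l⟩ =
          some (.inl ⟨k n, hkW n (by omega)⟩) := by
        simp only [Branch.locate, hl, resolve, arrayIndex, hkW n (by omega), dif_pos,
          Option.map_some]
      rw [List.range_succ, List.foldl_append, ht]
      refine ⟨_, rfl, fun v hv => ?_, h2, h3, h4, fun v e => ?_⟩
      · simp only [Branch.tick, Branch.setVar]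
        rw [Function.update_of_ne (by omega), h1 v hv]
      · have hloc' : Branch.locate q ((t.setVar 12 n).tick 1) ⟨.work, l⟩ =
          some (.inl ⟨k n, hkW n (by omega)⟩) := hloc
        simp only [applyGate, hloc', setBit_joint, Sum.map_inl]
        have hf : clearKeys k n (Function.update v (.inl (k n)) false) =
            clearKeys (S := S) k (n + 1) v := by
          funext x
          simp only [clearKeys, Nat.lt_succ_iff_lt_or_eq, or_and_right, exists_or, exists_eq_left]
          by_cases h : ∃ j < n, x = .inl (k j)
          · simp [h]
          · by_cases h' : x = .inl (k n) <;> simp [h, h']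
        -- The qubit is still 0, so the term in which the Hadamard gate would contribute a sign
        -- vanishes, and each gate yields just a factor 1/√2.
        have htrue : s.amp (joint (clearKeys k n (Function.update v (.inl (k n)) true)) e) = 0 := by
          refine hzero _ _ ⟨n, by omega, ?_⟩
          rw [clearKeys, if_neg]
          · simp
          · rintro ⟨j, hj, h⟩
            have := hk (Sum.inl.inj h)
            omega
        simp only [Branch.tick, Branch.setVar, h5, htrue, hf, mul_zero, add_zero]
        rw [pow_succ, div_eq_mul_inv]
        ring
  obtain ⟨t, ht, h⟩ := key N le_rfl
  refine ⟨t, ?_, h⟩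
  simp only [exec, hN] at ht ⊢
  exact ht

end Branches

/-! ### One step of the simulation -/

namespace Sim

/-- Answer a query with the simulated oracle, run the adversary up to the next query, and record
what is to be observed there. -/
def step : Cmd :=
  .seq (compute.compile false 12) (.seq (result.compile false 12) (.seq (compute.compile true 12)
    (.seq .advance ((observeAll (.add (v 11) (c 1))).compile false 12))))

end Sim

section Step

variable {S : Sizes} {W q : ℕ} {E : Type} [Fintype E] [DecidableEq E]

theorem exec_seq_of_eq {A : Adversary S q E} {msg : List Bool} {c d : Cmd} {s t : Branch S W E}
    (h : exec A msg c s = [t]) : exec A msg (.seq c d) s = exec A msg d t := by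
  simp [exec, h]

/-- A loop that maintains the invariant `I`, without randomness and measurements. -/
theorem exec_loop_of_invariant {A : Adversary S q E} {msg : List Bool} {v : ℕ} {e : Expr}
    {c : Cmd} {s : Branch S W E} {N : ℕ} (hN : e.eval s.vars = N) {I : ℕ → Branch S W E → Prop}
    (h0 : I 0 (s.tick (1 + e.cost s.vars)))
    (hstep : ∀ j < N, ∀ t, I j t → ∃ u, exec A msg c ((t.setVar v j).tick 1) = [u] ∧ I (j + 1) u) :
    ∃ t, exec A msg (.loop v e c) s = [t] ∧ I N t := by
  have key : ∀ n ≤ N, ∃ t, (List.range n).foldl (fun L i => L.flatMap fun t => exec A msg c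
      ((t.setVar v i).tick 1)) [s.tick (1 + e.cost s.vars)] = [t] ∧ I n t := by
    intro n
    induction n with
    | zero => exact fun _ => ⟨_, rfl, h0⟩
    | succ n ih =>
      intro hn
      obtain ⟨t, ht, hI⟩ := ih (by omega)
      obtain ⟨u, hu, hIu⟩ := hstep n (by omega) t hI
      refine ⟨u, ?_, hIu⟩
      rw [List.range_succ, List.foldl_append, ht]
      simpa using hu
  obtain ⟨t, ht, hI⟩ := key N le_rfl
  refine ⟨t, ?_, hI⟩
  simp only [exec, hN]
  exact ht

omit [DecidableEq E] in
theorem applyAdv_joint (M : Matrix (AdvBasis S E) (AdvBasis S E) ℂ) (ψ : JointBasis S W E → ℂ)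
    (p : Memory S q) (u : AdvBasis S E) :
    applyAdv M ψ (joint (p.state u.1) u.2) =
      M.mulVec (fun t => ψ (joint (p.state t.1) t.2)) u := by
  simp only [applyAdv, Matrix.mulVec, dotProduct]
  refine Finset.sum_congr rfl fun t _ => ?_
  congr 2
  refine Prod.ext (funext fun k => ?_) rfl
  cases k <;> rfl

/-- The amplitude at a memory content `p` is pulled back through the step. Undoing the recording
turns `p` into `p.observe`; with that memory fixed, compute, result and uncompute act as the oracle
reprogrammed according to it, and the adversary's own operation leaves the memory alone. -/
theorem exec_step (A : Adversary S q E) (msg : List Bool) {κ : Bool → ℕ} {s : Branch S W E}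
    (hs : InputsOk S q s.vars) (hκ : KappaOk κ s.vars) (h11 : s.vars 11 = s.advPos)
    (hi : s.advPos < q) (hW : 16 * maxIndex S q + 16 ≤ W) :
    ∃ t, exec A msg Sim.step s = [t] ∧ (∀ v < 12, t.vars v = s.vars v) ∧
      t.advPos = s.advPos + 1 ∧ t.weight = s.weight ∧ t.sent = s.sent ∧
      ∀ (p : Memory S q) (u : AdvBasis S E), t.amp (joint (p.state u.1) u.2) =
        A.stepAt s.advPos (applyOracle (reprogram (linHash p.coef) (enabled κ s.advPos)
          (p.observe κ (s.advPos + 1) u.1).point p.val)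
          fun w => s.amp (joint ((p.observe κ (s.advPos + 1) u.1).state w.1) w.2)) u := by
  have hgc := gates_compute hs hκ h11
  have hgr := gates_result hs
  have hokc : ∀ g ∈ Sim.compute.gates S false 12 s.vars, g.Ok W := by
    rw [hgc]
    exact fun g hg => (inside_computeGates q _ g hg).ok hW
  have hokr : ∀ g ∈ Sim.result.gates S false 12 s.vars, g.Ok W := by
    rw [hgr]
    exact ok_resultGates hW
  have hfin : ∀ t : Branch S W E, t.advPos = s.advPos → decide (q ≤ t.advPos) = false := by
    intro t ht
    rw [decide_eq_false_iff_not]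
    omega
  obtain ⟨s₁, e₁, h₁⟩ := Sim.compute.exec_compile A msg false 12 s.vars s (by decide)
    (fun _ _ => rfl) (by rw [hfin s rfl]; exact hokc)
  obtain ⟨s₂, e₂, h₂⟩ := Sim.result.exec_compile A msg false 12 s.vars s₁ (by decide)
    h₁.vars (by rw [hfin s₁ h₁.advPos]; exact hokr)
  have p₂ := h₂.advPos.trans h₁.advPos
  obtain ⟨s₃, e₃, h₃⟩ := Sim.compute.exec_compile A msg true 12 s.vars s₂ (by decide)
    h₂.vars (by rw [hfin s₂ p₂]; exact hokc)
  rw [hfin s rfl] at h₁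
  rw [hfin s₁ h₁.advPos] at h₂
  rw [hfin s₂ p₂] at h₃
  simp only [if_true, if_false, Bool.false_eq_true, hgc, hgr] at h₁ h₂ h₃
  have p₃ : s₃.advPos = s.advPos := h₃.advPos.trans p₂
  have hq : s₃.advPos < q := by omega
  set s₄ : Branch S W E := { s₃.tick 1 with
    advPos := s₃.advPos + 1, amp := applyAdv (A.step ⟨s₃.advPos, hq⟩) s₃.amp } with hs₄
  have e₄ : exec A msg .advance s₃ = [s₄] := by simp [exec, hq, hs₄]
  have p₄ : s₄.advPos = s.advPos + 1 := by rw [← p₃]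
  have hidx : (Expr.add (Sim.v 11) (Sim.c 1)).eval s.vars = s.advPos + 1 := by
    simp [Expr.eval, Sim.v, Sim.c, h11]
  have hgo := gates_observeAll hs hκ hidx
  obtain ⟨s₅, e₅, h₅⟩ := (Sim.observeAll (.add (Sim.v 11) (Sim.c 1))).exec_compile A msg false 12
    s.vars s₄ (by decide) h₃.vars (by
      rw [p₄, hgo]
      exact ok_observeAllGates hW)
  rw [p₄, hgo] at h₅
  simp only [if_false, Bool.false_eq_true] at h₅
  refine ⟨s₅, ?_, h₅.vars, h₅.advPos.trans p₄, h₅.weight.trans (h₃.weight.trans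
    (h₂.weight.trans h₁.weight)), h₅.sent.trans (h₃.sent.trans (h₂.sent.trans h₁.sent)),
    fun p u => ?_⟩
  · rw [Sim.step, exec_seq_of_eq e₁, exec_seq_of_eq e₂, exec_seq_of_eq e₃, exec_seq_of_eq e₄, e₅]
  · rw [h₅.amp, runGates_observeAllGates, Adversary.stepAt, dif_pos hi, Matrix.mulVecLin_apply]
    have e6 : s₄.amp = applyAdv (A.step ⟨s.advPos, hi⟩) s₃.amp := by
      simp only [hs₄, p₃]
    rw [e6, applyAdv_joint]
    congr 1
    funext w
    rw [h₃.amp, h₂.amp, h₁.amp, List.reverse_reverse, ← runGates_append, ← runGates_append,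
      ← List.append_assoc, runGates_oracle]
    rfl

end Step

/-! ### The amplitudes maintained during the simulation. -/

section Invariant

variable {S : Sizes} {W q : ℕ} {E : Type} [Fintype E] [DecidableEq E]

/-- The variables have the values that they have throughout the simulation with the guess `κ`. -/
structure Ready (S : Sizes) (q : ℕ) (κ : Bool → ℕ) (Γ : ℕ → ℕ) : Prop where
  inputs : InputsOk S q Γ
  kappa : KappaOk κ Γ
  pick : Γ 10 = bitNum (pickBit κ)

theorem Ready.congr {κ : Bool → ℕ} {Γ Γ' : ℕ → ℕ} (h : Ready S q κ Γ)
    (hΓ : ∀ v < 11, Γ' v = Γ v) : Ready S q κ Γ' where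
  inputs v hv := (hΓ v (by omega)).trans (h.inputs v hv)
  kappa β := (hΓ _ (by have := bitNum_le β; omega)).trans (h.kappa β)
  pick := (hΓ 10 (by omega)).trans h.pick

/-- The state of the adversary after `i` steps of the simulation, given the contents of the
memory, up to normalization. -/
def Adversary.simulated (A : Adversary S q E) (κ : Bool → ℕ) (i : ℕ) (p : Memory S q)
    (s : AdvBasis S E) : ℂ :=
  if ∀ β, i < κ β / 2 → p.point β = fun _ => false then
    A.ideal κ (linHash p.coef) p.point p.val i s else 0

theorem xor_eq_zero_iff {x y : HashBit S → Bool} :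
    ((fun u => xor (x u) (y u)) = fun _ => false) ↔ y = x := by
  simp only [funext_iff]
  exact forall_congr' fun u => by cases x u <;> cases y u <;> simp

/-- Recording by XOR into a register that was zero is the mask of the ideal simulation: the
pulled-back register is zero exactly if the recorded point agrees with what is shown. The earlier
state does not depend on the point recorded now, by `Adversary.preIdeal_congr`. -/
theorem Adversary.simulated_succ (A : Adversary S q E) (κ : Bool → ℕ) (i : ℕ) (p : Memory S q)
    (s : AdvBasis S E) :
    A.stepAt i (applyOracle (reprogram (linHash p.coef) (enabled κ i)
      (p.observe κ (i + 1) s.1).point p.val)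
      (A.simulated κ i (p.observe κ (i + 1) s.1))) s = A.simulated κ (i + 1) p s := by
  set p' := p.observe κ (i + 1) s.1 with hp'
  have hcond : (∀ β, i < κ β / 2 → p'.point β = fun _ => false) ↔
      (∀ β, i + 1 < κ β / 2 → p.point β = fun _ => false) ∧
        Agrees q κ p.point (i + 1) s.1 := by
    rw [Agrees, ← forall_and]
    refine forall_congr' fun β => ?_
    simp only [hp', Memory.observe]
    by_cases h : κ β / 2 = i + 1
    · rw [if_pos h, xor_eq_zero_iff]
      simp [h]
    · have : i < κ β / 2 ↔ i + 1 < κ β / 2 := by omega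
      rw [if_neg h, this]
      simp [h]
  by_cases h : ∀ β, i < κ β / 2 → p'.point β = fun _ => false
  · have h1 : A.simulated κ i p' = A.ideal κ (linHash p.coef) p'.point p.val i := by
      funext t
      rw [Adversary.simulated, if_pos h]
      rfl
    obtain ⟨h2, h3⟩ := hcond.1 h
    rw [h1, ← A.preIdeal_succ, Adversary.simulated, if_pos h2, A.ideal_apply, if_pos h3]
    refine congrFun (A.preIdeal_congr κ _ (fun β hβ => ?_) fun β _ => rfl) s
    simp only [hp', Memory.observe]
    rw [if_neg (by omega)]
  · have h1 : A.simulated κ i p' = 0 := by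
      funext t
      rw [Adversary.simulated, if_neg h]
      rfl
    have h2 : applyOracle (reprogram (linHash p.coef) (enabled κ i) p'.point p.val)
        (0 : AdvBasis S E → ℂ) = 0 := rfl
    rw [h1, h2, map_zero, Adversary.simulated, A.ideal_apply]
    rw [hcond, not_and_or] at h
    rcases h with h | h
    · rw [if_neg h]; rfl
    · rw [if_neg h, ite_self]; rfl

/-- The amplitude of the uniform superposition over the hash function and one challenge. -/
def superAmp (S : Sizes) (q : ℕ) : ℂ := ((√2 : ℝ) : ℂ)⁻¹ ^ (S.chal * featLen S q + S.chal)

/-- The branch of the simulation with the guess `κ` after `i` steps of the adversary; `K` restricts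
the contents of the memory for which the amplitudes are known. -/
structure Branch.Simulates (A : Adversary S q E) (κ : Bool → ℕ) (i : ℕ) (wt : ℝ)
    (snt : List Bool) (K : Memory S q → Prop) (s : Branch S W E) : Prop where
  ready : Ready S q κ s.vars
  advPos : s.advPos = i
  weight : s.weight = wt
  sent : s.sent = snt
  amp : ∀ p, K p → ∀ t : AdvBasis S E,
    s.amp (joint (p.state t.1) t.2) = superAmp S q * A.simulated κ i p t

variable {A : Adversary S q E} {κ : Bool → ℕ} {i : ℕ} {wt : ℝ} {snt : List Bool}
  {K : Memory S q → Prop} {s : Branch S W E}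

theorem Branch.Simulates.setVar (h : s.Simulates A κ i wt snt K) {v n m : ℕ} (hv : 11 ≤ v) :
    ((s.setVar v n).tick m).Simulates A κ i wt snt K :=
  ⟨h.ready.congr fun w hw => Function.update_of_ne (by omega) _ _, h.advPos, h.weight, h.sent, h.amp⟩

theorem Branch.Simulates.step (h : s.Simulates A κ i wt snt K) (msg : List Bool)
    (h11 : s.vars 11 = i) (hi : i < q) (hW : 16 * maxIndex S q + 16 ≤ W)
    (hK : ∀ p u, K p → K (p.observe κ (i + 1) u)) :
    ∃ t, exec A msg Sim.step s = [t] ∧ t.Simulates A κ (i + 1) wt snt K := by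
  obtain ⟨hr, rfl, hw, hs, ha⟩ := h
  obtain ⟨t, ht, h1, h2, h3, h4, h5⟩ := exec_step A msg hr.inputs hr.kappa h11 hi hW
  refine ⟨t, ht, hr.congr fun v hv => h1 v (by omega), h2, h3.trans hw, h4.trans hs,
    fun p hp u => ?_⟩
  rw [h5, ← A.simulated_succ]
  have : (fun w : AdvBasis S E => s.amp (joint ((p.observe κ (s.advPos + 1) u.1).state w.1) w.2)) =
      superAmp S q • A.simulated κ s.advPos (p.observe κ (s.advPos + 1) u.1) :=
    funext fun w => ha _ (hK p u.1 hp) w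
  rw [this]
  exact congrFun ((A.stepAt s.advPos).map_smul (superAmp S q) (applyOracle (reprogram
    (linHash p.coef) (enabled κ s.advPos) (p.observe κ (s.advPos + 1) u.1).point p.val)
    (A.simulated κ s.advPos (p.observe κ (s.advPos + 1) u.1)))) u

theorem Branch.Simulates.measured (h : s.Simulates A κ i wt snt K) {x : ℕ → Key S} {n : ℕ}
    {y : Fin n → Bool} {t : Branch S W E} (ht : s.Measured x y t) {K' : Memory S q → Prop}
    (hK : ∀ p, K' p → K p ∧ ∀ u, ∀ j : Fin n, p.state u (x j) = y j) :
    t.Simulates A κ i wt (snt ++ List.ofFn y) K' where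
  ready := h.ready.congr fun v hv => ht.vars v (by omega)
  advPos := ht.advPos.trans h.advPos
  weight := ht.weight.trans h.weight
  sent := by rw [ht.sent, h.sent]
  amp p hp u := by
    rw [ht.amp, if_pos ((hK p hp).2 _), h.amp p (hK p hp).1]

end Invariant

/-! ### The phases of the simulation before the announcement -/

namespace Sim

/-- The number of the step after which the first of the two points is observed. -/
def firstE : Expr := .div (.sub (v 8) (.sub (v 8) (v 9))) (c 2)

def workAt (t e : Expr) : Loc := ⟨.work, .add (.mul (c 16) e) t⟩

/-- The steps before the first observation. -/
def stepsBefore : Cmd := .loop 11 (v 0) (.ite (.sub firstE (v 11)) step .skip)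

/-- The steps after the first observation. -/
def stepsAfter : Cmd := .loop 11 (v 0) (.ite (.sub (.add (v 11) (c 1)) firstE) step .skip)

/-- Choose the hash function and one of the challenges in superposition. -/
def prepare : Cmd :=
  .seq (.assign 10 (.sub (c 1) (.sub (c 1) (.sub (v 8) (v 9)))))
    (.seq (.loop 12 (.mul (v 5) featLenE) (.gate (.hadamard (work 12 (v 12)))))
      (.seq (.loop 12 (v 5) (.gate (.hadamard (workAt (.add (c 10) (v 10)) (v 12)))))
        ((observeAll (c 0)).compile false 12)))

end Sim

section Before

variable {S : Sizes} {W q : ℕ} {E : Type} [Fintype E] [DecidableEq E]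
  {A : Adversary S q E} {κ : Bool → ℕ} {i : ℕ} {wt : ℝ} {snt : List Bool}
  {K : Memory S q → Prop} {s : Branch S W E}

/-- The number of the step after which the first of the two points is observed. -/
def firstStep (κ : Bool → ℕ) : ℕ := κ (pickBit κ) / 2

theorem firstStep_le_half (κ : Bool → ℕ) (β : Bool) : firstStep κ ≤ κ β / 2 := by
  rw [firstStep, pickBit]
  refine Nat.div_le_div_right ?_
  by_cases h : κ true < κ false <;> cases β <;> simp [h] <;> omega

/-- With truncated subtraction, min(a, b) = a − (a − b), and `pickBit` selects the index of the
smaller entry of κ. -/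
theorem eval_firstE {Γ : ℕ → ℕ} (h : Ready S q κ Γ) : Sim.firstE.eval Γ = firstStep κ := by
  have h0 : Γ 8 = κ false := h.kappa false
  have h1 : Γ 9 = κ true := h.kappa true
  simp only [Sim.firstE, Expr.eval, Sim.v, Sim.c, h0, h1, firstStep, pickBit]
  by_cases h : κ true < κ false
  · simp only [h, decide_true]
    congr 1
    omega
  · simp only [h, decide_false]
    congr 1
    omega

/-- Tame loops may only have bounds in terms of the inputs, so the loop runs over all q steps and
the test skips those from the first observation on; hence the `min` in the invariant. -/
theorem Branch.Simulates.stepsBefore (h : s.Simulates A κ 0 wt snt K) (msg : List Bool)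
    (hκ : firstStep κ ≤ q) (hW : 16 * maxIndex S q + 16 ≤ W)
    (hK : ∀ p j u, K p → K (p.observe κ j u)) :
    ∃ t, exec A msg Sim.stepsBefore s = [t] ∧ t.Simulates A κ (firstStep κ) wt snt K := by
  obtain ⟨t, ht, hI⟩ := exec_loop_of_invariant (A := A) (msg := msg) (v := 11)
    (c := .ite (.sub Sim.firstE (Sim.v 11)) Sim.step .skip) (s := s)
    (show (Sim.v 0).eval s.vars = q from h.ready.inputs.all.1)
    (I := fun j t => t.Simulates A κ (min j (firstStep κ)) wt snt K)
    (by
      rw [Nat.zero_min]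
      exact ⟨h.ready, h.advPos, h.weight, h.sent, h.amp⟩)
    (by
      intro j hj t ht
      have ht' := ht.setVar (n := j) (m := 1) le_rfl
      have h11 : ((t.setVar 11 j).tick 1).vars 11 = j := by simp [Branch.tick, Branch.setVar]
      have hev : (Expr.sub Sim.firstE (Sim.v 11)).eval ((t.setVar 11 j).tick 1).vars =
          firstStep κ - j := by
        rw [Expr.eval, eval_firstE ht'.ready, Sim.v, Expr.eval, h11]
      simp only [exec, hev]
      by_cases hlt : j < firstStep κ
      · rw [if_pos (by omega)]
        rw [min_eq_left hlt.le] at ht'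
        rw [min_eq_left (by omega)]
        exact Branch.Simulates.step (s := ((t.setVar 11 j).tick 1).tick _)
          ⟨ht'.ready, ht'.advPos, ht'.weight, ht'.sent, ht'.amp⟩ msg h11 hj hW
          fun p u => hK p _ u
      · rw [if_neg (by omega)]
        rw [min_eq_right (by omega)] at ht' ⊢
        exact ⟨_, rfl, ht'.ready, ht'.advPos, ht'.weight, ht'.sent, ht'.amp⟩)
  rw [min_eq_right hκ] at hI
  exact ⟨t, ht, hI⟩

/-- The complementary half of the loop. Only observations later than the first occur, so `K` may
constrain the point that was recorded first and has already been measured. -/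
theorem Branch.Simulates.stepsAfter (h : s.Simulates A κ (firstStep κ) wt snt K)
    (msg : List Bool) (hκ : firstStep κ ≤ q) (hW : 16 * maxIndex S q + 16 ≤ W)
    (hK : ∀ p j u, firstStep κ < j → K p → K (p.observe κ j u)) :
    ∃ t, exec A msg Sim.stepsAfter s = [t] ∧ t.Simulates A κ q wt snt K := by
  obtain ⟨t, ht, hI⟩ := exec_loop_of_invariant (A := A) (msg := msg) (v := 11)
    (c := .ite (.sub (.add (Sim.v 11) (Sim.c 1)) Sim.firstE) Sim.step .skip) (s := s)
    (show (Sim.v 0).eval s.vars = q from h.ready.inputs.all.1)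
    (I := fun j t => t.Simulates A κ (max j (firstStep κ)) wt snt K)
    (by
      rw [Nat.zero_max]
      exact ⟨h.ready, h.advPos, h.weight, h.sent, h.amp⟩)
    (by
      intro j hj t ht
      have ht' := ht.setVar (n := j) (m := 1) le_rfl
      have h11 : ((t.setVar 11 j).tick 1).vars 11 = j := by simp [Branch.tick, Branch.setVar]
      have hev : (Expr.sub (.add (Sim.v 11) (Sim.c 1)) Sim.firstE).eval
          ((t.setVar 11 j).tick 1).vars = j + 1 - firstStep κ := by
        rw [Expr.eval, eval_firstE ht'.ready, Sim.v, Sim.c, Expr.eval, Expr.eval, Expr.eval, h11]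
      simp only [exec, hev]
      by_cases hle : firstStep κ ≤ j
      · rw [if_pos (by omega)]
        rw [max_eq_left hle] at ht'
        rw [max_eq_left (by omega)]
        exact Branch.Simulates.step (s := ((t.setVar 11 j).tick 1).tick _)
          ⟨ht'.ready, ht'.advPos, ht'.weight, ht'.sent, ht'.amp⟩ msg h11 hj hW
          fun p u => hK p _ u (by omega)
      · rw [if_neg (by omega)]
        rw [max_eq_right (by omega)] at ht' ⊢
        exact ⟨_, rfl, ht'.ready, ht'.advPos, ht'.weight, ht'.sent, ht'.amp⟩)
  rw [max_eq_left hκ] at hI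
  exact ⟨t, ht, hI⟩

theorem clearKeys_wk {τ υ : ℕ} (hτ : τ < 16) (hυ : υ < 16) (N : ℕ) (v : Key S → Bool) (j : ℕ) :
    clearKeys (fun j => 16 * j + τ) N v (wk υ j) =
      if υ = τ ∧ j < N then false else v (wk υ j) := by
  rw [clearKeys]
  refine if_congr ⟨fun ⟨n, hn, h⟩ => ?_, fun h => ⟨j, h.2, by rw [h.1]; rfl⟩⟩ rfl rfl
  simp only [wk, Sum.inl.injEq] at h
  omega

/-- The memory without the hash function and the challenges. -/
def Memory.pointsOnly (p : Memory S q) : Memory S q :=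
  ⟨fun _ _ => false, p.point, fun _ _ => false⟩

theorem rawVal_eq_false {n : ℕ} (f : Bits n) {j : ℕ} (h : n ≤ j) : rawVal f j = false := by
  rw [rawVal, dif_neg (by omega)]

theorem rawVal_zero (n j : ℕ) : rawVal (fun _ : Fin n => false) j = false := by
  simp [rawVal]

theorem rawCoef_zero (j : ℕ) :
    rawCoef (fun (_ : Fin S.chal) (_ : Fin (featLen S q)) => false) j = false := by
  simp [rawCoef]

theorem rawCoef_eq_false (r : Fin S.chal → Fin (featLen S q) → Bool) {j : ℕ}
    (h : S.chal * featLen S q ≤ j) : rawCoef r j = false := by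
  rw [rawCoef, dif_neg]
  rw [not_lt]
  exact (Nat.le_div_iff_mul_le (featLen_pos S q)).2 h

/-- This is the memory seen after pulling back both Hadamard loops. The challenge register of the
other index has no Hadamard gates and must therefore be zero already. -/
theorem clearKeys_state (p : Memory S q) (b : Bool) (hp : p.val (!b) = fun _ => false)
    (t : AdvQubit S → Bool) :
    clearKeys (fun j => 16 * j + 12) (S.chal * featLen S q)
      (clearKeys (fun j => 16 * j + (10 + bitNum b)) S.chal (p.state t)) =
      p.pointsOnly.state t := by
  have hb := bitNum_le b
  funext k
  rcases k with n | k
  · obtain ⟨υ, j, hυ, hk⟩ : ∃ υ j, υ < 16 ∧ (.inl n : Key S) = wk υ j :=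
      ⟨n % 16, n / 16, Nat.mod_lt _ (by omega), by simp only [wk, Sum.inl.injEq]; omega⟩
    rw [hk, clearKeys_wk (by omega) hυ, clearKeys_wk (by omega) hυ, p.state_wk _ hυ,
      p.pointsOnly.state_wk _ hυ]
    simp only [Memory.array, Memory.pointsOnly]
    by_cases h12 : υ = 12
    · subst h12
      by_cases hj : j < S.chal * featLen S q
      · simp [hj, rawCoef_zero]
      · simp [rawCoef_zero, rawCoef_eq_false p.coef (not_lt.1 hj)]
    · by_cases h10 : υ = 10 + bitNum b
      · by_cases hj : j < S.chal
        · cases b <;> simp [bitNum] at h10 <;> simp [h10, hj, bitNum, rawVal_zero]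
        · cases b <;> simp [bitNum] at h10 <;>
            simp [h10, rawVal_eq_false _ (not_lt.1 hj)]
      · cases b <;> simp [bitNum] at h10 hp <;> simp [h12, h10, hp, bitNum]
  · simp [clearKeys]

theorem startBranch_amp (A : Adversary S q E) (p : Memory S q) (t : AdvBasis S E)
    (hW : 16 * maxIndex S q + 16 ≤ W) :
    (startBranch A W).amp (joint (p.pointsOnly.state t.1) t.2) =
      if ∀ β, p.point β = fun _ => false then A.start t else 0 := by
  have harr : (∀ k : Fin W, (joint (W := W) (p.pointsOnly.state t.1) t.2).1 (.inl k) = false) ↔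
      ∀ β, p.point β = fun _ => false := by
    have hbits : ∀ k : Fin W, (joint (W := W) (p.pointsOnly.state t.1) t.2).1 (.inl k) =
      p.pointsOnly.bits k := fun _ => rfl
    simp only [hbits]
    constructor
    · intro h β
      funext u
      have hb := bitNum_le β
      have hu := hashPos_lt u
      have := h ⟨16 * hashPos u + (8 + bitNum β), by
        simp only [maxIndex] at hW
        omega⟩
      have hwk := p.pointsOnly.state_wk t.1 (τ := 8 + bitNum β) (by omega) (hashPos u)
      rw [show p.pointsOnly.state t.1 (wk (8 + bitNum β) (hashPos u)) = _ from this] at hwk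
      cases β <;> simpa [Memory.array, bitNum, Memory.pointsOnly] using hwk.symm
    · intro h k
      have hz : ∀ n, rawBits (fun _ : HashBit S => false) n = false := by simp [rawBits]
      simp only [Memory.bits, Memory.array, Memory.pointsOnly, h]
      split_ifs <;> simp [hz, rawVal_zero, rawCoef_zero]
  simp only [startBranch, harr]
  rfl

/-- Points with κ β / 2 = 0 are recorded before the adversary's first operation, so the simulated
state at step 0 is the initial state with this recording applied. -/
theorem Adversary.simulated_zero (A : Adversary S q E) (κ : Bool → ℕ) (p : Memory S q)
    (t : AdvBasis S E) :
    A.simulated κ 0 p t =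
      if ∀ β, (p.observe κ 0 t.1).point β = fun _ => false then A.start t else 0 := by
  have hcond : (∀ β, (p.observe κ 0 t.1).point β = fun _ => false) ↔
      (∀ β, 0 < κ β / 2 → p.point β = fun _ => false) ∧ Agrees q κ p.point 0 t.1 := by
    rw [Agrees, ← forall_and]
    refine forall_congr' fun β => ?_
    simp only [Memory.observe]
    by_cases h : κ β / 2 = 0
    · rw [if_pos h, xor_eq_zero_iff]
      simp [h]
    · rw [if_neg h]
      simp [h, Nat.pos_of_ne_zero h]
  rw [Adversary.simulated, A.ideal_apply, ← ite_and]
  exact if_congr hcond.symm rfl rfl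

theorem exec_prepare (msg : List Bool) (hs : InputsOk S q s.vars) (hκ : KappaOk κ s.vars)
    (hpos : s.advPos = 0) (hw : s.weight = wt) (hsent : s.sent = snt)
    (hamp : s.amp = (startBranch A W).amp) (hW : 16 * maxIndex S q + 16 ≤ W) :
    ∃ t, exec A msg Sim.prepare s = [t] ∧
      t.Simulates A κ 0 wt snt fun p => p.val (!pickBit κ) = fun _ => false := by
  set b := pickBit κ with hb
  have hb1 := bitNum_le b
  -- 1 − (1 − (κ₀ − κ₁)) with truncated subtraction is the indicator of κ₁ < κ₀, i.e. the bit b.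
  set e₀ : Expr := .sub (Sim.c 1) (.sub (Sim.c 1) (.sub (Sim.v 8) (Sim.v 9))) with he₀
  set s₀ : Branch S W E := (s.setVar 10 (e₀.eval s.vars)).tick (1 + e₀.cost s.vars) with hs₀
  have E₀ : exec A msg (.assign 10 e₀) s = [s₀] := rfl
  have r₀ : Ready S q κ s₀.vars := by
    refine ⟨hs.update (by omega) _, fun β => ?_, ?_⟩
    · have := bitNum_le β
      exact (Function.update_of_ne (by omega) _ _).trans (hκ β)
    · have h0 : s.vars 8 = κ false := hκ false
      have h1 : s.vars 9 = κ true := hκ true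
      simp only [hs₀, Branch.tick, Branch.setVar, Function.update_self, he₀, Expr.eval, Sim.c,
        Sim.v, h0, h1, pickBit]
      by_cases h : κ true < κ false
      · simp only [h, decide_true, bitNum, if_true]
        omega
      · simp only [h, decide_false, bitNum, Bool.false_eq_true, if_false]
        omega
  have hclear : ∀ v : Key S → Bool, ∀ e, (∃ n < W, v (.inl n) = true) →
      s₀.amp (joint v e) = 0 := by
    rintro v e ⟨n, hn, hv⟩
    simp only [hs₀, Branch.tick, Branch.setVar, hamp, startBranch]
    rw [if_neg]
    intro h
    have := h ⟨n, hn⟩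
    simp [joint, hv] at this
  have hN : (Expr.mul (Sim.v 5) Sim.featLenE).eval s₀.vars = S.chal * featLen S q := by
    rw [Expr.eval, eval_featLenE r₀.inputs, Sim.v, Expr.eval, r₀.inputs.all.2.2.2.2.2.1]
  obtain ⟨s₁, E₁, v₁, a₁, w₁, n₁, m₁⟩ := exec_hadamardLoop A msg hN
    (l := (Sim.work 12 (Sim.v 12)).index) (k := fun j => 16 * j + 12)
    (fun i j h => by simpa using h) (fun j hj => by simp only [maxIndex] at hW; omega)
    (fun j _ σ _ h => by simp [Sim.work, Expr.eval, Sim.c, Sim.v, h])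
    (fun v e ⟨j, hj, h⟩ => hclear v e ⟨_, by simp only [maxIndex] at hW; omega, h⟩)
  have r₁ : Ready S q κ s₁.vars := r₀.congr fun v hv => v₁ v (by omega)
  have hN₁ : (Sim.v 5).eval s₁.vars = S.chal := r₁.inputs.all.2.2.2.2.2.1
  obtain ⟨s₂, E₂, v₂, a₂, w₂, n₂, m₂⟩ := exec_hadamardLoop A msg hN₁
    (l := (Sim.workAt (.add (Sim.c 10) (Sim.v 10)) (Sim.v 12)).index)
    (k := fun j => 16 * j + (10 + bitNum b))
    (fun i j h => by simpa using h) (fun j hj => by simp only [maxIndex] at hW; omega)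
    (fun j _ σ hσ h => by
      simp [Sim.workAt, Expr.eval, Sim.c, Sim.v, h, hσ 10, r₁.pick, hb])
    -- The first Hadamard loop only affects array 12, so the challenge register is still zero here.
    (fun v e ⟨j, hj, h⟩ => by
      rw [m₁, hclear _ _ ⟨16 * j + (10 + bitNum b), by simp only [maxIndex] at hW; omega, ?_⟩,
        mul_zero]
      have := clearKeys_wk (τ := 12) (υ := 10 + bitNum b) (by omega) (by omega)
        (S.chal * featLen S q) v j
      rw [if_neg (by omega)] at this
      exact this.trans h)
  have r₂ : Ready S q κ s₂.vars := r₁.congr fun v hv => v₂ v (by omega)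
  have hp₂ : s₂.advPos = 0 := a₂.trans (a₁.trans hpos)
  have hgo := gates_observeAll (q := q) r₂.inputs r₂.kappa (idx := Sim.c 0) (i := 0) rfl
  obtain ⟨s₃, E₃, h₃⟩ := (Sim.observeAll (Sim.c 0)).exec_compile A msg false 12 s₂.vars s₂
    (by decide) (fun _ _ => rfl) (by
      rw [hp₂, hgo]
      exact ok_observeAllGates hW)
  rw [hp₂, hgo] at h₃
  simp only [if_false, Bool.false_eq_true] at h₃
  refine ⟨s₃, ?_, r₂.congr fun v hv => h₃.vars v (by omega), h₃.advPos.trans hp₂,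
    h₃.weight.trans (w₂.trans (w₁.trans hw)), h₃.sent.trans (n₂.trans (n₁.trans hsent)),
    fun p hp t => ?_⟩
  · exact (exec_seq_of_eq E₀).trans
      ((exec_seq_of_eq E₁).trans ((exec_seq_of_eq E₂).trans E₃))
  · rw [h₃.amp, runGates_observeAllGates, m₂, m₁, clearKeys_state (p.observe κ 0 t.1) b hp]
    have : s₀.amp = (startBranch A W).amp := hamp
    rw [this, startBranch_amp A _ t hW, A.simulated_zero, superAmp, pow_add]
    ring

end Before

/-! ### The prover -/

namespace Sim

/-- A bit of the point that is observed first. -/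
def pointBit (e : Expr) : Loc := workAt (.add (c 8) (v 10)) e

def announce : Cmd :=
  .seq (.rand 8 (.add (.mul (c 2) (v 0)) (c 1))) (.seq (.rand 9 (.add (.mul (c 2) (v 0)) (c 1)))
    (.seq prepare (.seq stepsBefore (.seq (.send (v 10))
      (.seq (sendLoop (v 1) (pointBit (.add (c 1) (v 12))))
        (sendLoop (v 2) (pointBit (.add (.add (c 1) (v 1)) (v 12)))))))))

def sendCom (β : Bool) : Cmd :=
  sendLoop (v (3 + bitNum β)) (pointBit (.add afterInst (v 12)))

def commit : Cmd := .ite (v 10) (sendCom true) (sendCom false)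

/-- Reprogram the hash function at the first point to the challenge received. -/
def useChallenge : Cmd :=
  .loop 12 (v 5) (.seq (.read 13 (v 12))
    (.ite (v 13) (.gate (.not (workAt (.sub (c 11) (v 10)) (v 12)))) .skip))

def sendResp (β : Bool) : Cmd := sendLoop (v (6 + bitNum β)) ⟨.outResp β, v 12⟩

def respond : Cmd :=
  .seq useChallenge (.seq stepsAfter (.ite (v 10) (sendResp true) (sendResp false)))

def prover : Prover := ⟨announce, commit, respond⟩

end Sim

/-! ### The phases of the interaction. -/

section Phases

variable {S : Sizes} {W q : ℕ} {E : Type} [Fintype E] [DecidableEq E]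
  {A : Adversary S q E} {κ : Bool → ℕ} {i : ℕ} {wt : ℝ} {snt : List Bool}
  {K : Memory S q → Prop} {s : Branch S W E}

theorem Branch.Simulates.mono (h : s.Simulates A κ i wt snt K) {K' : Memory S q → Prop}
    (hK : ∀ p, K' p → K p) : s.Simulates A κ i wt snt K' :=
  ⟨h.ready, h.advPos, h.weight, h.sent, fun p hp => h.amp p (hK p hp)⟩

theorem Branch.Simulates.tick (h : s.Simulates A κ i wt snt K) (n : ℕ) :
    (s.tick n).Simulates A κ i wt snt K :=
  ⟨h.ready, h.advPos, h.weight, h.sent, h.amp⟩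

theorem Branch.Simulates.clearSent (h : s.Simulates A κ i wt snt K) :
    ({ s with sent := [] } : Branch S W E).Simulates A κ i wt [] K :=
  ⟨h.ready, h.advPos, h.weight, rfl, h.amp⟩

theorem branchSum_ite_pick (msg : List Bool) (h : Ready S q κ s.vars) (d : Bool → Cmd)
    (f : Branch S W E → ℝ) :
    branchSum A msg (.ite (Sim.v 10) (d true) (d false)) f s =
      branchSum A msg (d (pickBit κ)) f (s.tick (1 + (Sim.v 10).cost s.vars)) := by
  have hv : (Sim.v 10).eval s.vars = bitNum (pickBit κ) := h.pick
  simp only [branchSum, exec, hv]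
  cases pickBit κ <;> simp [bitNum]

theorem Branch.Simulates.le_branchSum_sendPoint (h : s.Simulates A κ i wt snt K)
    (msg : List Bool) {e idx : Expr} {N : ℕ} (hN : e.eval s.vars = N) (u : Fin N → HashBit S)
    (hidx : ∀ (j : Fin N) (σ : ℕ → ℕ), (∀ v < 12, σ v = s.vars v) → σ 12 = j →
      idx.eval σ = hashPos (u j)) (hW : 16 * maxIndex S q + 16 ≤ W)
    {f : Branch S W E → ℝ} {g : (Fin N → Bool) → ℝ}
    (hfg : ∀ y t, t.Simulates A κ i wt (snt ++ List.ofFn y)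
      (fun p => K p ∧ ∀ j, p.point (pickBit κ) (u j) = y j) → g y ≤ f t) :
    ∑ y, g y ≤ branchSum A msg (sendLoop e (Sim.pointBit idx)) f s := by
  have hb := bitNum_le (pickBit κ)
  refine le_branchSum_sendLoop A msg hN
    (x := fun j => if h : j < N then wk (8 + bitNum (pickBit κ)) (hashPos (u ⟨j, h⟩)) else .inl 0)
    (fun j hj σ hσ h12 => ?_) fun y t ht => hfg y t (h.measured ht fun p hp => ⟨hp.1, fun w j => ?_⟩)
  · have hlt := hashPos_lt (u ⟨j, hj⟩)
    have hev : (Sim.pointBit idx).index.eval σ =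
        16 * hashPos (u ⟨j, hj⟩) + (8 + bitNum (pickBit κ)) := by
      simp only [Sim.pointBit, Sim.workAt, Expr.eval, Sim.c, Sim.v, hσ 10 (by omega),
        h.ready.pick, hidx ⟨j, hj⟩ σ hσ h12]
    rw [hev, dif_pos hj]
    refine exists_resolve (k := .work) rfl fun n hn => ?_
    simp only [wk, Sum.inl.injEq] at hn
    simp only [maxIndex] at hW
    omega
  · rw [dif_pos j.2, Memory.state_wk _ _ (by omega), ← hp.2 j]
    cases pickBit κ <;> simp [Memory.array, bitNum]

/-- Only the outcome equal to the prescribed instance counts; the other outcomes contribute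
nonnegative amounts and are dropped. -/
theorem Branch.Simulates.le_branchSum_sendPoint_single (h : s.Simulates A κ i wt snt K)
    (hwt : 0 ≤ wt) (msg : List Bool) {e idx : Expr} {N : ℕ} (hN : e.eval s.vars = N)
    (u : Fin N → HashBit S)
    (hidx : ∀ (j : Fin N) (σ : ℕ → ℕ), (∀ v < 12, σ v = s.vars v) → σ 12 = j →
      idx.eval σ = hashPos (u j)) (hW : 16 * maxIndex S q + 16 ≤ W)
    {f : Branch S W E → ℝ} (hf : ∀ t, 0 ≤ t.weight → 0 ≤ f t) (y : Fin N → Bool) {B : ℝ}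
    (hfg : ∀ t, t.Simulates A κ i wt (snt ++ List.ofFn y)
      (fun p => K p ∧ ∀ j, p.point (pickBit κ) (u j) = y j) → B ≤ f t) :
    B ≤ branchSum A msg (sendLoop e (Sim.pointBit idx)) f s := by
  have := h.le_branchSum_sendPoint msg hN u hidx hW (f := f)
    (g := fun y' => if y' = y then B else 0) fun y' t ht => by
      by_cases hy : y' = y
      · subst hy
        rw [if_pos rfl]
        exact hfg t ht
      · rw [if_neg hy]
        exact hf t (by rw [ht.weight]; exact hwt)
  simpa using this

/-- What is known about the memory once the instances `x` and the message `a` have been sent, where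
`d` is the challenge. -/
def Known (κ : Bool → ℕ) (d : Bits S.chal) (x : Instances S) (a : Bits (S.com (pickBit κ)))
    (p : Memory S q) : Prop :=
  p.val (!pickBit κ) = d ∧ (∀ β j, p.point (pickBit κ) (.inst β j) = x β j) ∧
    ∀ j : Fin (S.com (pickBit κ)),
      p.point (pickBit κ) (.com (j.castLE (com_le_max S (pickBit κ)))) = a j

theorem Branch.Simulates.le_branchSum_commit {x : Instances S}
    (h : s.Simulates A κ i wt [] fun p => p.val (!pickBit κ) = (fun _ => false) ∧
      ∀ β j, p.point (pickBit κ) (.inst β j) = x β j)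
    (msg : List Bool) (hW : 16 * maxIndex S q + 16 ≤ W)
    {f : Branch S W E → ℝ} {g : Bits (S.com (pickBit κ)) → ℝ}
    (hfg : ∀ a t, t.Simulates A κ i wt (List.ofFn a) (Known κ (fun _ => false) x a) →
      g a ≤ f t) :
    ∑ a, g a ≤ branchSum A msg Sim.commit f s := by
  rw [Sim.commit, branchSum_ite_pick msg h.ready Sim.sendCom]
  have h' := h.tick (1 + (Sim.v 10).cost s.vars)
  refine h'.le_branchSum_sendPoint msg ?_
    (fun j => .com (j.castLE (com_le_max S (pickBit κ)))) (fun j σ hσ h12 => ?_) hW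
    fun a t ht => hfg a t (ht.mono fun p hp => ⟨⟨hp.1, hp.2.1⟩, hp.2.2⟩)
  · cases pickBit κ
    · exact h.ready.inputs.all.2.2.2.1
    · exact h.ready.inputs.all.2.2.2.2.1
  · have hin : InputsOk S q σ := fun v hv => (hσ v (by omega)).trans (h.ready.inputs v hv)
    rw [Expr.eval, eval_afterInst hin, Sim.v, Expr.eval, h12]
    rfl

/-- Flip the qubits `k j` for which `c j`, where `j < n`. -/
def flipKeys (k : ℕ → ℕ) (c : ℕ → Bool) (n : ℕ) (v : Key S → Bool) (x : Key S) : Bool :=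
  xor (v x) (decide (∃ j < n, x = .inl (k j) ∧ c j = true))

theorem flipKeys_update {k : ℕ → ℕ} (hk : Function.Injective k) (c : ℕ → Bool) (n : ℕ)
    (v : Key S → Bool) :
    flipKeys k c n (if c n then Function.update v (.inl (k n)) (!v (.inl (k n))) else v) =
      flipKeys k c (n + 1) v := by
  funext x
  simp only [flipKeys, Nat.lt_succ_iff_lt_or_eq, or_and_right, exists_or, exists_eq_left]
  by_cases hx : x = .inl (k n)
  · have hno : ¬ ∃ j < n, x = .inl (k j) ∧ c j = true := by
      rintro ⟨j, hj, h, -⟩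
      rw [hx, Sum.inl.injEq] at h
      have := hk h
      omega
    subst hx
    simp only [hno, false_or, true_and]
    cases c n <;> simp
  · have : (if c n then Function.update v (.inl (k n)) (!v (.inl (k n))) else v) x = v x := by
      split
      · exact Function.update_of_ne hx _ _
      · rfl
    rw [this]
    simp [hx]

theorem flipKeys_wk {τ υ : ℕ} (hτ : τ < 16) (hυ : υ < 16) (c : ℕ → Bool) (N : ℕ)
    (v : Key S → Bool) (j : ℕ) :
    flipKeys (fun j => 16 * j + τ) c N v (wk υ j) =
      xor (v (wk υ j)) (decide (υ = τ ∧ j < N ∧ c j = true)) := by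
  rw [flipKeys]
  congr 2
  refine propext ⟨fun ⟨n, hn, h, hc⟩ => ?_, fun h => ⟨j, h.2.1, by rw [h.1]; rfl, h.2.2⟩⟩
  simp only [wk, Sum.inl.injEq] at h
  obtain rfl : n = j := by omega
  exact ⟨by omega, hn, hc⟩

/-- The memory with the challenge for `b` cleared. -/
def Memory.clearVal (p : Memory S q) (b : Bool) : Memory S q :=
  { p with val := Function.update p.val b fun _ => false }

theorem flipKeys_state (p : Memory S q) (b : Bool) (t : AdvQubit S → Bool) :
    flipKeys (fun j => 16 * j + (10 + bitNum b)) (rawVal (p.val b)) S.chal (p.state t) =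
      (p.clearVal b).state t := by
  have hb := bitNum_le b
  funext k
  rcases k with n | k
  · obtain ⟨υ, j, hυ, hk⟩ : ∃ υ j, υ < 16 ∧ (.inl n : Key S) = wk υ j :=
      ⟨n % 16, n / 16, Nat.mod_lt _ (by omega), by simp only [wk, Sum.inl.injEq]; omega⟩
    rw [hk, flipKeys_wk (by omega) hυ, p.state_wk _ hυ, Memory.state_wk _ _ hυ]
    simp only [Memory.array, Memory.clearVal]
    have hlt : ∀ {f : Bits S.chal}, (j < S.chal ∧ rawVal f j = true) ↔ rawVal f j = true :=
      fun {f} => ⟨fun h => h.2, fun h => ⟨by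
        by_contra hj
        rw [rawVal_eq_false f (not_lt.1 hj)] at h
        simp at h, h⟩⟩
    simp only [hlt]
    by_cases h10 : υ = 10 + bitNum b
    · cases b <;> simp [bitNum] at h10 <;> simp [h10, rawVal_zero, bitNum]
    · cases b <;> simp [bitNum] at h10 <;> simp [h10, bitNum]
  · simp [flipKeys]

/-- Up to the first observation no reprogrammed value has been used, so the state does not depend on
the challenge registers. -/
theorem Adversary.simulated_clearVal (A : Adversary S q E) (κ : Bool → ℕ) (p : Memory S q)
    (b : Bool) (t : AdvBasis S E) :
    A.simulated κ (firstStep κ) (p.clearVal b) t = A.simulated κ (firstStep κ) p t := by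
  simp only [Adversary.simulated, A.ideal_apply, Memory.clearVal]
  rw [A.preIdeal_congr κ (linHash p.coef) (h := p.point) (h' := p.point) (Θ' := p.val)
    (fun _ _ => rfl) fun β hβ => by
      have := firstStep_le_half κ β
      omega]
  rfl

theorem getD_ofFn {n : ℕ} (c : Fin n → Bool) (j : ℕ) :
    (List.ofFn c).getD j false = rawVal c j := by
  rw [List.getD_eq_getElem?_getD, List.getElem?_ofFn, rawVal]
  split <;> rfl

/-- Flipping the bits of c into the zero register moves the known amplitudes from challenge 0 to
challenge c. Since they do not yet depend on the challenge, the result is as if c had been there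
from the start. -/
theorem Branch.Simulates.useChallenge {X : (HashBit S → Bool) → Prop}
    (h : s.Simulates A κ (firstStep κ) wt snt fun p =>
      p.val (!pickBit κ) = (fun _ => false) ∧ X (p.point (pickBit κ)))
    (c : Bits S.chal) (hW : 16 * maxIndex S q + 16 ≤ W) :
    ∃ t, exec A (List.ofFn c) Sim.useChallenge s = [t] ∧
      t.Simulates A κ (firstStep κ) wt snt fun p =>
        p.val (!pickBit κ) = c ∧ X (p.point (pickBit κ)) := by
  set b := pickBit κ with hb
  have hb1 := bitNum_le (!b)
  -- The challenge is written to the array of the index other than b.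
  have hbn : 11 - bitNum b = 10 + bitNum (!b) := by cases b <;> rfl
  have hinj : Function.Injective fun j => 16 * j + (10 + bitNum (!b)) :=
    fun i j h => by simpa using h
  obtain ⟨t, ht, h1, h2, h3, h4, h5⟩ := exec_loop_of_invariant (A := A) (msg := List.ofFn c)
    (v := 12) (s := s) (c := .seq (.read 13 (Sim.v 12)) (.ite (Sim.v 13)
      (.gate (.not (Sim.workAt (.sub (Sim.c 11) (Sim.v 10)) (Sim.v 12)))) .skip))
    (show (Sim.v 5).eval s.vars = S.chal from h.ready.inputs.all.2.2.2.2.2.1)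
    (I := fun j t => (∀ v < 12, t.vars v = s.vars v) ∧ t.advPos = s.advPos ∧
      t.weight = s.weight ∧ t.sent = s.sent ∧ ∀ v e, t.amp (joint v e) = s.amp (joint
        (flipKeys (fun j => 16 * j + (10 + bitNum (!b))) (rawVal c) j v) e))
    ⟨fun _ _ => rfl, rfl, rfl, rfl, fun v e => by
      have : flipKeys (fun j => 16 * j + (10 + bitNum (!b))) (rawVal c) 0 v = v := by
        funext x; simp [flipKeys]
      rw [this]
      rfl⟩
    (by
      intro j hj t ⟨h1, h2, h3, h4, h5⟩
      set t' : Branch S W E := (((t.setVar 12 j).tick 1).setVar 13 (rawVal c j).toNat).tick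
        (1 + (Sim.v 12).cost ((t.setVar 12 j).tick 1).vars) with ht'
      have e1 : exec A (List.ofFn c) (.read 13 (Sim.v 12)) ((t.setVar 12 j).tick 1) = [t'] := by
        simp [exec, ht', Sim.v, Expr.eval, Branch.tick, Branch.setVar, ← getD_ofFn]
      rw [exec_seq_of_eq e1]
      have e13 : (Sim.v 13).eval t'.vars = (rawVal c j).toNat := by
        simp [ht', Sim.v, Expr.eval, Branch.tick, Branch.setVar]
      have e12 : t'.vars 12 = j := by
        simp [ht', Branch.tick, Branch.setVar]
      have hv : ∀ v < 12, t'.vars v = s.vars v := fun v hv => by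
        rw [← h1 v hv]
        simp only [ht', Branch.tick, Branch.setVar]
        rw [Function.update_of_ne (by omega), Function.update_of_ne (by omega)]
      have hidx : (Expr.add (.mul (Sim.c 16) (Sim.v 12)) (.sub (Sim.c 11) (Sim.v 10))).eval
          t'.vars = 16 * j + (10 + bitNum (!b)) := by
        simp only [Expr.eval, Sim.c, Sim.v, e12, hv 10 (by omega), h.ready.pick, ← hbn]
        rfl
      have hlt : 16 * j + (10 + bitNum (!b)) < W := by
        simp only [maxIndex] at hW
        omega
      simp only [exec, e13]
      have hstep := flipKeys_update (S := S) hinj (rawVal c) j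
      cases hc : rawVal c j with
      | false =>
        simp only [Bool.toNat_false, ne_eq, not_true_eq_false, if_false]
        refine ⟨_, rfl, hv, h2, h3, h4, fun v e => ?_⟩
        rw [← hstep, hc]
        exact h5 v e
      | true =>
        simp only [Bool.toNat_true, ne_eq, one_ne_zero, not_false_eq_true, if_true]
        refine ⟨_, rfl, hv, h2, h3, h4, fun v e => ?_⟩
        have hloc : (t'.tick (1 + (Sim.v 13).cost t'.vars)).locate q
            (Sim.workAt (.sub (Sim.c 11) (Sim.v 10)) (Sim.v 12)) =
            some (.inl ⟨16 * j + (10 + bitNum (!b)), hlt⟩) := by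
          have : (t'.tick (1 + (Sim.v 13).cost t'.vars)).vars = t'.vars := rfl
          simp only [Branch.locate, Sim.workAt, resolve, this, hidx, arrayIndex, hlt, dif_pos,
            Option.map_some]
        simp only [applyGate, hloc, setBit_joint]
        rw [← hstep, hc, if_pos rfl]
        exact h5 _ e)
  refine ⟨t, ht, h.ready.congr fun v hv => h1 v (by omega), h2.trans h.advPos,
    h3.trans h.weight, h4.trans h.sent, fun p hp u => ?_⟩
  rw [h5, ← hp.1, flipKeys_state, h.amp (p.clearVal (!b)) ⟨by simp [Memory.clearVal], hp.2⟩,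
    A.simulated_clearVal]

/-- The state of the adversary at the end, restricted to the response `z`. -/
structure Branch.Finished (A : Adversary S q E) (κ : Bool → ℕ) (wt : ℝ)
    (z : Bits (S.resp (pickBit κ))) (K : Memory S q → Prop) (u : Branch S W E) : Prop where
  weight : u.weight = wt
  sent : u.sent = List.ofFn z
  amp : ∀ p, K p → ∀ t : AdvBasis S E, (∀ j, t.1 (.outResp (pickBit κ) j) = z j) →
    u.amp (joint (p.state t.1) t.2) =
      superAmp S q * A.ideal κ (linHash p.coef) p.point p.val q t

theorem Branch.Simulates.le_branchSum_respond {x : Instances S} {a : Bits (S.com (pickBit κ))}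
    (h : s.Simulates A κ (firstStep κ) wt [] (Known κ (fun _ => false) x a))
    (hκ : ∀ β, κ β / 2 ≤ q) (c : Bits S.chal) (hW : 16 * maxIndex S q + 16 ≤ W)
    {f : Branch S W E → ℝ} {g : Bits (S.resp (pickBit κ)) → ℝ}
    (hfg : ∀ z u, u.Finished A κ wt z (Known κ c x a) → g z ≤ f u) :
    ∑ z, g z ≤ branchSum A (List.ofFn c) Sim.respond f s := by
  obtain ⟨s₁, e₁, h₁⟩ := Branch.Simulates.useChallenge
    (X := fun y => (∀ β j, y (.inst β j) = x β j) ∧ ∀ j : Fin (S.com (pickBit κ)),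
      y (.com (j.castLE (com_le_max S (pickBit κ)))) = a j) h c hW
  obtain ⟨s₂, e₂, h₂⟩ := h₁.stepsAfter (List.ofFn c) (hκ _) hW (by
    rintro p j u hj ⟨hp1, hp2⟩
    refine ⟨hp1, ?_⟩
    -- The register of the first point is written only at step `firstStep κ`.
    have hne : ¬ κ (pickBit κ) / 2 = j := fun h => by rw [firstStep] at hj; omega
    simp only [Memory.observe, if_neg hne]
    exact hp2)
  rw [Sim.respond, branchSum_seq, branchSum_of_eq e₁, branchSum_seq, branchSum_of_eq e₂,
    branchSum_ite_pick _ h₂.ready Sim.sendResp]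
  have h₃ := h₂.tick (1 + (Sim.v 10).cost s₂.vars)
  set s₃ := s₂.tick (1 + (Sim.v 10).cost s₂.vars)
  refine le_branchSum_sendLoop A _ ?_
    (x := fun j => if hj : j < S.resp (pickBit κ) then .inr (.outResp (pickBit κ) ⟨j, hj⟩)
      else .inl 0) (fun j hj σ hσ h12 => ?_) fun z u hu => hfg z u ⟨hu.weight.trans h₃.weight, ?_,
        fun p hp t ht => ?_⟩
  · cases pickBit κ
    · exact h₂.ready.inputs.all.2.2.2.2.2.2.1
    · exact h₂.ready.inputs.all.2.2.2.2.2.2.2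
  · refine ⟨.inr (.outResp (pickBit κ) ⟨j, hj⟩), ?_, by simp [hj]⟩
    simp [h₃.advPos, Sim.v, Expr.eval, h12, resolve, arrayIndex, hj]
  · rw [hu.sent, h₃.sent, List.nil_append]
  · rw [hu.amp, if_pos (fun j => by simp [ht j]), h₃.amp p ⟨hp.1, hp.2⟩, Adversary.simulated, if_pos]
    -- After q steps no point is left unobserved, so the simulated state is the ideal one.
    intro β hβ
    have := hκ β
    omega

end Phases

/-! ### The success probability of the prover -/

section Success

variable {S : Sizes} {W q : ℕ} {E : Type} [Fintype E] [DecidableEq E]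
  {A : Adversary S q E} {κ : Bool → ℕ} {wt : ℝ} {s : Branch S W E}

/-- The value `d` at `b`, and `c` at the other index. -/
def twoVals (b : Bool) (c d : Bits S.chal) (β : Bool) : Bits S.chal := if β = b then d else c

theorem sum_twoVals (b : Bool) (F : (Bool → Bits S.chal) → ℝ) :
    ∑ Θ, F Θ = ∑ c, ∑ d, F (twoVals b c d) := by
  rw [← (Equiv.boolArrowEquivProd (Bits S.chal)).symm.sum_comp, Fintype.sum_prod_type]
  have h : ∀ x y : Bits S.chal, (Equiv.boolArrowEquivProd (Bits S.chal)).symm (x, y) =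
      fun β => if β then y else x := fun x y => by
    funext β
    cases β <;> rfl
  simp only [h]
  cases b
  · rw [Finset.sum_comm]
    refine Finset.sum_congr rfl fun c _ => Finset.sum_congr rfl fun d _ => congrArg F ?_
    funext β
    cases β <;> rfl
  · refine Finset.sum_congr rfl fun c _ => Finset.sum_congr rfl fun d _ => congrArg F ?_
    funext β
    cases β <;> rfl

/-- The contents of the memory that belong to a final state `t` of the adversary. -/
def finalMemory (b : Bool) (x : Instances S) (c : Bits S.chal)
    (r : Fin S.chal → Fin (featLen S q) → Bool) (d : Bits S.chal) (t : AdvQubit S → Bool) :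
    Memory S q :=
  ⟨r, proofPoint x t, twoVals b c d⟩

/-- The hash function, the challenge in superposition, and the final state of the adversary. -/
abbrev FinalIndex (S : Sizes) (q : ℕ) (E : Type) : Type :=
  (Fin S.chal → Fin (featLen S q) → Bool) × Bits S.chal × AdvBasis S E

omit [Fintype E] [DecidableEq E] in
-- The coefficients r, the value d and the final state t are all readable from the basis state, so
-- different indices are orthogonal and their squared amplitudes add up.
theorem joint_finalMemory_injective (b : Bool) (x : Instances S) (c : Bits S.chal)
    (hW : 16 * maxIndex S q + 16 ≤ W) :
    Function.Injective fun k : FinalIndex S q E =>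
      (joint ((finalMemory b x c k.1 k.2.1 k.2.2.1).state k.2.2.1) k.2.2.2 : JointBasis S W E) := by
  rintro ⟨r, d, t, e⟩ ⟨r', d', t', e'⟩ h
  have h1 := congrArg Prod.fst h
  have ht : t = t' := funext fun k => congrFun h1 (.inr k)
  have he : e = e' := congrArg Prod.snd h
  subst ht he
  have hb := bitNum_le b
  have key : ∀ τ j, τ < 16 → 16 * j + τ < W →
      (finalMemory b x c r d t).array τ j = (finalMemory b x c r' d' t).array τ j := by
    intro τ j hτ hj
    rw [← Memory.state_wk _ t hτ, ← Memory.state_wk _ t hτ]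
    exact congrFun h1 (.inl ⟨_, hj⟩)
  have hr : r = r' := by
    funext j u
    have hj : (j : ℕ) * featLen S q + u < S.chal * featLen S q :=
      calc (j : ℕ) * featLen S q + u < (j + 1) * featLen S q := by
            rw [Nat.add_mul, Nat.one_mul]; exact Nat.add_lt_add_left u.2 _
        _ ≤ _ := Nat.mul_le_mul_right _ j.2
    have := key 12 (j * featLen S q + u) (by omega) (by simp only [maxIndex] at hW; omega)
    simpa [Memory.array, finalMemory, rawCoef_add] using this
  have hd : d = d' := by
    funext j
    have := key (10 + bitNum b) j (by omega) (by
      have := j.2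
      simp only [maxIndex] at hW
      omega)
    cases b <;> simpa [Memory.array, finalMemory, bitNum, rawVal, twoVals] using this
  rw [hr, hd]

/-- The probability of a final state of the adversary in the simulation. -/
def Adversary.finalWeight (A : Adversary S q E) (κ : Bool → ℕ) (x : Instances S)
    (c : Bits S.chal) (k : FinalIndex S q E) : ℝ :=
  ‖superAmp S q‖ ^ 2 * ‖A.ideal κ (linHash k.1) (proofPoint x k.2.2.1)
    (twoVals (pickBit κ) c k.2.1) q k.2.2‖ ^ 2

theorem known_finalMemory (κ : Bool → ℕ) (x : Instances S) (c : Bits S.chal)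
    (r : Fin S.chal → Fin (featLen S q) → Bool) (d : Bits S.chal) (t : AdvQubit S → Bool) :
    Known κ c x (fun j => t (.outCom (pickBit κ) j)) (finalMemory (pickBit κ) x c r d t) := by
  refine ⟨?_, fun _ _ => rfl, fun j => ?_⟩
  · simp [finalMemory, twoVals]
  · simp [finalMemory, proofPoint, hashInput]

open Classical in
-- The squared norm of the branch is bounded below by its part on the basis states whose memory
-- holds exactly the points of the final output.
theorem Branch.Finished.le_prob {x : Instances S} {c : Bits S.chal}
    {a : Bits (S.com (pickBit κ))} {z : Bits (S.resp (pickBit κ))} {u : Branch S W E}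
    (h : u.Finished A κ wt z (Known κ c x a)) (hwt : 0 ≤ wt)
    (hW : 16 * maxIndex S q + 16 ≤ W) (p : FinalIndex S q E → Prop) :
    wt * ∑ k : FinalIndex S q E, (if p k ∧ (a = fun j => k.2.2.1 (.outCom (pickBit κ) j)) ∧
      (z = fun j => k.2.2.1 (.outResp (pickBit κ) j)) then A.finalWeight κ x c k else 0) ≤
      u.prob := by
  rw [Branch.prob, h.weight]
  refine mul_le_mul_of_nonneg_left ?_ hwt
  set emb : FinalIndex S q E → JointBasis S W E := fun k =>
    joint ((finalMemory (pickBit κ) x c k.1 k.2.1 k.2.2.1).state k.2.2.1) k.2.2.2 with hemb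
  calc _ ≤ ∑ k : FinalIndex S q E, ‖u.amp (emb k)‖ ^ 2 := by
        refine Finset.sum_le_sum fun k _ => ?_
        split_ifs with hk
        · obtain ⟨-, ha, hz⟩ := hk
          subst ha
          have := h.amp _ (known_finalMemory κ x c k.1 k.2.1 k.2.2.1) k.2.2
            (fun j => (congrFun hz j).symm)
          rw [hemb]
          simp only [this, norm_mul, mul_pow, Adversary.finalWeight]
          rfl
        · positivity
    _ = ∑ k ∈ Finset.univ.image emb, ‖u.amp k‖ ^ 2 :=
        (Finset.sum_image (f := fun k => ‖u.amp k‖ ^ 2)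
          (joint_finalMemory_injective (pickBit κ) x c hW).injOn).symm
    _ ≤ _ := Finset.sum_le_sum_of_subset_of_nonneg (Finset.subset_univ _)
        fun _ _ _ => by positivity

open Classical in
/-- The contribution of an announcement to the success probability. -/
def successAfter (A : Adversary S q E) (V : Verifiers S) (x : Instances S) (c : Bits S.chal)
    (s : Branch S W E) : ℝ :=
  branchSum A [] Sim.commit (fun t => branchSum A (List.ofFn c) Sim.respond (fun u =>
    if (Outcome.mk s.sent t.sent u.sent u).Success V x c then u.prob else 0)
    { t with sent := [] }) { s with sent := [] }

open Classical in
theorem runs_sum_eq (A : Adversary S q E) (W : ℕ) (V : Verifiers S) (x : Instances S)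
    (c : Bits S.chal) :
    ((Sim.prover.runs A W c).map fun o => if o.Success V x c then o.final.prob else 0).sum =
      branchSum A [] Sim.announce (successAfter A V x c) (startBranch A W) := by
  simp only [Prover.runs, sum_map_flatMap, List.map_map]
  rfl

omit [DecidableEq E] in
theorem prob_nonneg {u : Branch S W E} (h : 0 ≤ u.weight) : 0 ≤ u.prob :=
  mul_nonneg h (Finset.sum_nonneg fun _ _ => by positivity)

theorem successAfter_nonneg (A : Adversary S q E) (V : Verifiers S) (x : Instances S)
    (c : Bits S.chal) (s : Branch S W E) (hs : 0 ≤ s.weight) : 0 ≤ successAfter A V x c s := by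
  refine branchSum_nonneg A _ _ (s := { s with sent := [] }) (fun t ht =>
    branchSum_nonneg A _ _ (s := { t with sent := [] }) (fun u hu => ?_) ht) hs
  split_ifs
  · exact prob_nonneg hu
  · exact le_rfl

/-- Each index belongs to exactly one pair of messages. This removes the restriction to measured
values once all branches are summed. -/
theorem sum_ite_eq_and {α β ι : Type*} [Fintype α] [Fintype β] [Fintype ι] [DecidableEq α]
    [DecidableEq β] (p : ι → Prop) [DecidablePred p] (f : ι → α) (g : ι → β) (w : ι → ℝ) :
    ∑ a, ∑ b, ∑ i, (if p i ∧ a = f i ∧ b = g i then w i else 0) =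
      ∑ i, if p i then w i else 0 := by
  have : ∀ a, ∑ b, ∑ i, (if p i ∧ a = f i ∧ b = g i then w i else 0) =
      ∑ i, if p i ∧ a = f i then w i else 0 := by
    intro a
    rw [Finset.sum_comm]
    refine Finset.sum_congr rfl fun i _ => ?_
    by_cases h : p i ∧ a = f i
    · simp [h]
    · simp only [← and_assoc, h, false_and, if_false, Finset.sum_const_zero]
  simp only [this]
  rw [Finset.sum_comm]
  refine Finset.sum_congr rfl fun i _ => ?_
  by_cases h : p i <;> simp [h]

open Classical in
/-- The contribution of the guess `κ` and the challenge `c` to the success probability. -/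
theorem le_branchSum_guess {V : Verifiers S} {x : Instances S} {c : Bits S.chal}
    (hs : InputsOk S q s.vars) (hκ : KappaOk κ s.vars) (hpos : s.advPos = 0)
    (hw : s.weight = wt) (hsent : s.sent = []) (hamp : s.amp = (startBranch A W).amp)
    (hκq : ∀ β, κ β / 2 ≤ q) (hwt : 0 ≤ wt) (hW : 16 * maxIndex S q + 16 ≤ W) :
    wt * ∑ k : FinalIndex S q E, (if Accepts V x (pickBit κ) c k.2.2.1 then
      A.finalWeight κ x c k else 0) ≤
      branchSum A [] (.seq Sim.prepare (.seq Sim.stepsBefore (.seq (.send (Sim.v 10))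
      (.seq (sendLoop (Sim.v 1) (Sim.pointBit (.add (Sim.c 1) (Sim.v 12))))
        (sendLoop (Sim.v 2) (Sim.pointBit (.add (.add (Sim.c 1) (Sim.v 1)) (Sim.v 12))))))))
        (successAfter A V x c) s := by
  set b := pickBit κ with hb
  obtain ⟨s₁, e₁, h₁⟩ := exec_prepare (A := A) [] hs hκ hpos hw hsent hamp hW
  obtain ⟨s₂, e₂, h₂⟩ := h₁.stepsBefore [] (hκq _) hW (fun _ _ _ h => h)
  set s₃ : Branch S W E := { s₂.tick (1 + (Sim.v 10).cost s₂.vars) with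
    sent := s₂.sent ++ [decide ((Sim.v 10).eval s₂.vars ≠ 0)] } with hs₃
  have e₃ : exec A [] (.send (Sim.v 10)) s₂ = [s₃] := rfl
  have h₃ : s₃.Simulates A κ (firstStep κ) wt [b]
      fun p => p.val (!pickBit κ) = fun _ => false := by
    refine ⟨h₂.ready, h₂.advPos, h₂.weight, ?_, h₂.amp⟩
    have : (Sim.v 10).eval s₂.vars = bitNum b := h₂.ready.pick
    simp only [hs₃, h₂.sent, this]
    cases b <;> rfl
  rw [branchSum_seq, branchSum_of_eq e₁, branchSum_seq, branchSum_of_eq e₂, branchSum_seq,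
    branchSum_of_eq e₃, branchSum_seq]
  refine h₃.le_branchSum_sendPoint_single hwt []
    (show (Sim.v 1).eval s₃.vars = S.inst false from h₃.ready.inputs.all.2.1)
    (fun j => .inst false j) (fun j σ hσ h12 => by simp [Expr.eval, Sim.c, Sim.v, h12, hashPos])
    hW (fun t ht => branchSum_nonneg A _ _ (successAfter_nonneg A V x c) ht) (x false)
    fun s₄ h₄ => ?_
  refine h₄.le_branchSum_sendPoint_single hwt []
    (show (Sim.v 2).eval s₄.vars = S.inst true from h₄.ready.inputs.all.2.2.1)
    (fun j => .inst true j) (fun j σ hσ h12 => by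
      simp [Expr.eval, Sim.c, Sim.v, h12, hashPos, hσ 1, h₄.ready.inputs.all.2.1])
    hW (successAfter_nonneg A V x c) (x true) fun s₅ h₅ => ?_
  have h₆ := (h₅.clearSent.mono (K' := fun p => p.val (!pickBit κ) = (fun _ => false) ∧
    ∀ β j, p.point (pickBit κ) (.inst β j) = x β j)
    fun p hp => ⟨⟨hp.1, hp.2 false⟩, hp.2 true⟩)
  -- Distribute the weight over the messages (a, z) that the branches measure.
  rw [← sum_ite_eq_and (fun k : FinalIndex S q E => Accepts V x b c k.2.2.1)
    (fun k j => k.2.2.1 (.outCom b j)) (fun k j => k.2.2.1 (.outResp b j)), Finset.mul_sum]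
  simp only [Finset.mul_sum (s := (Finset.univ : Finset (Bits (S.resp b))))]
  refine h₆.le_branchSum_commit [] hW fun a t ht => ?_
  refine ht.clearSent.le_branchSum_respond hκq c hW fun z u hu => ?_
  by_cases hV : V b (x b) a c z
  · rw [if_pos ⟨b, a, z, h₅.sent, ht.sent, hu.sent, hV⟩]
    exact hu.le_prob hwt hW _
  -- For a rejected transcript no final state with these messages satisfies `Accepts`, so the lower
  -- bound is zero.
  · refine le_trans (le_of_eq ?_) (show (0 : ℝ) ≤ _ from ?_)
    · rw [Finset.sum_eq_zero, mul_zero]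
      intro k _
      rw [if_neg]
      rintro ⟨h, rfl, rfl⟩
      exact hV h.2
    · split_ifs
      · exact prob_nonneg (by rw [hu.weight]; exact hwt)
      · exact le_rfl

theorem norm_superAmp_sq : ‖superAmp S q‖ ^ 2 = 1 / ((Fintype.card (Bits S.chal) : ℝ) *
    Fintype.card (Fin S.chal → Fin (featLen S q) → Bool)) := by
  rw [superAmp, norm_pow, norm_inv, Complex.norm_real, Real.norm_of_nonneg (Real.sqrt_nonneg _),
    ← pow_mul, mul_comm _ 2, pow_mul, inv_pow, Real.sq_sqrt (by norm_num)]
  simp only [Fintype.card_pi, Finset.prod_const, Finset.card_univ, Fintype.card_fin,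
    Fintype.card_bool]
  push_cast
  rw [inv_pow, one_div, ← pow_mul, ← pow_add]
  congr 2
  ring

open Classical in
-- The verifier's c is uniform on Θ_{!b}, and the squared superposition amplitude makes d on Θ_b and
-- the coefficients r uniform as well. Together this is the average that defines `simProb`.
theorem sum_finalWeight (A : Adversary S q E) (V : Verifiers S) (x : Instances S)
    (κ : Bool → ℕ) :
    (∑ c : Bits S.chal, ∑ k : FinalIndex S q E, (if Accepts V x (pickBit κ) c k.2.2.1 then
      A.finalWeight κ x c k else 0)) / (Fintype.card (Bits S.chal) : ℝ) = A.simProb V x κ := by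
  have hcard : (Fintype.card (Bool → Bits S.chal) : ℝ) =
      (Fintype.card (Bits S.chal) : ℝ) * Fintype.card (Bits S.chal) := by
    rw [Fintype.card_fun, Fintype.card_bool]
    push_cast
    ring
  rw [Adversary.simProb, sum_twoVals (pickBit κ), hcard]
  have hsum : ∀ c : Bits S.chal, ∑ k : FinalIndex S q E,
      (if Accepts V x (pickBit κ) c k.2.2.1 then A.finalWeight κ x c k else 0) =
      ‖superAmp S q‖ ^ 2 * ∑ d : Bits S.chal, ∑ r : Fin S.chal → Fin (featLen S q) → Bool,
        ∑ t : AdvBasis S E,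
        if Accepts V x (pickBit κ) (twoVals (pickBit κ) c d (!pickBit κ)) t.1 then
          ‖A.ideal κ (linHash r) (proofPoint x t.1) (twoVals (pickBit κ) c d) q t‖ ^ 2 else 0 := by
    intro c
    rw [Fintype.sum_prod_type, Finset.sum_congr rfl fun r _ => Fintype.sum_prod_type _,
      Finset.sum_comm, Finset.mul_sum]
    refine Finset.sum_congr rfl fun d _ => ?_
    rw [Finset.mul_sum]
    refine Finset.sum_congr rfl fun r _ => ?_
    rw [Finset.mul_sum]
    refine Finset.sum_congr rfl fun t _ => ?_
    have : twoVals (pickBit κ) c d (!pickBit κ) = c := by simp [twoVals]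
    rw [this, mul_ite, mul_zero]
    simp only [Adversary.finalWeight]
  simp only [hsum, ← Finset.mul_sum]
  rw [norm_superAmp_sq, div_mul_eq_mul_div, one_mul, div_div]
  congr 1
  ring

/-- Each guess κ has weight 1/(2q+1)². For every challenge the branches of different guesses are
summed, and `le_branchSum_guess` is applied to each. -/
theorem le_successProb_prover (A : Adversary S q E) (V : Verifiers S) (x : Instances S)
    (hW : 16 * maxIndex S q + 16 ≤ W) :
    1 / (2 * (q : ℝ) + 1) ^ 2 * ∑ k ∈ Finset.range (2 * q + 1), ∑ l ∈ Finset.range (2 * q + 1),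
      A.simProb V x (pairNat k l) ≤ Sim.prover.successProb A W V x := by
  classical
  set wt : ℝ := 1 / ((2 * q + 1 : ℕ) : ℝ) / ((2 * q + 1 : ℕ) : ℝ) with hwt
  have h0 : 0 ≤ wt := by positivity
  have hwt' : wt = 1 / (2 * (q : ℝ) + 1) ^ 2 := by
    rw [hwt, div_div]
    push_cast
    rw [sq]
  have hc : ∀ c : Bits S.chal, ∑ k ∈ Finset.range (2 * q + 1), ∑ l ∈ Finset.range (2 * q + 1),
      wt * ∑ j : FinalIndex S q E, (if Accepts V x (pickBit (pairNat k l)) c j.2.2.1 then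
        A.finalWeight (pairNat k l) x c j else 0) ≤
      branchSum A [] Sim.announce (successAfter A V x c) (startBranch A W) := by
    intro c
    have hin : InputsOk S q (startBranch A W).vars := fun _ _ => rfl
    have hN : ∀ {Γ : ℕ → ℕ}, InputsOk S q Γ →
        (Expr.add (.mul (Sim.c 2) (Sim.v 0)) (Sim.c 1)).eval Γ = 2 * q + 1 := fun h => by
      simp [Expr.eval, Sim.c, Sim.v, h.all.1]
    rw [Sim.announce, branchSum_seq, branchSum_rand A _ _ _ _ _ (hN hin) (by omega)]
    refine Finset.sum_le_sum fun k hk => ?_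
    have hin' : InputsOk S q (Function.update (startBranch A W).vars 8 k) :=
      hin.update (by omega) k
    rw [branchSum_seq, branchSum_rand A _ _ _ _ _ (hN hin') (by omega)]
    refine Finset.sum_le_sum fun l hl => ?_
    rw [Finset.mem_range] at hk hl
    refine le_branchSum_guess (κ := pairNat k l) (hin'.update (by omega) l) (fun β => ?_) rfl rfl
      rfl rfl (fun β => ?_) h0 hW
    · cases β
      · change Function.update (Function.update (inputVars S q) 8 k) 9 l 8 = k
        simp
      · change Function.update (Function.update (inputVars S q) 8 k) 9 l 9 = l
        simp
    · cases β <;> simp only [pairNat, if_true, if_false, Bool.false_eq_true] <;> omega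
  rw [Prover.successProb, ← hwt']
  simp only [runs_sum_eq]
  refine le_trans (le_of_eq ?_) (div_le_div_of_nonneg_right
    (Finset.sum_le_sum fun c _ => hc c) (Nat.cast_nonneg _))
  simp only [← sum_finalWeight]
  symm
  rw [Finset.sum_comm, Finset.sum_div, Finset.mul_sum]
  refine Finset.sum_congr rfl fun k _ => ?_
  rw [Finset.sum_comm, Finset.sum_div, Finset.mul_sum]
  refine Finset.sum_congr rfl fun l _ => ?_
  rw [← Finset.mul_sum, mul_div_assoc]

theorem exists_work_bound : ∃ p : Polynomial ℕ, ∀ (S : Sizes) (q : ℕ),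
    16 * maxIndex S q + 16 ≤ p.eval (q + S.total) := by
  let X : Polynomial ℕ := Polynomial.X
  let F : Polynomial ℕ := (2 * X + 1) * ((2 * X + 2) * (X + 1))
  refine ⟨16 * (X * F + F + (X + 1) + X) + 16, fun S q => ?_⟩
  set n := q + S.total with hn
  have h1 : S.chal ≤ n := by simp only [hn, Sizes.total]; omega
  have h2 : hashLen S ≤ n + 1 := by
    simp only [hashLen, hn, Sizes.total]
    omega
  have h3 : q ≤ n := by omega
  have h4 : featLen S q ≤ (2 * n + 1) * ((2 * n + 2) * (n + 1)) := by
    simp only [featLen, rowLen]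
    gcongr
  have h5 := Nat.mul_le_mul h1 h4
  simp only [maxIndex, X, F, Polynomial.eval_add, Polynomial.eval_mul, Polynomial.eval_X,
    Polynomial.eval_ofNat, Polynomial.eval_one]
  omega

end Success

end SeqOr

end
/-- There are a single prover program and a polynomial `p` such that, for all message lengths, all
`q` and all `q`-query adversaries `A`, the prover with black-box access to `A` uses at most `p(s)`
work qubits and at most `p(s)` steps, where `s` is `q` plus the sum of all message lengths, and has
the stated probability of success. -/
theorem mainTheorem12 :
    ∃ (P : SeqOr.Prover) (p : Polynomial ℕ),
      ∀ (S : SeqOr.Sizes) (q : ℕ) (E : Type) [Fintype E] [DecidableEq E]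
        (A : SeqOr.Adversary S q E),
        P.RunsInTime A (p.eval (q + S.total)) (p.eval (q + S.total)) ∧
        ∀ (V : SeqOr.Verifiers S) (x : SeqOr.Instances S),
          P.successProb A (p.eval (q + S.total)) V x ≥
            1 / (2 * (q : ℝ) + 1) ^ 4 * A.successProb V x := by
  obtain ⟨pT, hT⟩ := SeqOr.Prover.exists_time_le SeqOr.Sim.prover (by decide) (by decide)
    (by decide)
  obtain ⟨pW, hW⟩ := SeqOr.exists_work_bound
  -- The sum of the two polynomials serves for both bounds: the time bound holds for any number of
  -- work qubits, and extra work qubits do no harm.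
  refine ⟨SeqOr.Sim.prover, pT + pW, fun S q E _ _ A => ⟨fun c o ho => ?_, fun V x => ?_⟩⟩
  · refine (hT S _ q E A c o ho).trans ?_
    rw [Polynomial.eval_add]
    exact Nat.le_add_right _ _
  · have h1 := SeqOr.le_successProb_prover A V x (W := (pT + pW).eval (q + S.total)) (by
      rw [Polynomial.eval_add]
      exact (hW S q).trans (Nat.le_add_left _ _))
    have h2 := A.successProb_le V x
    have hq : (0 : ℝ) < 2 * (q : ℝ) + 1 := by positivity
    refine ge_iff_le.2 (le_trans ?_ h1)
    calc _ ≤ 1 / (2 * (q : ℝ) + 1) ^ 4 * _ := mul_le_mul_of_nonneg_left h2 (by positivity)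
      _ = _ := by
        rw [← mul_assoc]
        congr 1
        field_simp
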